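/- **Setting.** Let $d,K\in\mathbb N$, $d,K\ge 1$. We consider triples $(\Omega,\mathcal T,\Gamma)$, where $\Omega\subset\mathbb R^d$ is a bounded polyhedral domain (a bounded connected open set), $\mathcal T$ is a regular (conforming) triangulation of $\overline\Omega$ into finitely many closed $d$-simplices such that $\partial\Omega$ is a union of $(d-1)$-dimensional faces, and $\Gamma\subseteq\partial\Omega$ is resolved by $\mathcal T$, i.e. a (possibly empty) union of $(d-1)$-dimensional faces. Let $$\mathcal L^1_{K,\Gamma}(\mathcal T)=\{v\in W^{1,\infty}(\Omega): v|_T \text{ is a polynomial of degree}\le K\text{ for all }T\in\mathcal T,\ v|_\Gamma=0\},$$ and let $Q_\Gamma:L^1(\Omega)\to\mathcal L^1_{K,\Gamma}(\mathcal T)$ be the $L^2$-projection, $\int_\Omega (Q_\Gamma u)\,w\,dx=\int_\Omega u\,w\,dx$ for all $w\in\mathcal L^1_{K,\Gamma}(\mathcal T)$. Let $W^{1,p}_\Gamma(\Omega)=\{u\in W^{1,p}(\Omega):u|_\Gamma=0\}$, in the sense of traces. Let $\delta$ be the geodesic distance on $\mathcal T$ for which distinct simplices are neighbors ($\delta(T,T')=1$)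 if and only if they share a vertex. A positive function $\rho\in L^1(\Omega)$ is a *weight with grading* $\gamma_\rho\ge1$ if $\operatorname{ess\,sup}_T\rho\le\gamma_\rho\operatorname{ess\,inf}_T\rho$ for all $T\in\mathcal T$, and $\operatorname{ess\,sup}_{T'}\rho\le\gamma_\rho\operatorname{ess\,sup}_T\rho$, $\operatorname{ess\,inf}_{T'}\rho\le\gamma_\rho\operatorname{ess\,inf}_T\rho$ whenever $\delta(T,T')=1$. A *mesh size function with grading* $\gamma_h$ and equivalence constant $\kappa$ is a weight $h$ with grading $\gamma_h$ such that $\operatorname{diam}T\le\kappa\operatorname{ess\,inf}_T h$ and $\operatorname{ess\,sup}_T h\le\kappa\operatorname{diam}T$ for all $T\in\mathcal T$. The shape regularity parameter of $\mathcal T$ is at most $\chi_0$ if every $T\in\mathcal T$ contains a closed ball of some radius $r>0$ with $\operatorname{diam}T\le\chi_0\,r$. Let $\mathfrak F$ be any class of such triples in dimension $d$ (for instance all of them). The *worst grading* $\gamma_{\max}=\gamma_{\max}(\mathfrak F,K)\in[1,\infty]$ is the supremum of all $\gamma\ge1$ for which there is a constant $C(\gamma)<\infty$ such that $\|\rho\,Q_\Gamma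 u\|_{L^2(\Omega)}\le C(\gamma)\|\rho u\|_{L^2(\Omega)}$ for all $(\Omega,\mathcal T,\Gamma)\in\mathfrak F$, all weights $\rho$ with grading $\gamma$ and all $u\in L^2(\Omega)$. **Theorem 4.14.** Let $d,K\ge1$, $\mathfrak F$ and $\gamma_{\max}$ be as above, and let $p\in[1,\infty]$, $\gamma_\rho,\gamma_h\ge1$, and $\chi_0,\kappa\in\mathbb R$. (i) ($L^p$-stability) If $\gamma_\rho\,\gamma_h^{d|\frac12-\frac1p|}<\gamma_{\max}$, then there is a constant $c<\infty$, depending only on $\gamma_\rho,\gamma_h,d,p,K,\chi_0,\kappa$ and on the class $\mathfrak F$, such that for all $(\Omega,\mathcal T,\Gamma)\in\mathfrak F$ with shape regularity parameter at most $\chi_0$ that admit a mesh size function with grading $\gamma_h$ and equivalence constant $\kappa$, and for all weights $\rho$ with grading $\gamma_\rho$, $$\|\rho\,Q_\Gamma u\|_{L^p(\Omega)}\le c\,\|\rho\,u\|_{L^p(\Omega)}\qquad\text{for all }u\in L^p(\Omega).$$ (ii) ($W^{1,p}$-stability) If $\gamma_\rho\,\gamma_h^{1+d|\frac12-\frac1p|}<\gamma_{\max}$,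 then there is a constant $c<\infty$ with the same dependence such that, for the same triples and weights, $$\|\rho\,\nabla Q_\Gamma u\|_{L^p(\Omega)}\le c\,\|\rho\,\nabla u\|_{L^p(\Omega)}\qquad\text{for all }u\in W^{1,p}_\Gamma(\Omega).$$ -/

import Mathlib

open MeasureTheory
open scoped ENNReal NNReal ContDiff

namespace FEM

/-- `ℝᵈ` with its Euclidean norm. -/
abbrev Space (d : ℕ) : Type := EuclideanSpace ℝ (Fin d)

/-- `S` is the union of a collection of closed `(d-1)`-dimensional faces of the complex `𝒦`. -/
def IsFacetUnion {d : ℕ} (𝒦 : Geometry.SimplicialComplex ℝ (Space d)) (S : Set (Space d)) : Prop :=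
  ∃ B : Set (Finset (Space d)), (∀ F ∈ B, F ∈ 𝒦.faces ∧ F.card = d) ∧
    S = ⋃ F ∈ B, convexHull ℝ (F : Set (Space d))

/-- A bounded polyhedral domain `Ω ⊆ ℝᵈ`, a regular (that is, conforming, with no hanging nodes)
triangulation of it into finitely many closed simplices, and a part `Γ` of the boundary of `Ω` that
is resolved by the triangulation. The triangulation is a geometric simplicial complex all of whose
faces lie in `d`-dimensional ones. -/
structure Triangulation (d : ℕ) where
  /-- the domain -/
  Ω : Set (Space d)
  isOpen : IsOpen Ω
  isConnected : IsConnected Ω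
  isBounded : Bornology.IsBounded Ω
  /-- the simplices of the triangulation and all their faces -/
  complex : Geometry.SimplicialComplex ℝ (Space d)
  finite_faces : complex.faces.Finite
  pure : ∀ s ∈ complex.faces, ∃ t ∈ complex.faces, s ⊆ t ∧ t.card = d + 1
  closure_eq : closure Ω = complex.space
  frontier_resolved : IsFacetUnion complex (frontier Ω)
  /-- the part of the boundary that carries the zero boundary values -/
  Γ : Set (Space d)
  Γ_subset : Γ ⊆ frontier Ω
  Γ_resolved : IsFacetUnion complex Γ

/-- `g` is the weak gradient of `u` on the open set `Ω`. (It is only used for functions `u` and `g`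
that are integrable on `Ω`.) -/
def HasWeakGradient {d : ℕ} (Ω : Set (Space d)) (u : Space d → ℝ) (g : Space d → Space d) : Prop :=
  ∀ φ : Space d → ℝ, ContDiff ℝ ∞ φ → HasCompactSupport φ → tsupport φ ⊆ Ω → ∀ e : Space d,
    ∫ x in Ω, u x * fderiv ℝ φ x e = - ∫ x in Ω, inner ℝ (g x) e * φ x

/-- `u ∈ W^{1,p}(Ω)`, with `∇u = g`. -/
def HasSobolevGradient {d : ℕ} (Ω : Set (Space d)) (p : ℝ≥0∞) (u : Space d → ℝ)
    (g : Space d → Space d) : Prop :=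
  MemLp u p (volume.restrict Ω) ∧ MemLp g p (volume.restrict Ω) ∧ HasWeakGradient Ω u g

namespace Triangulation

variable {d : ℕ} (M : Triangulation d)

/-- The elements `T ∈ 𝒯`, given by their `d + 1` vertices. -/
def Cell : Type := {s : Finset (Space d) // s ∈ M.complex.faces ∧ s.card = d + 1}

variable {M} in
/-- The closed simplex spanned by the vertices of `T`. -/
def Cell.simplex (T : M.Cell) : Set (Space d) := convexHull ℝ (T.1 : Set (Space d))

variable {M} in
/-- `F` is (the vertex set of) a `(d-1)`-dimensional face of `T`. -/
def Cell.IsFacet (T : M.Cell) (F : Finset (Space d)) : Prop := F ⊆ T.1 ∧ F.card = d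

/-- `L^1_{K,Γ}(𝒯)`: the functions in `W^{1,∞}(Ω)` that on each element agree with a polynomial of
degree at most `K`, and that vanish on `Γ`. -/
def MemLagrange (K : ℕ) (v : Space d → ℝ) : Prop :=
  (∃ g, HasSobolevGradient M.Ω ∞ v g) ∧
    ∀ T : M.Cell, ∃ P : MvPolynomial (Fin d) ℝ, P.totalDegree ≤ K ∧
      (∀ᵐ x ∂volume.restrict M.Ω, x ∈ T.simplex → v x = MvPolynomial.eval (fun i => x i) P) ∧
      ∀ F, T.IsFacet F → convexHull ℝ (F : Set (Space d)) ⊆ M.Γ →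
        ∀ x ∈ convexHull ℝ (F : Set (Space d)), MvPolynomial.eval (fun i => x i) P = 0

/-- `v` is the `L²`-projection of `u ∈ L¹(Ω)` to `L^1_{K,Γ}(𝒯)`. -/
def IsL2Projection (K : ℕ) (u v : Space d → ℝ) : Prop :=
  M.MemLagrange K v ∧
    ∀ w, M.MemLagrange K w → ∫ x in M.Ω, v x * w x = ∫ x in M.Ω, u x * w x

open Classical in
/-- The `L²`-projection `Q_Γ`, extended to `L¹(Ω)`; see `isL2Projection_Q`. -/
noncomputable def Q (K : ℕ) (u : Space d → ℝ) : Space d → ℝ :=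
  if h : ∃ v, M.IsL2Projection K u v then h.choose else 0

/-- The (nodal) neighbor relation: distinct elements that share a vertex. -/
def neighborGraph : SimpleGraph M.Cell where
  Adj T T' := T ≠ T' ∧ ∃ i, i ∈ T.1 ∧ i ∈ T'.1
  symm := ⟨fun _ _ h => ⟨h.1.symm, h.2.imp fun _ hi => hi.symm⟩⟩
  loopless := ⟨fun _ h => h.1 rfl⟩

/-- The geodesic distance `δ` on the elements. -/
noncomputable def δ (T T' : M.Cell) : ℕ := M.neighborGraph.dist T T'

/-- The essential supremum over an element. -/
noncomputable def Cell.esssup {M : Triangulation d} (T : M.Cell) (ρ : Space d → ℝ) : ℝ≥0∞ :=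
  essSup (fun x => ENNReal.ofReal (ρ x)) (volume.restrict T.simplex)

/-- The essential infimum over an element. -/
noncomputable def Cell.essinf {M : Triangulation d} (T : M.Cell) (ρ : Space d → ℝ) : ℝ≥0∞ :=
  essInf (fun x => ENNReal.ofReal (ρ x)) (volume.restrict T.simplex)

/-- `ρ` is a weight with grading `γ`. -/
structure IsWeight (ρ : Space d → ℝ) (γ : ℝ) : Prop where
  one_le : 1 ≤ γ
  integrable : IntegrableOn ρ M.Ω
  pos : ∀ᵐ x ∂volume.restrict M.Ω, 0 < ρ x
  esssup_le_essinf : ∀ T : M.Cell, T.esssup ρ ≤ ENNReal.ofReal γ * T.essinf ρ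
  esssup_le : ∀ T T' : M.Cell, M.δ T T' = 1 → T'.esssup ρ ≤ ENNReal.ofReal γ * T.esssup ρ
  essinf_le : ∀ T T' : M.Cell, M.δ T T' = 1 → T'.essinf ρ ≤ ENNReal.ofReal γ * T.essinf ρ

/-- `h` is a mesh size function with grading `γ`, equivalent to the diameters of the elements with
constant `κ`. -/
structure IsMeshSize (h : Space d → ℝ) (γ κ : ℝ) : Prop extends M.IsWeight h γ where
  diam_le : ∀ T : M.Cell, ENNReal.ofReal (Metric.diam T.simplex) ≤ ENNReal.ofReal κ * T.essinf h
  le_diam : ∀ T : M.Cell, T.esssup h ≤ ENNReal.ofReal κ * ENNReal.ofReal (Metric.diam T.simplex)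

/-- Every element contains a ball of radius comparable to the diameter of the element. -/
def ShapeRegular (χ : ℝ) : Prop :=
  ∀ T : M.Cell, ∃ (x : Space d) (r : ℝ), 0 < r ∧ Metric.closedBall x r ⊆ T.simplex ∧
    Metric.diam T.simplex ≤ χ * r

/-- The function `u` with gradient `g` has zero trace on `Γ`: on every element `T` with a facet `F`
in `Γ`, the trace of `u|_T` on `F` is zero. By the Gauss-Green formula the integral below equals
`∫_F (tr u) φ (ν · e)` with `ν` the outer unit normal of `T` on `F`, as `φ` vanishes on the other
facets of `T`. -/
def HasZeroTrace (u : Space d → ℝ) (g : Space d → Space d) : Prop :=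
  ∀ (T : M.Cell) (F : Finset (Space d)), T.IsFacet F → convexHull ℝ (F : Set (Space d)) ⊆ M.Γ →
    ∀ φ : Space d → ℝ, ContDiff ℝ ∞ φ →
      (∀ F', T.IsFacet F' → F' ≠ F → ∀ x ∈ convexHull ℝ (F' : Set (Space d)), φ x = 0) →
      ∀ e : Space d, ∫ x in T.simplex, (u x * fderiv ℝ φ x e + inner ℝ (g x) e * φ x) = 0

/-- `u ∈ W^{1,p}_Γ(Ω)`, with `∇u = g`. -/
def HasSobolevGradientΓ (p : ℝ≥0∞) (u : Space d → ℝ) (g : Space d → Space d) : Prop :=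
  HasSobolevGradient M.Ω p u g ∧ M.HasZeroTrace u g

/-! ### The `L²`-projection is well defined -/

section WellDefined

variable {M}

lemma isFiniteMeasure (M : Triangulation d) : IsFiniteMeasure (volume.restrict M.Ω) :=
  ⟨by simpa using M.isBounded.measure_lt_top⟩

lemma memLagrange_congr {K : ℕ} {v w : Space d → ℝ} (hv : M.MemLagrange K v)
    (h : v =ᵐ[volume.restrict M.Ω] w) : M.MemLagrange K w := by
  obtain ⟨⟨g, hv1, hg, hvg⟩, hP⟩ := hv
  refine ⟨⟨g, hv1.ae_eq h, hg, fun φ h1 h2 h3 e => ?_⟩, fun T => ?_⟩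
  · rw [← hvg φ h1 h2 h3 e]
    refine integral_congr_ae ?_
    filter_upwards [h] with x hx
    rw [hx]
  · obtain ⟨P, hP1, hP2, hP3⟩ := hP T
    refine ⟨P, hP1, ?_, hP3⟩
    filter_upwards [hP2, h] with x hx hx' hT
    rw [← hx', hx hT]

lemma memLagrange_zero (K : ℕ) : M.MemLagrange K (0 : Space d → ℝ) := by
  refine ⟨⟨0, MemLp.zero, MemLp.zero, fun φ _ _ _ e => by simp⟩, fun T => ⟨0, by simp, by simp, ?_⟩⟩
  intros
  simp

lemma memLagrange_smul {K : ℕ} {v : Space d → ℝ} (hv : M.MemLagrange K v) (c : ℝ) :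
    M.MemLagrange K (c • v) := by
  obtain ⟨⟨g, hv1, hg, hvg⟩, hP⟩ := hv
  refine ⟨⟨c • g, hv1.const_smul c, hg.const_smul c, fun φ h1 h2 h3 e => ?_⟩, fun T => ?_⟩
  · simp only [Pi.smul_apply, smul_eq_mul, inner_smul_left, mul_assoc, integral_const_mul,
      hvg φ h1 h2 h3 e]
    simp
  · obtain ⟨P, hP1, hP2, hP3⟩ := hP T
    refine ⟨c • P, (MvPolynomial.totalDegree_smul_le c P).trans hP1, ?_, fun F hF hΓ x hx => ?_⟩
    · filter_upwards [hP2] with x hx hT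
      simp [hx hT]
    · simp [hP3 F hF hΓ x hx]

lemma memLagrange_add {K : ℕ} {v w : Space d → ℝ} (hv : M.MemLagrange K v)
    (hw : M.MemLagrange K w) : M.MemLagrange K (v + w) := by
  have := M.isFiniteMeasure
  obtain ⟨⟨g, hv1, hg, hvg⟩, hP⟩ := hv
  obtain ⟨⟨g', hw1, hg', hwg⟩, hR⟩ := hw
  refine ⟨⟨g + g', hv1.add hw1, hg.add hg', fun φ h1 h2 h3 e => ?_⟩, fun T => ?_⟩
  · have hφ : MemLp φ ∞ (volume.restrict M.Ω) := by
      obtain ⟨C, hC⟩ := h1.continuous.bounded_above_of_compact_support h2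
      exact memLp_top_of_bound h1.continuous.aestronglyMeasurable C (.of_forall hC)
    have hφ' : MemLp (fun x => fderiv ℝ φ x e) ∞ (volume.restrict M.Ω) := by
      have hc : Continuous fun x => fderiv ℝ φ x e :=
        (h1.continuous_fderiv (by simp)).clm_apply continuous_const
      obtain ⟨C, hC⟩ := hc.bounded_above_of_compact_support (h2.fderiv_apply ℝ e)
      exact memLp_top_of_bound hc.aestronglyMeasurable C (.of_forall hC)
    have key (f f' : Space d → ℝ) (hf : MemLp f ∞ (volume.restrict M.Ω))
        (hf' : MemLp f' ∞ (volume.restrict M.Ω)) :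
        Integrable (fun x => f x * f' x) (volume.restrict M.Ω) :=
      (hf'.mul hf : MemLp _ ∞ _).integrable (by simp)
    have hi (k : Space d → Space d) (hk : MemLp k ∞ (volume.restrict M.Ω)) :
        MemLp (fun x => inner ℝ (k x) e) ∞ (volume.restrict M.Ω) :=
      hk.inner_const e
    simp only [Pi.add_apply, inner_add_left, add_mul]
    rw [integral_add (key _ _ hv1 hφ') (key _ _ hw1 hφ'),
      integral_add (key _ _ (hi _ hg) hφ) (key _ _ (hi _ hg') hφ), hvg φ h1 h2 h3 e,
      hwg φ h1 h2 h3 e, neg_add]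
  · obtain ⟨P, hP1, hP2, hP3⟩ := hP T
    obtain ⟨R, hR1, hR2, hR3⟩ := hR T
    refine ⟨P + R, (MvPolynomial.totalDegree_add P R).trans (max_le hP1 hR1), ?_,
      fun F hF hΓ x hx => ?_⟩
    · filter_upwards [hP2, hR2] with x hx hx' hT
      simp [hx hT, hx' hT]
    · simp [hP3 F hF hΓ x hx, hR3 F hF hΓ x hx]

lemma memLp_two_of_memLagrange {K : ℕ} {v : Space d → ℝ} (hv : M.MemLagrange K v) :
    MemLp v 2 (volume.restrict M.Ω) := by
  have := M.isFiniteMeasure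
  exact hv.1.choose_spec.1.mono_exponent le_top

/-- `L^1_{K,Γ}(𝒯)` as a subspace of `L²(Ω)`. -/
def lagrangeSubmodule (M : Triangulation d) (K : ℕ) :
    Submodule ℝ (Lp ℝ 2 (volume.restrict M.Ω)) where
  carrier := {f | M.MemLagrange K f}
  add_mem' ha hb := memLagrange_congr (memLagrange_add ha hb) (Lp.coeFn_add _ _).symm
  zero_mem' := memLagrange_congr (memLagrange_zero K) (Lp.coeFn_zero _ _ _).symm
  smul_mem' c _ ha := memLagrange_congr (memLagrange_smul ha c) (Lp.coeFn_smul _ _).symm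

lemma finite_cell (M : Triangulation d) : Finite M.Cell :=
  (Set.Finite.subset M.finite_faces
    (fun _ h => h.1 : {s | s ∈ M.complex.faces ∧ s.card = d + 1} ⊆ M.complex.faces)).to_subtype

lemma exists_mem_simplex {x : Space d} (hx : x ∈ M.Ω) : ∃ T : M.Cell, x ∈ T.simplex := by
  have h := subset_closure hx
  rw [M.closure_eq, Geometry.SimplicialComplex.mem_space_iff] at h
  obtain ⟨s, hs, hxs⟩ := h
  obtain ⟨t, ht, hst, hcard⟩ := M.pure s hs
  exact ⟨⟨t, ht, hcard⟩, convexHull_mono (by exact_mod_cast hst) hxs⟩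

lemma isCompact_simplex (T : M.Cell) : IsCompact T.simplex :=
  T.1.finite_toSet.isCompact_convexHull ℝ

lemma memLp_eval (T : M.Cell) (P : MvPolynomial (Fin d) ℝ) :
    MemLp (fun x : Space d => MvPolynomial.eval (fun i => x i) P) 2
      ((volume.restrict M.Ω).restrict T.simplex) := by
  have := M.isFiniteMeasure
  have hc : Continuous fun x : Space d => MvPolynomial.eval (fun i => x i) P :=
    (MvPolynomial.continuous_eval P).comp (by fun_prop)
  obtain ⟨C, hC⟩ := (isCompact_simplex T).exists_bound_of_continuousOn hc.continuousOn
  refine MemLp.of_bound hc.aestronglyMeasurable C ?_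
  exact (ae_restrict_iff' (isCompact_simplex T).measurableSet).2 (.of_forall hC)

/-- The polynomials of degree at most `K` on an element, as elements of `L²`. -/
noncomputable def evalLp (K : ℕ) (T : M.Cell) :
    MvPolynomial.restrictTotalDegree (Fin d) ℝ K →ₗ[ℝ]
      Lp ℝ 2 ((volume.restrict M.Ω).restrict T.simplex) where
  toFun P := (memLp_eval T P.1).toLp
  map_add' P R := by
    rw [← MemLp.toLp_add]
    congr 1
    ext x
    simp
  map_smul' c P := by
    rw [RingHom.id_apply, ← MemLp.toLp_const_smul]
    congr 1
    ext x
    simp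

instance finiteDimensional_lagrange (M : Triangulation d) (K : ℕ) :
    FiniteDimensional ℝ (lagrangeSubmodule M K) := by
  have := M.finite_cell
  let r (T : M.Cell) := (LpToLpRestrictCLM (Space d) ℝ ℝ (volume.restrict M.Ω) 2 T.simplex).toLinearMap
  have hr (f : lagrangeSubmodule M K) (T : M.Cell) : r T f.1 ∈ LinearMap.range (evalLp K T) := by
    obtain ⟨P, hP1, hP2, -⟩ := f.2.2 T
    refine ⟨⟨P, (MvPolynomial.mem_restrictTotalDegree _ _ _).2 hP1⟩, ?_⟩
    refine Lp.ext ((MemLp.coeFn_toLp (memLp_eval T P)).trans ?_)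
    refine Filter.EventuallyEq.trans ?_ (LpToLpRestrictCLM_coeFn ℝ T.simplex f.1).symm
    refine (ae_restrict_iff' (isCompact_simplex T).measurableSet).2 ?_
    filter_upwards [hP2] with x hx hT
    exact (hx hT).symm
  let R : lagrangeSubmodule M K →ₗ[ℝ] (T : M.Cell) → LinearMap.range (evalLp K T) :=
    LinearMap.pi fun T => ((r T).comp (lagrangeSubmodule M K).subtype).codRestrict _ fun f => hr f T
  refine Module.Finite.of_injective R ((injective_iff_map_eq_zero R).2 fun f hf => ?_)
  refine Subtype.ext (Lp.ext ((?_ : _ =ᵐ[_] (0 : Space d → ℝ)).trans (Lp.coeFn_zero _ _ _).symm))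
  have h0 (T : M.Cell) : ∀ᵐ x ∂volume.restrict M.Ω, x ∈ T.simplex → f.1 x = 0 := by
    have h1 : r T f.1 = 0 := congrArg Subtype.val (congrFun hf T)
    refine (ae_restrict_iff' (isCompact_simplex T).measurableSet).1 ?_
    have h2 := LpToLpRestrictCLM_coeFn ℝ T.simplex f.1
    have h3 : (r T f.1 : Space d → ℝ) =ᵐ[(volume.restrict M.Ω).restrict T.simplex] 0 := by
      rw [h1]; exact Lp.coeFn_zero _ _ _
    filter_upwards [h2, h3] with x hx hx'
    rw [← hx]; exact hx'
  filter_upwards [ae_all_iff.2 h0, ae_restrict_mem M.isOpen.measurableSet] with x hx hΩ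
  obtain ⟨T, hT⟩ := exists_mem_simplex hΩ
  exact hx T hT

theorem exists_isL2Projection (K : ℕ) {u : Space d → ℝ} (hu : IntegrableOn u M.Ω) :
    ∃ v, M.IsL2Projection K u v := by
  have hint (f : Space d → ℝ) (hf : M.MemLagrange K f) : IntegrableOn (fun x => u x * f x) M.Ω := by
    have h := hf.1.choose_spec.1
    exact memLp_one_iff_integrable.1 (h.mul (memLp_one_iff_integrable.2 hu) : MemLp _ 1 _)
  let ℓ : lagrangeSubmodule M K →ₗ[ℝ] ℝ :=
    { toFun := fun f => ∫ x in M.Ω, u x * f.1 x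
      map_add' := fun f g => by
        rw [← integral_add (hint _ f.2) (hint _ g.2)]
        refine integral_congr_ae ?_
        filter_upwards [Lp.coeFn_add f.1 g.1] with x hx
        rw [← mul_add, Submodule.coe_add, hx, Pi.add_apply]
      map_smul' := fun c f => by
        rw [RingHom.id_apply, smul_eq_mul, ← integral_const_mul]
        refine integral_congr_ae ?_
        filter_upwards [Lp.coeFn_smul c f.1] with x hx
        simp [hx, mul_left_comm] }
  let v := (InnerProductSpace.toDual ℝ (lagrangeSubmodule M K)).symm ℓ.toContinuousLinearMap
  refine ⟨v.1, v.2, fun w hw => ?_⟩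
  have hw2 := memLp_two_of_memLagrange hw
  let W : lagrangeSubmodule M K := ⟨hw2.toLp, memLagrange_congr hw hw2.coeFn_toLp.symm⟩
  have h : inner ℝ v W = ℓ W := InnerProductSpace.toDual_symm_apply
  have h1 : inner ℝ v W = ∫ x in M.Ω, v.1 x * w x := by
    rw [Submodule.coe_inner, L2.inner_def]
    refine integral_congr_ae ?_
    filter_upwards [hw2.coeFn_toLp] with x hx
    simp [W, hx, mul_comm]
  have h2 : ℓ W = ∫ x in M.Ω, u x * w x := by
    refine integral_congr_ae ?_
    filter_upwards [hw2.coeFn_toLp] with x hx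
    simp [W, hx]
  rw [← h1, h, h2]

theorem isL2Projection_Q (K : ℕ) {u : Space d → ℝ} (hu : IntegrableOn u M.Ω) :
    M.IsL2Projection K u (M.Q K u) := by
  have h := exists_isL2Projection K hu
  rw [Q, dif_pos h]
  exact h.choose_spec

theorem IsL2Projection.ae_eq {K : ℕ} {u v v' : Space d → ℝ} (hv : M.IsL2Projection K u v)
    (hv' : M.IsL2Projection K u v') : v =ᵐ[volume.restrict M.Ω] v' := by
  have hw : M.MemLagrange K (v + (-1 : ℝ) • v') := memLagrange_add hv.1 (memLagrange_smul hv'.1 _)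
  have h2 := memLp_two_of_memLagrange hv.1
  have h2' := memLp_two_of_memLagrange hv'.1
  have hW := memLp_two_of_memLagrange hw
  have h : ∫ x in M.Ω, (v + (-1 : ℝ) • v') x * (v + (-1 : ℝ) • v') x = 0 := by
    have hs : ∀ x, (v + (-1 : ℝ) • v') x * (v + (-1 : ℝ) • v') x =
        v x * (v + (-1 : ℝ) • v') x - v' x * (v + (-1 : ℝ) • v') x := fun x => by
      simp; ring
    simp_rw [hs]
    refine (integral_sub (h2.integrable_mul hW) (h2'.integrable_mul hW)).trans ?_
    exact sub_eq_zero.2 ((hv.2 _ hw).trans (hv'.2 _ hw).symm)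
  rw [integral_eq_zero_iff_of_nonneg (fun x => mul_self_nonneg _) (hW.integrable_mul hW)] at h
  filter_upwards [h] with x hx
  have : v x + -1 * v' x = 0 := by simpa using hx
  linarith

end WellDefined

end Triangulation

/-- `γ` is an admissible grading for a class `𝔉` of triangulations: the projections `Q_Γ` are
stable in the weighted `L²`-norms, for all weights with grading `γ`, uniformly in the class. -/
def WeightedL2Stable {d : ℕ} (𝔉 : Set (Triangulation d)) (K : ℕ) (γ : ℝ) : Prop :=
  ∃ C : ℝ≥0, ∀ M ∈ 𝔉, ∀ ρ, M.IsWeight ρ γ → ∀ u, MemLp u 2 (volume.restrict M.Ω) →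
    eLpNorm (fun x => ρ x * M.Q K u x) 2 (volume.restrict M.Ω) ≤
      C * eLpNorm (fun x => ρ x * u x) 2 (volume.restrict M.Ω)

/-- The worst grading `γ_max ∈ [1, ∞]` of the class `𝔉`: the largest number such that
`WeightedL2Stable 𝔉 K γ` holds for all gradings `1 ≤ γ < γ_max`. -/
noncomputable def gammaMax {d : ℕ} (𝔉 : Set (Triangulation d)) (K : ℕ) : ℝ≥0∞ :=
  sSup {a | ∃ γ : ℝ, 1 ≤ γ ∧ WeightedL2Stable 𝔉 K γ ∧ a = ENNReal.ofReal γ}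

end FEM

/-!
Everything is reduced to a statement about finitely many numbers, one for each element. A weighted
`ℓ²`-bound that holds, with one constant, for all weights of grading `γ` on a connected graph
implies weighted `ℓᵖ`-bounds for weights of a smaller grading `γρ` (`exists_discrete_bound`). By
Hölder's inequality, it suffices to apply the hypothesis to the weight times a suitable power of the
function that has to be estimated. This product need not be graded, so that function is first
replaced by an exponentially decaying average `F i = ∑ j, q ^ dist i j * f j`, which has grading
`q⁻¹` (`exists_graded_majorant`). The mass of `F` is controlled by that of `f` if `q` is smaller
than the reciprocal of the exponential growth rate `η` of the masses of the spheres in the graph,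
and the power of `F` costs the factor `q⁻¹ ^ |1 / 2 - 1 / p|` in the grading (`graded_mul_rpow`),
which leads to the condition `γρ * η ^ |1 / 2 - 1 / p| < γ`. For a mesh, the elements at distance
`n` from an element `T` lie in a ball whose radius is at most a constant times
`(n + 1) * γ_h ^ n * diam T`, whence `η = γ_h ^ d` (`MeshBounds.growthBound`).

For the `Lᵖ`-stability, `u` may be replaced by its elementwise projection to polynomials, which has
the same global projection. On polynomials of bounded degree all norms are equivalent, with
constants that depend only on the shape of the element (`exists_inverse_estimate`). Hence the
definition of `γ_max` gives the `ℓ²`-bound for the quadratic means of `Q u` by the means of `|u|`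
(`exists_gradedBound`).

For the `W^{1,p}`-stability, `Q u` is compared with a piecewise affine function `v` whose
nodal values are mean values of `u` on elements, or zero at the vertices tied to `Γ`. As `v` belongs
to the discrete space (`memLagrange_nodalAverage`), `Q u - v` is the projection of `u - v`. An
inverse estimate for the gradient of `Q u - v` divides the weight by the mesh size, which increases
the grading by the factor `γ_h` (`exists_gradedBound_gradient`). It remains to bound `u - v` locally
by the mesh size times the means of `|∇u|` on neighboring elements. Instead of Poincaré and trace
inequalities, this uses the definition of the weak gradient with products of barycentric coordinates
as test functions. Derivatives along the edges relate the moments of `u` on an element to the mean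
value (`abs_moment_sub_momentRatio_le`), and moments are all that the local projection sees. The
product of the coordinates belonging to an interior facet estimates the difference of the mean
values on the two adjacent elements (`IsInteriorFacet.vol_mul_abs_avg_sub_le`), and that belonging
to a facet of `Γ` estimates the mean value itself (`vol_mul_abs_avg_le`).

Two elements that share a vertex `z` need not be joined by a chain of elements around `z` that share
interior facets, because the boundary need not be Lipschitz. The nodal values are therefore chosen
for each class of elements that are joined in this way. Then `v` is known to be continuous only
across the interior facets, not across faces of lower dimension. This suffices, as almost every line
in a given direction avoids the latter (`hasWeakGradient_stepFun`).
-/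

namespace FEM

/-! ### Extrapolation on graphs -/

/-- Multiplying a weight of grading `γρ` by the power `s` of a function of grading `q⁻¹` costs the
factor `q⁻¹ ^ |s|` in the grading. -/
lemma graded_mul_rpow {α : Type} {G : SimpleGraph α} {r F : α → ℝ} {γρ γ q : ℝ}
    (hF : ∀ i, 0 < F i) (hr : ∀ i, 0 < r i) (hq : 0 < q)
    (hFq : ∀ i j, G.Adj i j → F j ≤ q⁻¹ * F i)
    (hrγ : ∀ i j, G.Adj i j → r j ≤ γρ * r i) {s : ℝ} (hs : γρ * q⁻¹ ^ |s| ≤ γ) (i j : α)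
    (hij : G.Adj i j) : r j * F j ^ s ≤ γ * (r i * F i ^ s) := by
  have h1 : F j ^ s ≤ q⁻¹ ^ |s| * F i ^ s := by
    rcases le_total 0 s with h0 | h0
    · rw [abs_of_nonneg h0, ← Real.mul_rpow (by positivity) (hF i).le]
      exact Real.rpow_le_rpow (hF j).le (hFq i j hij) h0
    · rw [abs_of_nonpos h0, Real.rpow_neg (by positivity), ← Real.inv_rpow (by positivity),
        inv_inv, ← Real.mul_rpow hq.le (hF i).le]
      refine Real.rpow_le_rpow_of_nonpos (mul_pos hq (hF i)) ?_ h0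
      have := hFq j i hij.symm
      rwa [le_inv_mul_iff₀ hq] at this
  have h2 := hrγ i j hij
  have h3 := hr i
  have h4 := hr j
  have h5 : 0 < F j ^ s := Real.rpow_pos_of_pos (hF j) s
  have h6 : 0 < F i ^ s := Real.rpow_pos_of_pos (hF i) s
  have h7 : 0 < γρ := pos_of_mul_pos_left (h4.trans_le h2) h3.le
  calc r j * F j ^ s ≤ (γρ * r i) * (q⁻¹ ^ |s| * F i ^ s) := by gcongr
    _ = γρ * q⁻¹ ^ |s| * (r i * F i ^ s) := by ring
    _ ≤ γ * (r i * F i ^ s) := by gcongr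

section Discrete

variable {ι : Type} [Fintype ι]

/-- The weighted `ℓ²`-bound of `V` by `U`, uniformly over all positive weights whose values at
adjacent vertices of the graph differ at most by the factor `γ`. -/
def GradedBound (G : SimpleGraph ι) (μ : ι → ℝ) (γ C : ℝ) (V U : ι → ℝ) : Prop :=
  ∀ w : ι → ℝ, (∀ i, 0 < w i) → (∀ i j, G.Adj i j → w j ≤ γ * w i) →
    ∑ i, μ i * (w i * V i) ^ 2 ≤ C ^ 2 * ∑ i, μ i * (w i * U i) ^ 2

/-- The mass at distance `n` from a vertex grows at most like `(n + 1) ^ d * η ^ n`. -/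
def GrowthBound (G : SimpleGraph ι) (μ : ι → ℝ) (d : ℕ) (B η : ℝ) : Prop :=
  ∀ i n, ∑ j with G.dist i j = n, μ j ≤ B * ((n : ℝ) + 1) ^ d * η ^ n * μ i

lemma summable_growth (d : ℕ) (B : ℝ) {x : ℝ} (hx0 : 0 ≤ x) (hx : x < 1) :
    Summable fun n : ℕ => B * ((n : ℝ) + 1) ^ d * x ^ n := by
  have h := summable_pow_mul_geometric_of_norm_lt_one (R := ℝ) d (r := x)
    (by rwa [Real.norm_of_nonneg hx0])
  rcases hx0.eq_or_lt with rfl | hx0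
  · refine summable_of_ne_finset_zero (s := {0}) fun n hn => ?_
    simp only [Finset.mem_singleton] at hn
    simp [hn]
  · have h1 := ((summable_nat_add_iff 1).2 h).mul_left (B * x⁻¹)
    refine h1.congr fun n => ?_
    push_cast
    field_simp
    ring

/-- The factor by which the exponentially decaying average with rate `q` enlarges the mass. -/
noncomputable def growthSum (d : ℕ) (B x : ℝ) : ℝ := ∑' n : ℕ, B * ((n : ℝ) + 1) ^ d * x ^ n

lemma sum_pow_dist_le {G : SimpleGraph ι} {μ : ι → ℝ} {d : ℕ} {B η q : ℝ}
    (hB : 0 ≤ B) (hμ : ∀ i, 0 < μ i) (hgr : GrowthBound G μ d B η) (hη : 0 ≤ η) (hq : 0 < q)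
    (hqη : q * η < 1) (i : ι) :
    ∑ j, μ j * q ^ G.dist i j ≤ growthSum d B (q * η) * μ i := by
  classical
  have hx0 : 0 ≤ q * η := by positivity
  obtain ⟨N, hN⟩ : ∃ N, ∀ j, G.dist i j < N := by
    obtain ⟨N, hN⟩ := (Set.finite_range fun j => G.dist i j).bddAbove
    exact ⟨N + 1, fun j => Nat.lt_succ_of_le (hN ⟨j, rfl⟩)⟩
  calc ∑ j, μ j * q ^ G.dist i j
      = ∑ n ∈ Finset.range N, ∑ j with G.dist i j = n, μ j * q ^ G.dist i j :=
        (Finset.sum_fiberwise_of_maps_to (fun j _ => Finset.mem_range.2 (hN j)) _).symm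
    _ ≤ ∑ n ∈ Finset.range N, B * ((n : ℝ) + 1) ^ d * (q * η) ^ n * μ i := by
        refine Finset.sum_le_sum fun n _ => ?_
        have : ∑ j with G.dist i j = n, μ j * q ^ G.dist i j
            = (∑ j with G.dist i j = n, μ j) * q ^ n := by
          rw [Finset.sum_mul]
          refine Finset.sum_congr rfl fun j hj => ?_
          rw [(Finset.mem_filter.1 hj).2]
        rw [this, mul_pow]
        calc _ ≤ (B * ((n : ℝ) + 1) ^ d * η ^ n * μ i) * q ^ n := by
              gcongr
              exact hgr i n
          _ = _ := by ring
    _ = (∑ n ∈ Finset.range N, B * ((n : ℝ) + 1) ^ d * (q * η) ^ n) * μ i := by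
        rw [Finset.sum_mul]
    _ ≤ growthSum d B (q * η) * μ i := by
        refine mul_le_mul_of_nonneg_right ?_ (hμ i).le
        refine (summable_growth d B hx0 hqη).sum_le_tsum _ fun n _ => ?_
        positivity

/-- A maximal function: a nonnegative `f` that is not zero everywhere has a positive majorant that
varies slowly along the graph and whose mass is comparable to that of `f`. -/
lemma exists_graded_majorant {G : SimpleGraph ι} (hG : G.Connected) {μ : ι → ℝ} {d : ℕ}
    {B η q : ℝ} (hB : 0 ≤ B) (hμ : ∀ i, 0 < μ i) (hgr : GrowthBound G μ d B η) (hη : 0 ≤ η)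
    (hq : 0 < q) (hq1 : q ≤ 1) (hqη : q * η < 1) {f : ι → ℝ} (hf : ∀ i, 0 ≤ f i)
    (hf0 : ∃ i, f i ≠ 0) :
    ∃ F : ι → ℝ, (∀ i, 0 < F i) ∧ (∀ i, f i ≤ F i) ∧ (∀ i j, G.Adj i j → F j ≤ q⁻¹ * F i) ∧
      ∑ i, μ i * F i ≤ growthSum d B (q * η) * ∑ i, μ i * f i := by
  refine ⟨fun i => ∑ j, q ^ G.dist i j * f j, fun i => ?_, fun i => ?_, fun i j hij => ?_, ?_⟩
  · obtain ⟨j, hj⟩ := hf0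
    refine Finset.sum_pos' (fun k _ => mul_nonneg (by positivity) (hf k)) ⟨j, Finset.mem_univ j, ?_⟩
    have := lt_of_le_of_ne (hf j) (Ne.symm hj)
    positivity
  · have := Finset.single_le_sum (f := fun j => q ^ G.dist i j * f j)
      (fun k _ => mul_nonneg (by positivity) (hf k)) (Finset.mem_univ i)
    simpa using this
  · rw [Finset.mul_sum]
    refine Finset.sum_le_sum fun k _ => ?_
    rw [← mul_assoc]
    refine mul_le_mul_of_nonneg_right ?_ (hf k)
    rw [le_inv_mul_iff₀ hq, ← pow_succ']
    refine pow_le_pow_of_le_one hq.le hq1 ?_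
    calc G.dist i k ≤ G.dist i j + G.dist j k := hG.dist_triangle
      _ = G.dist j k + 1 := by rw [SimpleGraph.dist_eq_one_iff_adj.2 hij, add_comm]
  · simp_rw [Finset.mul_sum]
    rw [Finset.sum_comm]
    refine Finset.sum_le_sum fun j _ => ?_
    have := mul_le_mul_of_nonneg_right (sum_pow_dist_le hB hμ hgr hη hq hqη j) (hf j)
    rw [Finset.sum_mul] at this
    calc _ = ∑ i, μ i * q ^ G.dist j i * f j := by
          refine Finset.sum_congr rfl fun i _ => ?_
          rw [SimpleGraph.dist_comm]; ring
      _ ≤ _ := this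
      _ = _ := by ring

lemma exists_rate {η γρ γ s : ℝ} (hη : 1 ≤ η) (h : γρ * η ^ s < γ) :
    ∃ q : ℝ, 0 < q ∧ q ≤ 1 ∧ q * η < 1 ∧ γρ * q⁻¹ ^ s ≤ γ := by
  have hc : ContinuousAt (fun t : ℝ => γρ * t ^ s) η :=
    continuousAt_const.mul (Real.continuousAt_rpow_const _ _ (Or.inl (by linarith)))
  have h1 : ∀ᶠ t in nhds η, γρ * t ^ s < γ := hc.eventually_lt continuousAt_const h
  obtain ⟨t, ht, hηt⟩ := ((h1.filter_mono nhdsWithin_le_nhds).and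
    (self_mem_nhdsWithin : Set.Ioi η ∈ nhdsWithin η (Set.Ioi η))).exists
  have hηt : η < t := hηt
  have ht0 : 0 < t := by linarith
  refine ⟨t⁻¹, by positivity, inv_le_one_of_one_le₀ (by linarith), ?_, by rw [inv_inv]; exact ht.le⟩
  rw [inv_mul_lt_iff₀ ht0]
  linarith

variable {G : SimpleGraph ι} {μ r V U : ι → ℝ} {d : ℕ} {B η γρ γ q C : ℝ}

/-- The case `p = ∞` of the discrete stability. -/
lemma discrete_bound_top (hG : G.Connected) (hB : 0 ≤ B) (hμ : ∀ i, 0 < μ i)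
    (hgr : GrowthBound G μ d B η) (hη : 0 ≤ η) (hq : 0 < q) (hq1 : q ≤ 1) (hqη : q * η < 1)
    (hr : ∀ i, 0 < r i) (hrγ : ∀ i j, G.Adj i j → r j ≤ γρ * r i)
    (hs : γρ * q⁻¹ ^ (1 / 2 : ℝ) ≤ γ) (hU : ∀ i, 0 ≤ U i)
    (hC : 0 ≤ C) (h : GradedBound G μ γ C V U) {A : ℝ} (hA : ∀ i, r i * U i ≤ A) (i : ι) :
    r i * V i ≤ C * √(growthSum d B (q * η)) * A := by
  classical
  obtain ⟨F, hF, hfF, hFq, hFK⟩ := exists_graded_majorant hG hB hμ hgr hη hq hq1 hqη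
    (f := fun j => if j = i then 1 else 0) (fun j => by positivity) ⟨i, by simp⟩
  have h1 := h (fun j => r j * F j ^ (1 / 2 : ℝ))
    (fun j => mul_pos (hr j) (Real.rpow_pos_of_pos (hF j) _))
    (graded_mul_rpow hF hr hq hFq hrγ (by rwa [abs_of_nonneg (by norm_num)]))
  have hFs (j : ι) : (F j ^ (1 / 2 : ℝ)) ^ 2 = F j := by
    rw [← Real.sqrt_eq_rpow, Real.sq_sqrt (hF j).le]
  set K := growthSum d B (q * η)
  simp only [mul_ite, mul_one, mul_zero, Finset.sum_ite_eq', Finset.mem_univ, if_true] at hFK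
  have hK : 0 ≤ K := by
    have : 0 ≤ K * μ i := (Finset.sum_nonneg fun j _ => (mul_pos (hμ j) (hF j)).le).trans hFK
    exact nonneg_of_mul_nonneg_left this (hμ i)
  have hA0 : 0 ≤ A := (mul_nonneg (hr i).le (hU i)).trans (hA i)
  have h2 : μ i * (r i * V i) ^ 2 ≤ C ^ 2 * (A ^ 2 * (K * μ i)) := by
    calc μ i * (r i * V i) ^ 2 ≤ μ i * (r i * F i ^ (1 / 2 : ℝ) * V i) ^ 2 := by
          have h1 : 1 ≤ F i := by simpa using hfF i
          have e : (r i * F i ^ (1 / 2 : ℝ) * V i) ^ 2 = (r i * V i) ^ 2 * F i := by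
            nth_rw 2 [← hFs i]; ring
          rw [e]
          exact mul_le_mul_of_nonneg_left (le_mul_of_one_le_right (sq_nonneg _) h1) (hμ i).le
      _ ≤ ∑ j, μ j * (r j * F j ^ (1 / 2 : ℝ) * V j) ^ 2 :=
          Finset.single_le_sum (f := fun j => μ j * (r j * F j ^ (1 / 2 : ℝ) * V j) ^ 2)
            (fun j _ => mul_nonneg (hμ j).le (sq_nonneg _)) (Finset.mem_univ i)
      _ ≤ C ^ 2 * ∑ j, μ j * (r j * F j ^ (1 / 2 : ℝ) * U j) ^ 2 := h1
      _ ≤ C ^ 2 * (A ^ 2 * (K * μ i)) := by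
          refine mul_le_mul_of_nonneg_left ?_ (sq_nonneg C)
          refine le_trans ?_ (mul_le_mul_of_nonneg_left hFK (sq_nonneg A))
          rw [Finset.mul_sum]
          refine Finset.sum_le_sum fun j _ => ?_
          have e : (r j * F j ^ (1 / 2 : ℝ) * U j) ^ 2 = (r j * U j) ^ 2 * F j := by
            nth_rw 2 [← hFs j]; ring
          rw [e]
          have : (r j * U j) ^ 2 ≤ A ^ 2 :=
            pow_le_pow_left₀ (mul_nonneg (hr j).le (hU j)) (hA j) 2
          have := mul_le_mul_of_nonneg_right this (mul_pos (hμ j) (hF j)).le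
          linarith
  have h3 : (r i * V i) ^ 2 ≤ (C * √K * A) ^ 2 := by
    rw [mul_pow (C * √K), mul_pow C, Real.sq_sqrt hK]
    refine le_of_mul_le_mul_left ?_ (hμ i)
    linarith
  exact le_of_sq_le_sq h3 (by positivity)

lemma discrete_zero (hμ : ∀ i, 0 < μ i) (hγ : 1 ≤ γ) (h : GradedBound G μ γ C V U)
    (hU : ∀ i, U i = 0) (i : ι) : V i = 0 := by
  have h1 := h (fun _ => 1) (fun _ => one_pos) (fun _ _ _ => by linarith)
  simp only [hU, mul_zero, one_mul, ne_eq, OfNat.ofNat_ne_zero, not_false_eq_true, zero_pow,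
    Finset.sum_const_zero] at h1
  have h2 := (Finset.sum_eq_zero_iff_of_nonneg
    (fun j _ => mul_nonneg (hμ j).le (sq_nonneg (V j)))).1
    (le_antisymm h1 (Finset.sum_nonneg fun j _ => mul_nonneg (hμ j).le (sq_nonneg (V j))))
    i (Finset.mem_univ i)
  simpa [(hμ i).ne'] using h2

/-- Hölder's inequality in the form `∑ μ a^(1-s) b^s ≤ (∑ μ a)^(1-s) (∑ μ b)^s`. -/
lemma sum_rpow_mul_rpow_le (hμ : ∀ i, 0 < μ i) {a b : ι → ℝ} (ha : ∀ i, 0 ≤ a i)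
    (hb : ∀ i, 0 ≤ b i) {s : ℝ} (hs0 : 0 < s) (hs1 : s < 1) :
    ∑ i, μ i * (a i ^ (1 - s) * b i ^ s) ≤
      (∑ i, μ i * a i) ^ (1 - s) * (∑ i, μ i * b i) ^ s := by
  have hs1' : 0 < 1 - s := by linarith
  have hpq : Real.HolderConjugate (1 - s)⁻¹ s⁻¹ := by
    refine Real.holderConjugate_iff.2 ⟨(one_lt_inv₀ hs1').2 (by linarith), by simp⟩
  have h := Real.inner_le_Lp_mul_Lq Finset.univ (fun i => (μ i * a i) ^ (1 - s))
    (fun i => (μ i * b i) ^ s) hpq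
  have e1 (i : ι) : |(μ i * a i) ^ (1 - s)| ^ (1 - s)⁻¹ = μ i * a i := by
    have : 0 ≤ μ i * a i := mul_nonneg (hμ i).le (ha i)
    rw [abs_of_nonneg (by positivity), Real.rpow_rpow_inv this hs1'.ne']
  have e2 (i : ι) : |(μ i * b i) ^ s| ^ s⁻¹ = μ i * b i := by
    have : 0 ≤ μ i * b i := mul_nonneg (hμ i).le (hb i)
    rw [abs_of_nonneg (by positivity), Real.rpow_rpow_inv this hs0.ne']
  simp only [e1, e2, one_div, inv_inv] at h
  refine le_trans (le_of_eq (Finset.sum_congr rfl fun i _ => ?_)) h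
  rw [Real.mul_rpow (hμ i).le (ha i), Real.mul_rpow (hμ i).le (hb i)]
  have : μ i ^ (1 - s) * μ i ^ s = μ i := by
    rw [← Real.rpow_add (hμ i)]; simp
  calc _ = (μ i ^ (1 - s) * μ i ^ s) * (a i ^ (1 - s) * b i ^ s) := by rw [this]
    _ = _ := by ring

/-- The case `p < 2` of the discrete stability. -/
lemma discrete_bound_lt_two (hG : G.Connected) (hB : 0 ≤ B) (hμ : ∀ i, 0 < μ i)
    (hgr : GrowthBound G μ d B η) (hη : 0 ≤ η) (hq : 0 < q) (hq1 : q ≤ 1) (hqη : q * η < 1)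
    (hr : ∀ i, 0 < r i) (hrγ : ∀ i j, G.Adj i j → r j ≤ γρ * r i) {p : ℝ} (hp1 : 1 ≤ p)
    (hp2 : p < 2) (hs : γρ * q⁻¹ ^ |1 / 2 - p⁻¹| ≤ γ) (hγ : 1 ≤ γ) (hU : ∀ i, 0 ≤ U i)
    (hV : ∀ i, 0 ≤ V i) (hC : 0 ≤ C) (h : GradedBound G μ γ C V U) :
    ∑ i, μ i * (r i * V i) ^ p ≤
      C ^ p * growthSum d B (q * η) ^ (1 - p / 2) * ∑ i, μ i * (r i * U i) ^ p := by
  have hp0 : 0 < p := by linarith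
  by_cases hU0 : ∀ i, U i = 0
  · simp [discrete_zero hμ hγ h hU0, hU0, Real.zero_rpow hp0.ne']
  push Not at hU0
  obtain ⟨i₀, hi₀⟩ := hU0
  have hrU (i : ι) : 0 ≤ r i * U i := mul_nonneg (hr i).le (hU i)
  have hrV (i : ι) : 0 ≤ r i * V i := mul_nonneg (hr i).le (hV i)
  obtain ⟨F, hF, hfF, hFq, hFK⟩ := exists_graded_majorant hG hB hμ hgr hη hq hq1 hqη
    (f := fun j => (r j * U j) ^ p) (fun j => Real.rpow_nonneg (hrU j) p)
    ⟨i₀, by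
      have : 0 < r i₀ * U i₀ := mul_pos (hr i₀) (lt_of_le_of_ne (hU i₀) hi₀.symm)
      positivity⟩
  set K := growthSum d B (q * η)
  set s := 1 / 2 - p⁻¹ with hsdef
  have h1 := h (fun j => r j * F j ^ s)
    (fun j => mul_pos (hr j) (Real.rpow_pos_of_pos (hF j) _))
    (graded_mul_rpow hF hr hq hFq hrγ hs)
  have hsum : 0 < ∑ i, μ i * (r i * U i) ^ p := by
    refine Finset.sum_pos' (fun i _ => mul_nonneg (hμ i).le (Real.rpow_nonneg (hrU i) p))
      ⟨i₀, Finset.mem_univ _, ?_⟩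
    have : 0 < r i₀ * U i₀ := mul_pos (hr i₀) (lt_of_le_of_ne (hU i₀) hi₀.symm)
    have := hμ i₀
    positivity
  have hK : 0 ≤ K := by
    have : 0 ≤ K * ∑ i, μ i * (r i * U i) ^ p :=
      (Finset.sum_nonneg fun j _ => (mul_pos (hμ j) (hF j)).le).trans hFK
    exact nonneg_of_mul_nonneg_left this hsum
  have e (i : ι) (x : ℝ) : (r i * F i ^ s * x) ^ 2 = (r i * x) ^ 2 * F i ^ (1 - 2 / p) := by
    have : (F i ^ s) ^ 2 = F i ^ (1 - 2 / p) := by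
      rw [← Real.rpow_natCast, ← Real.rpow_mul (hF i).le]
      congr 1
      rw [hsdef]; push_cast; ring
    rw [← this]; ring
  have h2 : ∑ i, μ i * (r i * F i ^ s * U i) ^ 2 ≤ ∑ i, μ i * (r i * U i) ^ p := by
    refine Finset.sum_le_sum fun i _ => mul_le_mul_of_nonneg_left ?_ (hμ i).le
    rw [e]
    rcases (hrU i).eq_or_lt with h0 | h0
    · rw [← h0, Real.zero_rpow hp0.ne']; simp
    · calc (r i * U i) ^ 2 * F i ^ (1 - 2 / p)
          ≤ (r i * U i) ^ 2 * ((r i * U i) ^ p) ^ (1 - 2 / p) := by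
            refine mul_le_mul_of_nonneg_left ?_ (sq_nonneg _)
            refine Real.rpow_le_rpow_of_nonpos (by positivity) (hfF i) ?_
            rw [sub_nonpos, le_div_iff₀ hp0]; linarith
        _ = (r i * U i) ^ p := by
            rw [← Real.rpow_natCast, ← Real.rpow_mul h0.le, ← Real.rpow_add h0]
            congr 1
            field_simp
            push_cast; ring
  have h3 := sum_rpow_mul_rpow_le hμ (a := fun i => (r i * F i ^ s * V i) ^ 2) (b := F)
    (fun i => sq_nonneg _) (fun i => (hF i).le) (s := 1 - p / 2) (by linarith) (by linarith)
  rw [sub_sub_cancel] at h3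
  have h4 (i : ι) :
      ((r i * F i ^ s * V i) ^ 2) ^ (p / 2) * F i ^ (1 - p / 2) = (r i * V i) ^ p := by
    rw [e, Real.mul_rpow (sq_nonneg _) (Real.rpow_nonneg (hF i).le _), ← Real.rpow_mul (hF i).le,
      ← Real.rpow_natCast, ← Real.rpow_mul (hrV i), mul_assoc, ← Real.rpow_add (hF i)]
    have e1 : ((2 : ℕ) : ℝ) * (p / 2) = p := by push_cast; ring
    have e2 : (1 - 2 / p) * (p / 2) + (1 - p / 2) = 0 := by field_simp; ring
    rw [e1, e2, Real.rpow_zero, mul_one]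
  simp only [h4] at h3
  refine h3.trans ?_
  have hVn : 0 ≤ ∑ i, μ i * (r i * F i ^ s * V i) ^ 2 :=
    Finset.sum_nonneg fun i _ => mul_nonneg (hμ i).le (sq_nonneg _)
  set X := ∑ i, μ i * (r i * U i) ^ p with hX
  calc _ ≤ (C ^ 2 * X) ^ (p / 2) * (K * X) ^ (1 - p / 2) := by
        refine mul_le_mul (Real.rpow_le_rpow hVn (h1.trans ?_) (by linarith))
          (Real.rpow_le_rpow (Finset.sum_nonneg fun j _ => (mul_pos (hμ j) (hF j)).le) hFK
            (by linarith)) (Real.rpow_nonneg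
              (Finset.sum_nonneg fun j _ => (mul_pos (hμ j) (hF j)).le) _)
          (Real.rpow_nonneg (by positivity) _)
        exact mul_le_mul_of_nonneg_left h2 (sq_nonneg C)
    _ = C ^ p * K ^ (1 - p / 2) * X := by
        rw [Real.mul_rpow (sq_nonneg C) hsum.le, Real.mul_rpow hK hsum.le, ← Real.rpow_natCast,
          ← Real.rpow_mul hC]
        have e1 : ((2 : ℕ) : ℝ) * (p / 2) = p := by push_cast; ring
        have e2 : X ^ (p / 2) * X ^ (1 - p / 2) = X := by
          rw [← Real.rpow_add hsum]; simp
        rw [e1]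
        calc _ = C ^ p * K ^ (1 - p / 2) * (X ^ (p / 2) * X ^ (1 - p / 2)) := by ring
          _ = _ := by rw [e2]

/-- The case `p > 2` of the discrete stability. -/
lemma discrete_bound_gt_two (hG : G.Connected) (hB : 0 ≤ B) (hμ : ∀ i, 0 < μ i)
    (hgr : GrowthBound G μ d B η) (hη : 0 ≤ η) (hq : 0 < q) (hq1 : q ≤ 1) (hqη : q * η < 1)
    (hr : ∀ i, 0 < r i) (hrγ : ∀ i j, G.Adj i j → r j ≤ γρ * r i) {p : ℝ} (hp2 : 2 < p)
    (hs : γρ * q⁻¹ ^ |1 / 2 - p⁻¹| ≤ γ) (hU : ∀ i, 0 ≤ U i)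
    (hV : ∀ i, 0 ≤ V i) (hC : 0 ≤ C) (h : GradedBound G μ γ C V U) :
    ∑ i, μ i * (r i * V i) ^ p ≤
      C ^ p * growthSum d B (q * η) ^ (p / 2 - 1) * ∑ i, μ i * (r i * U i) ^ p := by
  have hp0 : 0 < p := by linarith
  have hK : 0 ≤ growthSum d B (q * η) := tsum_nonneg fun n => by positivity
  have hrU (i : ι) : 0 ≤ r i * U i := mul_nonneg (hr i).le (hU i)
  have hrV (i : ι) : 0 ≤ r i * V i := mul_nonneg (hr i).le (hV i)
  have hYn : 0 ≤ ∑ i, μ i * (r i * U i) ^ p :=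
    Finset.sum_nonneg fun i _ => mul_nonneg (hμ i).le (Real.rpow_nonneg (hrU i) p)
  by_cases hV0 : ∀ i, V i = 0
  · simp only [hV0, mul_zero, Real.zero_rpow hp0.ne', Finset.sum_const_zero]
    positivity
  push Not at hV0
  obtain ⟨i₀, hi₀⟩ := hV0
  have hi₀' : 0 < r i₀ * V i₀ := mul_pos (hr i₀) (lt_of_le_of_ne (hV i₀) hi₀.symm)
  obtain ⟨F, hF, hfF, hFq, hFK⟩ := exists_graded_majorant hG hB hμ hgr hη hq hq1 hqη
    (f := fun j => (r j * V j) ^ p) (fun j => Real.rpow_nonneg (hrV j) p) ⟨i₀, by positivity⟩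
  set K := growthSum d B (q * η)
  set s := 1 / 2 - p⁻¹ with hsdef
  have hs0 : 0 < s := by
    rw [hsdef, sub_pos, ← one_div]
    exact one_div_lt_one_div_of_lt two_pos hp2
  have hs2 : 2 * s < 1 := by
    have : 0 < p⁻¹ := by positivity
    rw [hsdef]; linarith
  have h1 := h (fun j => r j * F j ^ s)
    (fun j => mul_pos (hr j) (Real.rpow_pos_of_pos (hF j) _))
    (graded_mul_rpow hF hr hq hFq hrγ hs)
  have e (i : ι) (x : ℝ) : (r i * F i ^ s * x) ^ 2 = (r i * x) ^ 2 * F i ^ (2 * s) := by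
    have : (F i ^ s) ^ 2 = F i ^ (2 * s) := by
      rw [← Real.rpow_natCast, ← Real.rpow_mul (hF i).le]
      congr 1
      push_cast; ring
    rw [← this]; ring
  have hXpos : 0 < ∑ i, μ i * (r i * V i) ^ p := by
    refine Finset.sum_pos' (fun i _ => mul_nonneg (hμ i).le (Real.rpow_nonneg (hrV i) p))
      ⟨i₀, Finset.mem_univ _, ?_⟩
    have := hμ i₀
    positivity
  have h2 : ∑ i, μ i * (r i * V i) ^ p ≤ ∑ i, μ i * (r i * F i ^ s * V i) ^ 2 := by
    refine Finset.sum_le_sum fun i _ => mul_le_mul_of_nonneg_left ?_ (hμ i).le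
    rw [e]
    rcases (hrV i).eq_or_lt with h0 | h0
    · rw [← h0, Real.zero_rpow hp0.ne']; simp
    · calc (r i * V i) ^ p = (r i * V i) ^ 2 * ((r i * V i) ^ p) ^ (2 * s) := by
            rw [← Real.rpow_natCast, ← Real.rpow_mul h0.le, ← Real.rpow_add h0]
            congr 1
            rw [hsdef]; field_simp
            push_cast; ring
        _ ≤ (r i * V i) ^ 2 * F i ^ (2 * s) := by
            refine mul_le_mul_of_nonneg_left ?_ (sq_nonneg _)
            exact Real.rpow_le_rpow (by positivity) (hfF i) (by linarith)
  have h3 := sum_rpow_mul_rpow_le hμ (a := fun i => (r i * U i) ^ p) (b := F)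
    (fun i => Real.rpow_nonneg (hrU i) p) (fun i => (hF i).le) (s := 2 * s) (by linarith) hs2
  have h4 (i : ι) : ((r i * U i) ^ p) ^ (1 - 2 * s) * F i ^ (2 * s) =
      (r i * F i ^ s * U i) ^ 2 := by
    rw [e, ← Real.rpow_mul (hrU i)]
    have e1 : p * (1 - 2 * s) = ((2 : ℕ) : ℝ) := by rw [hsdef]; field_simp; push_cast; ring
    rw [e1, Real.rpow_natCast]
  simp only [h4] at h3
  set X := ∑ i, μ i * (r i * V i) ^ p with hX
  set Y := ∑ i, μ i * (r i * U i) ^ p with hY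
  have h5 : X ≤ C ^ 2 * (Y ^ (1 - 2 * s) * (K * X) ^ (2 * s)) := by
    refine (h2.trans h1).trans (mul_le_mul_of_nonneg_left (h3.trans ?_) (sq_nonneg C))
    refine mul_le_mul_of_nonneg_left ?_ (Real.rpow_nonneg hYn _)
    exact Real.rpow_le_rpow (Finset.sum_nonneg fun j _ => (mul_pos (hμ j) (hF j)).le) hFK
      (by linarith)
  have h6 : X ^ (1 - 2 * s) ≤ C ^ 2 * (Y ^ (1 - 2 * s) * K ^ (2 * s)) := by
    have hXs : 0 < X ^ (2 * s) := Real.rpow_pos_of_pos hXpos _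
    refine le_of_mul_le_mul_right ?_ hXs
    calc X ^ (1 - 2 * s) * X ^ (2 * s) = X := by
          rw [← Real.rpow_add hXpos]; simp
      _ ≤ _ := h5
      _ = _ := by rw [Real.mul_rpow hK hXpos.le]; ring
  -- `1 - 2 s = 2 / p`
  have h7 := Real.rpow_le_rpow (Real.rpow_nonneg hXpos.le _) h6 (by positivity : 0 ≤ p / 2)
  have e1 : (1 - 2 * s) * (p / 2) = 1 := by rw [hsdef]; field_simp; ring
  have e2 : (2 * s) * (p / 2) = p / 2 - 1 := by rw [hsdef]; field_simp
  have e3 : ((2 : ℕ) : ℝ) * (p / 2) = p := by push_cast; ring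
  rw [← Real.rpow_mul hXpos.le, e1, Real.rpow_one,
    Real.mul_rpow (sq_nonneg C) (mul_nonneg (Real.rpow_nonneg hYn _) (Real.rpow_nonneg hK _)),
    Real.mul_rpow (Real.rpow_nonneg hYn _) (Real.rpow_nonneg hK _), ← Real.rpow_mul hYn, e1,
    ← Real.rpow_mul hK, e2, ← Real.rpow_natCast C, ← Real.rpow_mul hC, e3, Real.rpow_one] at h7
  calc X ≤ _ := h7
    _ = _ := by ring

/-- The discrete `ℓᵖ`-bound of `V` by `U` in the weight `r`. -/
def LpBound (μ r : ι → ℝ) (p : ℝ≥0∞) (c : ℝ) (V U : ι → ℝ) : Prop :=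
  (p ≠ ⊤ → ∑ i, μ i * (r i * V i) ^ p.toReal ≤ c ^ p.toReal * ∑ i, μ i * (r i * U i) ^ p.toReal) ∧
    (p = ⊤ → ∀ A, (∀ i, r i * U i ≤ A) → ∀ i, r i * V i ≤ c * A)

end Discrete

/-- Extrapolation: weighted `ℓ²`-bounds for all weights of grading `γ` imply `ℓᵖ`-bounds in weights
of a grading `γρ` with `γρ * η ^ |1/2 - 1/p| < γ`, where `η` is the growth rate of the mass. -/
theorem exists_discrete_bound (d : ℕ) {B C η γρ γ : ℝ} (hB : 0 ≤ B) (hC : 0 ≤ C) (hη : 1 ≤ η)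
    (hγρ : 1 ≤ γρ) {p : ℝ≥0∞} (hp : 1 ≤ p) (hlt : γρ * η ^ |1 / 2 - (p⁻¹).toReal| < γ) :
    ∃ c : ℝ, 0 ≤ c ∧ ∀ (ι : Type) [Fintype ι] (G : SimpleGraph ι) (μ r V U : ι → ℝ),
      G.Connected → (∀ i, 0 < μ i) → GrowthBound G μ d B η → (∀ i, 0 < r i) →
      (∀ i j, G.Adj i j → r j ≤ γρ * r i) → (∀ i, 0 ≤ V i) → (∀ i, 0 ≤ U i) →
      GradedBound G μ γ C V U → LpBound μ r p c V U := by
  have hη0 : 0 ≤ η := by linarith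
  have hγ : γρ ≤ γ := by
    refine le_trans ?_ hlt.le
    exact le_mul_of_one_le_right (by linarith) (Real.one_le_rpow hη (abs_nonneg _))
  obtain ⟨q, hq, hq1, hqη, hs⟩ := exists_rate hη hlt
  have hK : 0 ≤ growthSum d B (q * η) := tsum_nonneg fun n => by positivity
  rcases eq_or_ne p ⊤ with rfl | hpt
  · refine ⟨C * √(growthSum d B (q * η)), by positivity, ?_⟩
    intro ι _ G μ r V U hG hμ hgr hr hrγ hV hU h
    refine ⟨fun h => (h rfl).elim, fun _ A hA i => ?_⟩
    refine discrete_bound_top hG hB hμ hgr hη0 hq hq1 hqη hr hrγ ?_ hU hC h hA i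
    simpa [abs_of_nonneg] using hs
  have hp1 : 1 ≤ p.toReal := by
    rw [← ENNReal.toReal_one]
    exact ENNReal.toReal_mono hpt hp
  have hp0 : 0 < p.toReal := by linarith
  rw [ENNReal.toReal_inv] at hs
  have hroot (x : ℝ) (hx : 0 ≤ x) : (x ^ p.toReal⁻¹) ^ p.toReal = x :=
    Real.rpow_inv_rpow hx hp0.ne'
  rcases lt_trichotomy p.toReal 2 with h2 | h2 | h2
  · refine ⟨(C ^ p.toReal * growthSum d B (q * η) ^ (1 - p.toReal / 2)) ^ p.toReal⁻¹,
      by positivity, ?_⟩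
    intro ι _ G μ r V U hG hμ hgr hr hrγ hV hU h
    refine ⟨fun _ => ?_, fun h => (hpt h).elim⟩
    rw [hroot _ (by positivity)]
    exact discrete_bound_lt_two hG hB hμ hgr hη0 hq hq1 hqη hr hrγ hp1 h2 hs (by linarith) hU hV
      hC h
  · refine ⟨C, hC, ?_⟩
    intro ι _ G μ r V U hG hμ hgr hr hrγ hV hU h
    refine ⟨fun _ => ?_, fun h => (hpt h).elim⟩
    have := h r hr fun i j hij =>
      (hrγ i j hij).trans (mul_le_mul_of_nonneg_right hγ (hr i).le)
    rw [h2]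
    simpa using this
  · refine ⟨(C ^ p.toReal * growthSum d B (q * η) ^ (p.toReal / 2 - 1)) ^ p.toReal⁻¹,
      by positivity, ?_⟩
    intro ι _ G μ r V U hG hμ hgr hr hrγ hV hU h
    refine ⟨fun _ => ?_, fun h => (hpt h).elim⟩
    rw [hroot _ (by positivity)]
    exact discrete_bound_gt_two hG hB hμ hgr hη0 hq hq1 hqη hr hrγ h2 hs hU hV hC h

namespace Triangulation

variable {d : ℕ} {M : Triangulation d}

/-! ### Barycentric coordinates of the elements -/

namespace Cell

lemma card_eq (T : M.Cell) : T.1.card = d + 1 := T.2.2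

/-- The vertices of an element as an affine basis of the space. -/
noncomputable def basis (T : M.Cell) : AffineBasis T.1 ℝ (Space d) where
  toFun := (↑)
  ind' := M.complex.indep T.2.1
  tot' := by
    rw [(M.complex.indep T.2.1).affineSpan_eq_top_iff_card_eq_finrank_add_one]
    simp [T.card_eq]

open Classical in
/-- The barycentric coordinate of an element that belongs to the vertex `p`. It is zero if `p` is
not a vertex of the element. -/
noncomputable def lam (T : M.Cell) (p : Space d) : Space d →ᵃ[ℝ] ℝ :=
  if h : p ∈ T.1 then T.basis.coord ⟨p, h⟩ else 0

lemma lam_of_mem (T : M.Cell) {p : Space d} (h : p ∈ T.1) : T.lam p = T.basis.coord ⟨p, h⟩ := by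
  rw [lam, dif_pos h]

lemma lam_of_notMem (T : M.Cell) {p : Space d} (h : p ∉ T.1) (x : Space d) : T.lam p x = 0 := by
  rw [lam, dif_neg h]; rfl

lemma lam_self (T : M.Cell) {p : Space d} (h : p ∈ T.1) : T.lam p p = 1 := by
  rw [lam_of_mem T h]
  exact T.basis.coord_apply_eq ⟨p, h⟩

lemma lam_of_ne (T : M.Cell) {p q : Space d} (hq : q ∈ T.1) (hpq : p ≠ q) : T.lam p q = 0 := by
  by_cases h : p ∈ T.1
  · rw [lam_of_mem T h]
    exact T.basis.coord_apply_ne (i := ⟨p, h⟩) (j := ⟨q, hq⟩) fun e => hpq (congrArg Subtype.val e)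
  · exact lam_of_notMem T h q

lemma sum_lam (T : M.Cell) (x : Space d) : ∑ p ∈ T.1, T.lam p x = 1 := by
  rw [← T.basis.sum_coord_apply_eq_one x, ← Finset.sum_coe_sort]
  exact Finset.sum_congr rfl fun p _ => by rw [lam_of_mem T p.2]

lemma sum_lam_smul (T : M.Cell) (x : Space d) : ∑ p ∈ T.1, T.lam p x • p = x := by
  conv_rhs => rw [← T.basis.linear_combination_coord_eq_self x]
  rw [← Finset.sum_coe_sort]
  exact Finset.sum_congr rfl fun p _ => by rw [lam_of_mem T p.2]; rfl

/-- Affine functions are determined by their values at the vertices. -/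
lemma affine_eq_sum (T : M.Cell) (f : Space d →ᵃ[ℝ] ℝ) (x : Space d) :
    f x = ∑ p ∈ T.1, T.lam p x * f p := by
  have hf (y : Space d) : f y = f.linear y + f 0 := by
    have := f.map_vadd 0 y
    simpa using this
  have h1 : f x = ∑ p ∈ T.1, T.lam p x * f.linear p + (∑ p ∈ T.1, T.lam p x) * f 0 := by
    conv_lhs => rw [hf, ← T.sum_lam_smul x]
    simp only [map_sum, map_smul, smul_eq_mul, T.sum_lam, one_mul]
  rw [h1, Finset.sum_mul, ← Finset.sum_add_distrib]
  exact Finset.sum_congr rfl fun p _ => by rw [hf p]; ring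

lemma range_basis (T : M.Cell) : Set.range T.basis = (T.1 : Set (Space d)) := by
  ext x; exact ⟨fun ⟨p, hp⟩ => hp ▸ p.2, fun h => ⟨⟨x, h⟩, rfl⟩⟩

lemma mem_simplex_iff (T : M.Cell) {x : Space d} : x ∈ T.simplex ↔ ∀ p, 0 ≤ T.lam p x := by
  rw [simplex, ← T.range_basis, T.basis.convexHull_eq_nonneg_coord]
  refine ⟨fun h p => ?_, fun h p => ?_⟩
  · by_cases hp : p ∈ T.1
    · rw [lam_of_mem T hp]; exact h ⟨p, hp⟩
    · rw [lam_of_notMem T hp]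
  · have := h p
    rwa [lam_of_mem T p.2] at this

lemma mem_interior_iff (T : M.Cell) {x : Space d} :
    x ∈ interior T.simplex ↔ ∀ p ∈ T.1, 0 < T.lam p x := by
  rw [simplex, ← T.range_basis, T.basis.interior_convexHull]
  refine ⟨fun h p hp => ?_, fun h p => ?_⟩
  · rw [lam_of_mem T hp]; exact h ⟨p, hp⟩
  · have := h p p.2
    rwa [lam_of_mem T p.2] at this

lemma lam_le_one (T : M.Cell) {x : Space d} (hx : x ∈ T.simplex) (p : Space d) :
    T.lam p x ≤ 1 := by
  rw [mem_simplex_iff] at hx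
  by_cases hp : p ∈ T.1
  · rw [← T.sum_lam x]
    exact Finset.single_le_sum (f := fun p => T.lam p x) (fun q _ => hx q) hp
  · rw [lam_of_notMem T hp]; exact zero_le_one

lemma subset_simplex (T : M.Cell) {p : Space d} (hp : p ∈ T.1) : p ∈ T.simplex :=
  subset_convexHull ℝ _ hp

lemma convex_simplex (T : M.Cell) : Convex ℝ T.simplex := convex_convexHull ℝ _

lemma continuous_lam (T : M.Cell) (p : Space d) : Continuous (T.lam p) :=
  (T.lam p).continuous_of_finiteDimensional

/-- The derivative of a barycentric coordinate. -/
noncomputable def dlam (T : M.Cell) (p : Space d) : Space d →L[ℝ] ℝ :=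
  LinearMap.toContinuousLinearMap (T.lam p).linear

lemma lam_add (T : M.Cell) (p x v : Space d) : T.lam p (x + v) = T.lam p x + T.dlam p v := by
  have := (T.lam p).map_vadd x v
  rw [vadd_eq_add, vadd_eq_add, add_comm v x] at this
  rw [this, add_comm]
  rfl

lemma dlam_sub (T : M.Cell) (p x y : Space d) : T.dlam p (y - x) = T.lam p y - T.lam p x := by
  have := T.lam_add p x (y - x)
  rw [add_sub_cancel] at this
  linarith

lemma hasFDerivAt_lam (T : M.Cell) (p x : Space d) : HasFDerivAt (T.lam p) (T.dlam p) x := by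
  have : (T.lam p : Space d → ℝ) = fun y => T.lam p 0 + T.dlam p y := by
    funext y
    rw [← T.lam_add, zero_add]
  rw [this]
  exact (T.dlam p).hasFDerivAt.const_add _

lemma contDiff_lam (T : M.Cell) (p : Space d) {n : ℕ∞} : ContDiff ℝ n (T.lam p) := by
  have : (T.lam p : Space d → ℝ) = fun y => T.lam p 0 + T.dlam p y := by
    funext y
    rw [← T.lam_add, zero_add]
  rw [this]
  exact contDiff_const.add (T.dlam p).contDiff

end Cell

lemma affine_eqOn_convexHull {f g : Space d →ᵃ[ℝ] ℝ} {s : Set (Space d)}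
    (h : ∀ x ∈ s, f x = g x) : ∀ x ∈ convexHull ℝ s, f x = g x := by
  intro x hx
  have h1 : Set.EqOn f g (affineSpan ℝ s) := AffineMap.eqOn_affineSpan h
  exact h1 (convexHull_subset_affineSpan s hx)

namespace Cell

lemma inter_subset (T T' : M.Cell) :
    T.simplex ∩ T'.simplex ⊆ convexHull ℝ ((T.1 : Set (Space d)) ∩ T'.1) :=
  M.complex.inter_subset_convexHull T.2.1 T'.2.1

/-- The barycentric coordinates of two elements agree where the elements meet. -/
lemma lam_eq_lam {T T' : M.Cell} {x : Space d} (hx : x ∈ T.simplex) (hx' : x ∈ T'.simplex)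
    (p : Space d) : T.lam p x = T'.lam p x := by
  refine affine_eqOn_convexHull (fun q hq => ?_) x (inter_subset T T' ⟨hx, hx'⟩)
  rcases eq_or_ne p q with rfl | hpq
  · rw [T.lam_self hq.1, T'.lam_self hq.2]
  · rw [T.lam_of_ne hq.1 hpq, T'.lam_of_ne hq.2 hpq]

/-- A point of an element that lies in a face of the complex has nonzero coordinates only for
vertices of the face. -/
lemma mem_of_lam_ne_zero {T : M.Cell} {t : Finset (Space d)} (ht : t ∈ M.complex.faces)
    {x p : Space d} (hx : x ∈ T.simplex) (hxt : x ∈ convexHull ℝ (t : Set (Space d)))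
    (hp : T.lam p x ≠ 0) : p ∈ t := by
  by_contra hpt
  refine hp ?_
  refine affine_eqOn_convexHull (g := 0) (fun q hq => ?_) x
    (M.complex.inter_subset_convexHull T.2.1 ht ⟨hx, hxt⟩)
  refine T.lam_of_ne hq.1 ?_
  rintro rfl
  exact hpt hq.2

lemma mem_convexHull_iff (T : M.Cell) {s : Finset (Space d)} (hs : s ⊆ T.1) {x : Space d} :
    x ∈ convexHull ℝ (s : Set (Space d)) ↔ x ∈ T.simplex ∧ ∀ p, p ∉ s → T.lam p x = 0 := by
  refine ⟨fun h => ⟨convexHull_mono (by exact_mod_cast hs) h, fun p hp => ?_⟩, fun ⟨h, h0⟩ => ?_⟩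
  · refine affine_eqOn_convexHull (g := 0) (fun q hq => ?_) x h
    refine T.lam_of_ne (hs hq) ?_
    rintro rfl
    exact hp hq
  · rw [Finset.mem_convexHull']
    have e1 := T.sum_lam x
    have e2 := T.sum_lam_smul x
    rw [← Finset.sum_subset hs fun p _ hp => h0 p hp] at e1
    rw [← Finset.sum_subset hs fun p _ hp => by rw [h0 p hp, zero_smul]] at e2
    exact ⟨fun p => T.lam p x, fun p _ => T.mem_simplex_iff.1 h p, e1, e2⟩

end Cell

/-! ### Measure of the elements and of their faces -/

lemma finrank_vectorSpan_lt (s : Finset (Space d)) (hs : s.Nonempty) :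
    Module.finrank ℝ (vectorSpan ℝ (s : Set (Space d))) + 1 ≤ s.card := by
  classical
  have := hs.coe_sort
  have h := finrank_vectorSpan_range_add_one_le ℝ ((↑) : s → Space d)
  rw [show Set.range ((↑) : s → Space d) = (s : Set (Space d)) from Subtype.range_coe_subtype,
    Fintype.card_coe] at h
  exact h

/-- The lines in a given direction through a face of codimension at least two fill a null set. -/
lemma volume_convexHull_add_line (s : Finset (Space d)) (hs : s.card + 1 ≤ d) (e : Space d) :
    volume {x : Space d | ∃ t : ℝ, x + t • e ∈ convexHull ℝ (s : Set (Space d))} = 0 := by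
  rcases s.eq_empty_or_nonempty with rfl | hne
  · simp
  obtain ⟨p, hp⟩ := id hne
  let A := AffineSubspace.mk' p (vectorSpan ℝ (s : Set (Space d)) ⊔ Submodule.span ℝ {e})
  have hA : A ≠ ⊤ := by
    intro h
    have h1 : A.direction = ⊤ := by rw [h]; exact AffineSubspace.direction_top ℝ _ _
    rw [AffineSubspace.direction_mk'] at h1
    have h2 := Submodule.finrank_add_le_finrank_add_finrank (vectorSpan ℝ (s : Set (Space d)))
      (Submodule.span ℝ {e})
    rw [h1, finrank_top, finrank_euclideanSpace_fin] at h2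
    have h3 := finrank_span_le_card (R := ℝ) ({e} : Set (Space d))
    rw [Set.toFinset_singleton, Finset.card_singleton] at h3
    have h4 := finrank_vectorSpan_lt s hne
    omega
  refine measure_mono_null ?_ (Measure.addHaar_affineSubspace volume A hA)
  rintro x ⟨t, ht⟩
  change x ∈ A
  rw [AffineSubspace.mem_mk']
  have h1 := convexHull_subset_affineSpan _ ht
  have h2 := AffineSubspace.vsub_mem_direction h1 (subset_affineSpan ℝ _ hp)
  rw [direction_affineSpan] at h2
  have : x -ᵥ p = (x + t • e -ᵥ p) + (-t) • e := by
    simp only [vsub_eq_sub, neg_smul]; abel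
  rw [this]
  exact Submodule.add_mem_sup h2
    (Submodule.smul_mem _ _ (Submodule.mem_span_singleton_self e))

lemma volume_convexHull_eq_zero (s : Finset (Space d)) (hs : s.card ≤ d) :
    volume (convexHull ℝ (s : Set (Space d))) = 0 := by
  rcases s.eq_empty_or_nonempty with rfl | hne
  · simp
  refine measure_mono_null (convexHull_subset_affineSpan _)
    (Measure.addHaar_affineSubspace volume _ fun h => ?_)
  have h1 := direction_affineSpan ℝ (s : Set (Space d))
  rw [h, AffineSubspace.direction_top] at h1
  have h4 := finrank_vectorSpan_lt s hne
  rw [← h1, finrank_top, finrank_euclideanSpace_fin] at h4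
  omega

noncomputable instance : Fintype M.Cell := @Fintype.ofFinite _ M.finite_cell

lemma volume_frontier : volume (frontier M.Ω) = 0 := by
  obtain ⟨B, hB, h⟩ := M.frontier_resolved
  rw [h, measure_biUnion_null_iff]
  · exact fun F hF => volume_convexHull_eq_zero F (hB F hF).2.le
  · exact (M.finite_faces.subset fun F hF => (hB F hF).1).countable

lemma closure_eq_iUnion : closure M.Ω = ⋃ T : M.Cell, T.simplex := by
  refine subset_antisymm (fun x hx => ?_) (Set.iUnion_subset fun T x hx => ?_)
  · rw [M.closure_eq, Geometry.SimplicialComplex.mem_space_iff] at hx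
    obtain ⟨s, hs, hxs⟩ := hx
    obtain ⟨t, ht, hst, hcard⟩ := M.pure s hs
    exact Set.mem_iUnion.2 ⟨⟨t, ht, hcard⟩, convexHull_mono (by exact_mod_cast hst) hxs⟩
  · rw [M.closure_eq, Geometry.SimplicialComplex.mem_space_iff]
    exact ⟨T.1, T.2.1, hx⟩

lemma Cell.subset_closure_domain (T : M.Cell) : T.simplex ⊆ closure M.Ω := by
  rw [closure_eq_iUnion]
  exact Set.subset_iUnion (fun T : M.Cell => T.simplex) T

lemma Cell.ne_inter_card {T T' : M.Cell} [DecidableEq (Space d)] (h : T ≠ T') :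
    (T.1 ∩ T'.1).card ≤ d := by
  by_contra hlt
  have h1 := T.card_eq
  have h2 := T'.card_eq
  have e1 : T.1 ∩ T'.1 = T.1 := Finset.eq_of_subset_of_card_le Finset.inter_subset_left (by omega)
  have e2 : T.1 ∩ T'.1 = T'.1 :=
    Finset.eq_of_subset_of_card_le Finset.inter_subset_right (by omega)
  exact h (Subtype.ext (e1.symm.trans e2))

lemma volume_inter_eq_zero {T T' : M.Cell} (h : T ≠ T') : volume (T.simplex ∩ T'.simplex) = 0 := by
  classical
  refine measure_mono_null (Cell.inter_subset T T') ?_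
  rw [← Finset.coe_inter]
  exact volume_convexHull_eq_zero _ (Cell.ne_inter_card h)

/-- The integral over the domain is the sum of the integrals over the elements. -/
lemma restrict_eq_sum (M : Triangulation d) :
    volume.restrict M.Ω = ∑ T : M.Cell, volume.restrict T.simplex := by
  have h1 : volume.restrict M.Ω = volume.restrict (closure M.Ω) := by
    refine Measure.restrict_congr_set ?_
    rw [closure_eq_self_union_frontier]
    exact (union_ae_eq_left_of_ae_eq_empty (ae_eq_empty.2 volume_frontier)).symm
  rw [h1, closure_eq_iUnion, Measure.restrict_iUnion_ae, Measure.sum_fintype]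
  · exact fun T T' h => volume_inter_eq_zero h
  · exact fun T => (isCompact_simplex T).measurableSet.nullMeasurableSet

lemma restrict_simplex_le (T : M.Cell) : volume.restrict T.simplex ≤ volume.restrict M.Ω := by
  rw [M.restrict_eq_sum]
  exact Measure.le_iff.2 fun s _ => by
    rw [Measure.finsetSum_apply]
    exact Finset.single_le_sum (f := fun T : M.Cell => volume.restrict T.simplex s)
      (fun _ _ => zero_le) (Finset.mem_univ T)

lemma ae_Ω_iff {P : Space d → Prop} :
    (∀ᵐ x ∂volume.restrict M.Ω, P x) ↔ ∀ T : M.Cell, ∀ᵐ x ∂volume.restrict T.simplex, P x := by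
  refine ⟨fun h T => ae_mono (restrict_simplex_le T) h, fun h => ?_⟩
  rw [M.restrict_eq_sum, ← Measure.sum_fintype, ae_iff, Measure.sum_apply_eq_zero]
  exact fun T => h T

lemma integral_Ω_eq_sum {E : Type*} [NormedAddCommGroup E] [NormedSpace ℝ E] {f : Space d → E}
    (hf : IntegrableOn f M.Ω) : ∫ x in M.Ω, f x = ∑ T : M.Cell, ∫ x in T.simplex, f x := by
  rw [M.restrict_eq_sum, integral_finsetSum_measure]
  exact fun T _ => Integrable.mono_measure hf (restrict_simplex_le T)

lemma lintegral_Ω_eq_sum (f : Space d → ℝ≥0∞) :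
    ∫⁻ x in M.Ω, f x = ∑ T : M.Cell, ∫⁻ x in T.simplex, f x := by
  rw [M.restrict_eq_sum, lintegral_finsetSum_measure]

lemma integrableOn_Ω_iff {E : Type*} [NormedAddCommGroup E] {f : Space d → E} :
    IntegrableOn f M.Ω ↔ ∀ T : M.Cell, IntegrableOn f T.simplex := by
  rw [IntegrableOn, M.restrict_eq_sum, integrable_finsetSum_measure]
  simp [IntegrableOn]

lemma Cell.nonempty_interior (T : M.Cell) : (interior T.simplex).Nonempty := by
  rw [Cell.simplex, ← T.range_basis,
    interior_convexHull_nonempty_iff_affineSpan_eq_top]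
  exact T.basis.tot

/-- The volume of an element. -/
noncomputable def Cell.vol (T : M.Cell) : ℝ := volume.real T.simplex

lemma Cell.volume_ne_zero (T : M.Cell) : volume T.simplex ≠ 0 :=
  (Measure.measure_pos_of_nonempty_interior volume T.nonempty_interior).ne'

lemma Cell.volume_ne_top (T : M.Cell) : volume T.simplex ≠ ⊤ :=
  (isCompact_simplex T).measure_lt_top.ne

lemma Cell.vol_pos (T : M.Cell) : 0 < T.vol :=
  ENNReal.toReal_pos T.volume_ne_zero T.volume_ne_top

lemma Cell.ofReal_vol (T : M.Cell) : ENNReal.ofReal T.vol = volume T.simplex :=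
  ENNReal.ofReal_toReal T.volume_ne_top

lemma Cell.ae_interior (T : M.Cell) :
    ∀ᵐ x ∂volume.restrict T.simplex, x ∈ interior T.simplex := by
  rw [ae_restrict_iff' (isCompact_simplex T).measurableSet, ae_iff]
  refine measure_mono_null (fun x hx => ?_) (T.convex_simplex.addHaar_frontier volume)
  simp only [Set.mem_ofPred_eq, Classical.not_imp] at hx
  exact ⟨subset_closure hx.1, hx.2⟩

instance (T : M.Cell) : IsFiniteMeasure (volume.restrict T.simplex) :=
  ⟨by simpa using (isCompact_simplex T).measure_lt_top⟩

instance (T : M.Cell) : NeZero (volume.restrict T.simplex) :=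
  ⟨by simpa using T.volume_ne_zero⟩

/-- The interior of an element lies in the domain: a boundary point lies in a facet of the complex,
so one of its barycentric coordinates vanishes. -/
lemma Cell.interior_subset_domain (T : M.Cell) : interior T.simplex ⊆ M.Ω := by
  intro x hx
  have h1 : x ∈ closure M.Ω := T.subset_closure_domain (interior_subset hx)
  rw [closure_eq_self_union_frontier] at h1
  rcases h1 with h1 | h1
  · exact h1
  obtain ⟨B, hB, h⟩ := M.frontier_resolved
  rw [h] at h1
  simp only [Set.mem_iUnion] at h1
  obtain ⟨F, hF, hxF⟩ := h1
  exfalso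
  have h2 : T.1 ⊆ F := fun p hp =>
    Cell.mem_of_lam_ne_zero (hB F hF).1 (interior_subset hx) hxF
      (T.mem_interior_iff.1 hx p hp).ne'
  have := Finset.card_le_card h2
  rw [T.card_eq, (hB F hF).2] at this
  omega

/-! ### The neighbor graph -/

lemma adj_of_mem {T T' : M.Cell} (h : T ≠ T') {p : Space d} (hp : p ∈ T.1) (hp' : p ∈ T'.1) :
    M.neighborGraph.Adj T T' := ⟨h, p, hp, hp'⟩

lemma adj_of_nonempty_inter {T T' : M.Cell} (h : T ≠ T')
    (hi : (T.simplex ∩ T'.simplex).Nonempty) : M.neighborGraph.Adj T T' := by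
  obtain ⟨x, hx⟩ := hi
  have h1 := Cell.inter_subset T T' hx
  obtain ⟨p, hp⟩ := convexHull_nonempty_iff.1 ⟨x, h1⟩
  exact adj_of_mem h hp.1 hp.2

lemma connected_neighborGraph (M : Triangulation d) : M.neighborGraph.Connected := by
  obtain ⟨x₀, hx₀⟩ := M.isConnected.nonempty
  have hne : Nonempty M.Cell := ⟨(exists_mem_simplex hx₀).choose⟩
  refine (SimpleGraph.connected_iff _).2 ⟨fun T₀ T₁ => ?_, hne⟩
  by_contra hT
  have hc := M.isConnected.isPreconnected.closure
  rw [isPreconnected_closed_iff] at hc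
  have hclosed (A : Set M.Cell) : IsClosed (⋃ T ∈ A, T.simplex) :=
    (Set.toFinite A).isClosed_biUnion fun T _ => (isCompact_simplex T).isClosed
  have hsub (T : M.Cell) (A : Set M.Cell) (h : T ∈ A) :
      (closure M.Ω ∩ ⋃ T ∈ A, T.simplex).Nonempty := by
    obtain ⟨x, hx⟩ := T.nonempty_interior
    have hx := interior_subset hx
    exact ⟨x, T.subset_closure_domain hx, Set.mem_biUnion h hx⟩
  obtain ⟨x, -, hx, hx'⟩ := hc (⋃ T ∈ {T | M.neighborGraph.Reachable T₀ T}, T.simplex)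
    (⋃ T ∈ {T | ¬ M.neighborGraph.Reachable T₀ T}, T.simplex) (hclosed _) (hclosed _) (by
      rw [closure_eq_iUnion]
      refine Set.iUnion_subset fun T => ?_
      by_cases h : M.neighborGraph.Reachable T₀ T
      · exact Set.subset_union_of_subset_left
          (Set.subset_biUnion_of_mem (u := fun T : M.Cell => T.simplex) h) _
      · exact Set.subset_union_of_subset_right
          (Set.subset_biUnion_of_mem (u := fun T : M.Cell => T.simplex) h) _)
    (hsub T₀ _ (SimpleGraph.Reachable.refl _)) (hsub T₁ _ hT)
  simp only [Set.mem_iUnion, Set.mem_ofPred_eq] at hx hx'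
  obtain ⟨T, hT1, hxT⟩ := hx
  obtain ⟨T', hT2, hxT'⟩ := hx'
  have hne : T ≠ T' := by rintro rfl; exact hT2 hT1
  exact hT2 (hT1.trans (adj_of_nonempty_inter hne ⟨x, hxT, hxT'⟩).reachable)

lemma δ_eq_one_iff {T T' : M.Cell} : M.δ T T' = 1 ↔ M.neighborGraph.Adj T T' :=
  SimpleGraph.dist_eq_one_iff_adj

end Triangulation

namespace Triangulation

variable {d : ℕ} {M : Triangulation d}

/-! ### Weights and mesh size functions -/

/-- The value of a weight on an element, taken as its essential infimum. -/
noncomputable def Cell.weight (T : M.Cell) (ρ : Space d → ℝ) : ℝ := (T.essinf ρ).toReal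

lemma Cell.essinf_le_esssup (T : M.Cell) (ρ : Space d → ℝ) : T.essinf ρ ≤ T.esssup ρ := by
  obtain ⟨x, hx, hx'⟩ := ((ENNReal.ae_le_essSup (fun x => ENNReal.ofReal (ρ x))).and
    (ae_essInf_le (f := fun x => ENNReal.ofReal (ρ x)) (μ := volume.restrict T.simplex))).exists
  exact hx'.trans hx

namespace IsWeight

variable {ρ : Space d → ℝ} {γ : ℝ}

lemma essinf_ne_zero (hρ : M.IsWeight ρ γ) (T : M.Cell) : T.essinf ρ ≠ 0 := by
  intro h0
  have h1 := hρ.esssup_le_essinf T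
  rw [h0, mul_zero, nonpos_iff_eq_zero, Cell.esssup, ENNReal.essSup_eq_zero_iff] at h1
  obtain ⟨x, hx, hx'⟩ := (h1.and (ae_Ω_iff.1 hρ.pos T)).exists
  simp only [Pi.zero_apply, ENNReal.ofReal_eq_zero] at hx
  linarith

lemma essinf_ne_top (_ : M.IsWeight ρ γ) (T : M.Cell) : T.essinf ρ ≠ ⊤ := by
  intro h0
  obtain ⟨x, hx⟩ := (ae_essInf_le (f := fun x => ENNReal.ofReal (ρ x))
    (μ := volume.restrict T.simplex)).exists
  rw [← Cell.essinf, h0, top_le_iff] at hx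
  exact ENNReal.ofReal_ne_top hx

lemma weight_pos (hρ : M.IsWeight ρ γ) (T : M.Cell) : 0 < T.weight ρ :=
  ENNReal.toReal_pos (hρ.essinf_ne_zero T) (hρ.essinf_ne_top T)

lemma weight_le (hρ : M.IsWeight ρ γ) (T : M.Cell) :
    ∀ᵐ x ∂volume.restrict T.simplex, T.weight ρ ≤ ρ x := by
  filter_upwards [ae_essInf_le (f := fun x => ENNReal.ofReal (ρ x))
    (μ := volume.restrict T.simplex), ae_Ω_iff.1 hρ.pos T] with x hx hx'
  have := ENNReal.toReal_mono ENNReal.ofReal_ne_top hx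
  rwa [ENNReal.toReal_ofReal hx'.le] at this

lemma le_weight (hρ : M.IsWeight ρ γ) (T : M.Cell) :
    ∀ᵐ x ∂volume.restrict T.simplex, ρ x ≤ γ * T.weight ρ := by
  have hγ := hρ.one_le
  filter_upwards [ENNReal.ae_le_essSup (μ := volume.restrict T.simplex)
    (fun x => ENNReal.ofReal (ρ x)), ae_Ω_iff.1 hρ.pos T] with x hx hx'
  have h1 := hx.trans (hρ.esssup_le_essinf T)
  have := ENNReal.toReal_mono (ENNReal.mul_ne_top ENNReal.ofReal_ne_top (hρ.essinf_ne_top T)) h1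
  rwa [ENNReal.toReal_ofReal hx'.le, ENNReal.toReal_mul, ENNReal.toReal_ofReal (by linarith)]
    at this

lemma weight_graded (hρ : M.IsWeight ρ γ) {T T' : M.Cell} (h : M.neighborGraph.Adj T T') :
    T'.weight ρ ≤ γ * T.weight ρ := by
  have hγ := hρ.one_le
  have := ENNReal.toReal_mono (ENNReal.mul_ne_top ENNReal.ofReal_ne_top (hρ.essinf_ne_top T))
    (hρ.essinf_le T T' (δ_eq_one_iff.2 h))
  rwa [ENNReal.toReal_mul, ENNReal.toReal_ofReal (by linarith)] at this

end IsWeight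

lemma Cell.eq_of_mem_interior {T T' : M.Cell} {x : Space d} (hx : x ∈ interior T.simplex)
    (hx' : x ∈ T'.simplex) : T = T' := by
  have h2 : T.1 ⊆ T'.1 := fun p hp =>
    Cell.mem_of_lam_ne_zero T'.2.1 (interior_subset hx) hx' (T.mem_interior_iff.1 hx p hp).ne'
  exact Subtype.ext (Finset.eq_of_subset_of_card_le h2 (by rw [T.card_eq, T'.card_eq]))

/-- The function that is constant on the interior of every element, with the given values. -/
noncomputable def stepFun {E : Type*} [AddCommMonoid E] (w : M.Cell → Space d → E)
    (x : Space d) : E :=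
  ∑ T : M.Cell, (interior T.simplex).indicator (w T) x

lemma stepFun_eq {E : Type*} [AddCommMonoid E] (w : M.Cell → Space d → E) {T : M.Cell}
    {x : Space d} (hx : x ∈ interior T.simplex) : stepFun w x = w T x := by
  rw [stepFun, Finset.sum_eq_single T]
  · exact Set.indicator_of_mem hx _
  · intro T' _ hT'
    refine Set.indicator_of_notMem (fun hx' => hT' ?_) _
    exact Cell.eq_of_mem_interior hx' (interior_subset hx)
  · exact fun h => (h (Finset.mem_univ T)).elim

lemma stepFun_ae {E : Type*} [AddCommMonoid E] (w : M.Cell → Space d → E) (T : M.Cell) :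
    ∀ᵐ x ∂volume.restrict T.simplex, stepFun w x = w T x := by
  filter_upwards [T.ae_interior] with x hx
  exact stepFun_eq w hx

lemma isWeight_stepFun {γ : ℝ} (hγ : 1 ≤ γ) {w : M.Cell → ℝ} (hw : ∀ T, 0 < w T)
    (hwγ : ∀ T T', M.neighborGraph.Adj T T' → w T' ≤ γ * w T) :
    M.IsWeight (stepFun fun T _ => w T) γ := by
  have hsup (T : M.Cell) : T.esssup (stepFun fun T _ => w T) = ENNReal.ofReal (w T) := by
    rw [Cell.esssup, ← essSup_const' (μ := volume.restrict T.simplex) (ENNReal.ofReal (w T))]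
    refine essSup_congr_ae ?_
    filter_upwards [stepFun_ae (fun T _ => w T) T] with x hx
    rw [hx]
  have hinf (T : M.Cell) : T.essinf (stepFun fun T _ => w T) = ENNReal.ofReal (w T) := by
    rw [Cell.essinf, ← essInf_const' (μ := volume.restrict T.simplex) (ENNReal.ofReal (w T))]
    refine essInf_congr_ae ?_
    filter_upwards [stepFun_ae (fun T _ => w T) T] with x hx
    rw [hx]
  refine ⟨hγ, ?_, ?_, fun T => ?_, fun T T' h => ?_, fun T T' h => ?_⟩
  · rw [integrableOn_Ω_iff]
    intro T
    refine (integrable_const (w T)).congr ?_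
    filter_upwards [stepFun_ae (fun T _ => w T) T] with x hx
    rw [hx]
  · rw [ae_Ω_iff]
    intro T
    filter_upwards [stepFun_ae (fun T _ => w T) T] with x hx
    rw [hx]
    exact hw T
  · rw [hsup, hinf, ← ENNReal.ofReal_mul (by linarith)]
    exact ENNReal.ofReal_le_ofReal (le_mul_of_one_le_left (hw T).le hγ)
  · rw [hsup, hsup, ← ENNReal.ofReal_mul (by linarith)]
    exact ENNReal.ofReal_le_ofReal (hwγ T T' (δ_eq_one_iff.1 h))
  · rw [hinf, hinf, ← ENNReal.ofReal_mul (by linarith)]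
    exact ENNReal.ofReal_le_ofReal (hwγ T T' (δ_eq_one_iff.1 h))

/-- The diameter of an element. -/
noncomputable def Cell.diam (T : M.Cell) : ℝ := Metric.diam T.simplex

lemma Cell.dist_le_diam (T : M.Cell) {x y : Space d} (hx : x ∈ T.simplex) (hy : y ∈ T.simplex) :
    dist x y ≤ T.diam :=
  Metric.dist_le_diam_of_mem (isCompact_simplex T).isBounded hx hy

lemma Cell.diam_nonneg (T : M.Cell) : 0 ≤ T.diam := Metric.diam_nonneg

lemma Cell.diam_pos (hd : 1 ≤ d) (T : M.Cell) : 0 < T.diam := by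
  have h : 1 < T.1.card := by rw [T.card_eq]; omega
  obtain ⟨p, hp, q, hq, hpq⟩ := Finset.one_lt_card.1 h
  exact (dist_pos.2 hpq).trans_le (T.dist_le_diam (T.subset_simplex hp) (T.subset_simplex hq))

/-- The regularity of a mesh that enters the estimates: elements contain balls of a radius
comparable to their diameters, and `w` is a graded function comparable to the diameters. -/
structure MeshBounds (M : Triangulation d) (w : M.Cell → ℝ) (γ κ χ : ℝ) : Prop where
  ball : ∀ T : M.Cell, ∃ (x : Space d) (r : ℝ), 0 < r ∧ Metric.closedBall x r ⊆ T.simplex ∧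
    T.diam ≤ χ * r
  one_le : 1 ≤ γ
  κ_pos : 0 < κ
  χ_pos : 0 < χ
  pos : ∀ T, 0 < w T
  diam_le : ∀ T, T.diam ≤ κ * w T
  le_diam : ∀ T, w T ≤ κ * T.diam
  graded : ∀ T T', M.neighborGraph.Adj T T' → w T' ≤ γ * w T

lemma IsMeshSize.meshBounds (hd : 1 ≤ d) {h : Space d → ℝ} {γ κ χ : ℝ}
    (hh : M.IsMeshSize h γ κ) (hχ : M.ShapeRegular χ) :
    MeshBounds M (fun T => T.weight h) γ κ χ := by
  obtain ⟨T₀⟩ := M.connected_neighborGraph.nonempty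
  have hκ : 0 < κ := by
    by_contra hκ
    have h1 := hh.diam_le T₀
    rw [ENNReal.ofReal_of_nonpos (not_lt.1 hκ), zero_mul, nonpos_iff_eq_zero,
      ENNReal.ofReal_eq_zero] at h1
    exact (T₀.diam_pos hd).not_ge h1
  refine ⟨hχ, hh.one_le, hκ, ?_, fun T => hh.weight_pos T, fun T => ?_, fun T => ?_,
    fun T T' h => hh.weight_graded h⟩
  · obtain ⟨x, r, hr, -, h⟩ := hχ T₀
    exact pos_of_mul_pos_left ((T₀.diam_pos hd).trans_le h) hr.le
  · have := ENNReal.toReal_mono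
      (ENNReal.mul_ne_top ENNReal.ofReal_ne_top (hh.essinf_ne_top T)) (hh.diam_le T)
    rwa [ENNReal.toReal_mul, ENNReal.toReal_ofReal Metric.diam_nonneg,
      ENNReal.toReal_ofReal hκ.le] at this
  · have h1 := (T.essinf_le_esssup h).trans (hh.le_diam T)
    have := ENNReal.toReal_mono
      (ENNReal.mul_ne_top ENNReal.ofReal_ne_top ENNReal.ofReal_ne_top) h1
    rwa [ENNReal.toReal_mul, ENNReal.toReal_ofReal hκ.le, ENNReal.toReal_ofReal Metric.diam_nonneg]
      at this

namespace MeshBounds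

variable {w : M.Cell → ℝ} {γ κ χ : ℝ}

lemma dist_le_of_walk (h : MeshBounds M w γ κ χ) {T T' : M.Cell} (p : M.neighborGraph.Walk T T')
    {x y : Space d} (hy : y ∈ T.simplex) (hx : x ∈ T'.simplex) :
    dist x y ≤ (p.length + 1) * (κ * γ ^ p.length * w T) := by
  have hγ := h.one_le
  have hκ := h.κ_pos
  induction p generalizing y with
  | nil =>
    simpa using (Cell.dist_le_diam _ hx hy).trans (h.diam_le _)
  | @cons T T₁ T' hadj p ih =>
    obtain ⟨-, z, hz, hz₁⟩ := id hadj
    have h1 := ih (Cell.subset_simplex _ hz₁) hx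
    have h2 := (T.dist_le_diam (T.subset_simplex hz) hy).trans (h.diam_le T)
    have h3 := h.graded _ _ hadj
    have h4 := h.pos T
    have h5 : 1 ≤ γ ^ (p.length + 1) := one_le_pow₀ hγ
    rw [SimpleGraph.Walk.length_cons]
    push_cast
    calc dist x y ≤ dist x z + dist z y := dist_triangle _ _ _
      _ ≤ (p.length + 1) * (κ * γ ^ p.length * (γ * w T)) + κ * 1 * w T := by
          rw [mul_one]
          refine add_le_add (h1.trans ?_) h2
          gcongr
      _ ≤ (p.length + 1) * (κ * γ ^ p.length * (γ * w T)) + κ * γ ^ (p.length + 1) * w T := by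
          gcongr
      _ = _ := by ring

/-- Elements at distance `n` lie in a ball whose radius is at most a multiple of `(n + 1) γⁿ`. -/
lemma growthBound (h : MeshBounds M w γ κ χ) :
    GrowthBound M.neighborGraph (fun T : M.Cell => T.vol) d ((κ ^ 2 * χ) ^ d) (γ ^ d) := by
  intro T n
  have hγ := h.one_le
  have hκ := h.κ_pos
  have hχ := h.χ_pos
  obtain ⟨x₀, r, hr, hball, hdiam⟩ := h.ball T
  have hx₀ : x₀ ∈ T.simplex := hball (Metric.mem_closedBall_self hr.le)
  set R := κ ^ 2 * χ * (n + 1) * γ ^ n * r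
  have hR : 0 ≤ R := by positivity
  have hsub : (⋃ T' ∈ Finset.univ.filter (fun T' => M.neighborGraph.dist T T' = n), T'.simplex) ⊆
      Metric.closedBall x₀ R := by
    refine Set.iUnion₂_subset fun T' hT' x hx => ?_
    rw [Finset.mem_filter] at hT'
    obtain ⟨p, hp⟩ := M.connected_neighborGraph.exists_walk_length_eq_dist T T'
    have h1 := h.dist_le_of_walk p hx₀ hx
    rw [hp, hT'.2] at h1
    refine h1.trans ?_
    have : w T ≤ κ * (χ * r) := (h.le_diam T).trans (by gcongr)
    calc _ ≤ (n + 1) * (κ * γ ^ n * (κ * (χ * r))) := by gcongr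
      _ = R := by ring
  set b := volume.real (Metric.ball (0 : Space d) 1)
  have hball' (x : Space d) {s : ℝ} (hs : 0 ≤ s) :
      volume.real (Metric.closedBall x s) = s ^ d * b := by
    rw [Measure.real, Measure.addHaar_closedBall _ _ hs, ENNReal.toReal_mul,
      finrank_euclideanSpace_fin, ENNReal.toReal_ofReal (by positivity)]
    rfl
  have h1 : ∑ T' with M.neighborGraph.dist T T' = n, T'.vol ≤ R ^ d * b := by
    rw [← hball' x₀ hR]
    have e : ∑ T' with M.neighborGraph.dist T T' = n, T'.vol = volume.real
        (⋃ T' ∈ Finset.univ.filter (fun T' => M.neighborGraph.dist T T' = n), T'.simplex) := by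
      rw [Measure.real, measure_biUnion_finset₀, ENNReal.toReal_sum]
      · rfl
      · exact fun T' _ => T'.volume_ne_top
      · exact fun T₁ _ T₂ _ h => volume_inter_eq_zero h
      · exact fun T' _ => (isCompact_simplex T').measurableSet.nullMeasurableSet
    rw [e]
    exact measureReal_mono hsub (measure_closedBall_lt_top).ne
  have h2 : r ^ d * b ≤ T.vol := by
    rw [← hball' x₀ hr.le]
    exact measureReal_mono hball T.volume_ne_top
  calc _ ≤ R ^ d * b := h1
    _ = (κ ^ 2 * χ) ^ d * ((n : ℝ) + 1) ^ d * (γ ^ d) ^ n * (r ^ d * b) := by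
        have e : (γ ^ d) ^ n = (γ ^ n) ^ d := by rw [← pow_mul, mul_comm d n, pow_mul]
        simp only [R, e, mul_pow]
        ring
    _ ≤ _ := by gcongr

end MeshBounds

end Triangulation

/-! ### Polynomials on elements -/

section Polynomials

variable {d : ℕ}

/-- The function on `ℝᵈ` given by a polynomial. -/
noncomputable def polyFun (P : MvPolynomial (Fin d) ℝ) (x : Space d) : ℝ :=
  MvPolynomial.eval (fun i => x i) P

lemma polyFun_add (P R : MvPolynomial (Fin d) ℝ) (x : Space d) :
    polyFun (P + R) x = polyFun P x + polyFun R x := by simp [polyFun]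

lemma polyFun_sub (P R : MvPolynomial (Fin d) ℝ) (x : Space d) :
    polyFun (P - R) x = polyFun P x - polyFun R x := by simp [polyFun]

lemma polyFun_smul (c : ℝ) (P : MvPolynomial (Fin d) ℝ) (x : Space d) :
    polyFun (c • P) x = c * polyFun P x := by simp [polyFun]

lemma polyFun_C (c : ℝ) (x : Space d) : polyFun (MvPolynomial.C c) x = c := by simp [polyFun]

lemma contDiff_polyFun (P : MvPolynomial (Fin d) ℝ) : ContDiff ℝ ∞ (polyFun P) := by
  induction P using MvPolynomial.induction_on with
  | C a =>
    have : polyFun (MvPolynomial.C a : MvPolynomial (Fin d) ℝ) = fun _ => a := by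
      funext x; exact polyFun_C a x
    rw [this]; exact contDiff_const
  | add P R hP hR =>
    have : polyFun (P + R) = fun x => polyFun P x + polyFun R x := by
      funext x; exact polyFun_add P R x
    rw [this]; exact hP.add hR
  | mul_X P i hP =>
    have : polyFun (P * MvPolynomial.X i) = fun x : Space d => polyFun P x * x i := by
      funext x; simp [polyFun]
    rw [this]
    exact hP.mul (EuclideanSpace.proj (𝕜 := ℝ) i).contDiff

lemma continuous_polyFun (P : MvPolynomial (Fin d) ℝ) : Continuous (polyFun P) :=
  (contDiff_polyFun P).continuous

lemma differentiable_polyFun (P : MvPolynomial (Fin d) ℝ) : Differentiable ℝ (polyFun P) :=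
  (contDiff_polyFun P).differentiable (by simp)

lemma eq_zero_of_polyFun_eq_zero {P : MvPolynomial (Fin d) ℝ} {U : Set (Space d)} (hU : IsOpen U)
    (hne : U.Nonempty) (h : ∀ x ∈ U, polyFun P x = 0) : P = 0 := by
  obtain ⟨x₀, hx₀⟩ := hne
  let e := EuclideanSpace.equiv (Fin d) ℝ
  have hV : IsOpen (e.symm ⁻¹' U) := hU.preimage e.symm.continuous
  obtain ⟨ε, hε, hball⟩ := Metric.isOpen_iff.1 hV (e x₀) (by simpa using hx₀)
  refine MvPolynomial.funext_set (fun i => Metric.ball (e x₀ i) ε) (fun i => ?_) fun y hy => ?_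
  · rw [Real.ball_eq_Ioo]
    exact Set.Ioo_infinite (by linarith)
  · rw [← ball_pi _ hε] at hy
    have := h _ (hball hy)
    rw [map_zero]
    exact this

/-- Polynomials can be rescaled without raising their degrees. -/
lemma exists_polyFun_comp (P : MvPolynomial (Fin d) ℝ) (x₀ : Space d) (r : ℝ) :
    ∃ R : MvPolynomial (Fin d) ℝ, R.totalDegree ≤ P.totalDegree ∧
      ∀ y, polyFun R y = polyFun P (x₀ + r • y) := by
  let f (i : Fin d) : MvPolynomial (Fin d) ℝ :=
    MvPolynomial.C (x₀ i) + MvPolynomial.C r * MvPolynomial.X i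
  have hf (i : Fin d) : (f i).totalDegree ≤ 1 := by
    refine (MvPolynomial.totalDegree_add _ _).trans (max_le (by simp) ?_)
    refine (MvPolynomial.totalDegree_mul _ _).trans ?_
    simp
  refine ⟨∑ α ∈ P.support, MvPolynomial.C (P.coeff α) * ∏ i, f i ^ α i, ?_, fun y => ?_⟩
  · refine MvPolynomial.totalDegree_finsetSum_le fun α hα => ?_
    refine (MvPolynomial.totalDegree_mul _ _).trans ?_
    rw [MvPolynomial.totalDegree_C, zero_add]
    refine (MvPolynomial.totalDegree_finsetProd _ _).trans ?_
    refine le_trans ?_ (MvPolynomial.le_totalDegree hα)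
    rw [Finsupp.sum_fintype _ _ fun _ => rfl]
    refine Finset.sum_le_sum fun i _ => (MvPolynomial.totalDegree_pow _ _).trans ?_
    exact (Nat.mul_le_mul_left _ (hf i)).trans (by simp)
  · rw [polyFun, polyFun, MvPolynomial.eval_eq' _ P, map_sum]
    refine Finset.sum_congr rfl fun α _ => ?_
    simp [f]

lemma exists_bound_of_injective {E F H : Type*} [AddCommGroup E] [Module ℝ E]
    [FiniteDimensional ℝ E] [NormedAddCommGroup F] [NormedSpace ℝ F] [NormedAddCommGroup H]
    [NormedSpace ℝ H] (ι : E →ₗ[ℝ] H) (hι : Function.Injective ι) (N : E →ₗ[ℝ] F) :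
    ∃ c : ℝ, 0 ≤ c ∧ ∀ x, ‖N x‖ ≤ c * ‖ι x‖ := by
  let e := LinearEquiv.ofInjective ι hι
  let L := LinearMap.toContinuousLinearMap (N ∘ₗ e.symm.toLinearMap)
  refine ⟨‖L‖, L.opNorm_nonneg, fun x => ?_⟩
  have h := L.le_opNorm (e x)
  have h1 : L (e x) = N x := by simp [L]
  rwa [h1] at h

instance finiteDimensional_restrictTotalDegree (K : ℕ) :
    FiniteDimensional ℝ (MvPolynomial.restrictTotalDegree (Fin d) ℝ K) := by
  infer_instance

lemma memLp_polyFun_unitBall (P : MvPolynomial (Fin d) ℝ) :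
    MemLp (polyFun P) 2 (volume.restrict (Metric.closedBall (0 : Space d) 1)) := by
  have : IsFiniteMeasure (volume.restrict (Metric.closedBall (0 : Space d) 1)) :=
    ⟨by simpa using measure_closedBall_lt_top⟩
  obtain ⟨C, hC⟩ := (isCompact_closedBall (0 : Space d) 1).exists_bound_of_continuousOn
    (continuous_polyFun P).continuousOn
  refine MemLp.of_bound (continuous_polyFun P).aestronglyMeasurable C ?_
  exact (ae_restrict_iff' Metric.isClosed_closedBall.measurableSet).2 (.of_forall hC)

/-- The polynomials of degree at most `K` as functions in `L²` of the unit ball. -/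
noncomputable def polyLp (d K : ℕ) : MvPolynomial.restrictTotalDegree (Fin d) ℝ K →ₗ[ℝ]
    Lp ℝ 2 (volume.restrict (Metric.closedBall (0 : Space d) 1)) where
  toFun P := (memLp_polyFun_unitBall P.1).toLp
  map_add' P R := by
    rw [← MemLp.toLp_add]
    congr 1
    ext x
    exact polyFun_add _ _ x
  map_smul' c P := by
    rw [RingHom.id_apply, ← MemLp.toLp_const_smul]
    congr 1
    ext x
    exact polyFun_smul _ _ x

lemma norm_polyLp (K : ℕ) (P : MvPolynomial.restrictTotalDegree (Fin d) ℝ K) :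
    ‖polyLp d K P‖ ^ 2 = ∫ x in Metric.closedBall (0 : Space d) 1, polyFun P.1 x ^ 2 := by
  rw [← real_inner_self_eq_norm_sq, L2.inner_def]
  refine integral_congr_ae ?_
  filter_upwards [(memLp_polyFun_unitBall P.1).coeFn_toLp] with x hx
  have : (polyLp d K P : Space d → ℝ) x = polyFun P.1 x := hx
  simp [this, sq]

lemma polyFun_eq_zero_of_integral {P : MvPolynomial (Fin d) ℝ} {S : Set (Space d)}
    (hS : IsCompact S) (hne : (interior S).Nonempty) (h : ∫ x in S, polyFun P x ^ 2 = 0) :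
    P = 0 := by
  have hc : Continuous fun x => polyFun P x ^ 2 := (continuous_polyFun P).pow 2
  refine eq_zero_of_polyFun_eq_zero isOpen_interior hne fun x hx => ?_
  have h1 := (setIntegral_eq_zero_iff_of_nonneg_ae (.of_forall fun x => sq_nonneg (polyFun P x))
    (hc.continuousOn.integrableOn_compact hS)).1 h
  have h2 : (fun x => polyFun P x ^ 2) =ᵐ[volume.restrict (interior S)] fun _ => 0 :=
    ae_restrict_of_ae_restrict_of_subset interior_subset h1
  have h3 := Measure.eqOn_open_of_ae_eq h2 isOpen_interior hc.continuousOn continuousOn_const hx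
  simpa using h3

lemma polyLp_injective (d K : ℕ) : Function.Injective (polyLp d K) := by
  rw [injective_iff_map_eq_zero]
  intro P hP
  refine Subtype.ext (polyFun_eq_zero_of_integral (isCompact_closedBall (0 : Space d) 1) ?_ ?_)
  · exact ⟨0, Metric.ball_subset_interior_closedBall (Metric.mem_ball_self one_pos)⟩
  · rw [← norm_polyLp, hP]; simp

/-- The exponents of the monomials of degree at most `K`. -/
noncomputable def exponents (d K : ℕ) : Finset (Fin d →₀ ℕ) :=
  (Finsupp.finite_of_degree_le (σ := Fin d) K).toFinset

lemma mem_exponents {K : ℕ} {α : Fin d →₀ ℕ} : α ∈ exponents d K ↔ ∑ i, α i ≤ K := by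
  rw [exponents, Set.Finite.mem_toFinset, Set.mem_ofPred_eq, Finsupp.degree_eq_sum]

lemma polyFun_eq_sum {K : ℕ} {P : MvPolynomial (Fin d) ℝ} (hP : P.totalDegree ≤ K) (x : Space d) :
    polyFun P x = ∑ α ∈ exponents d K, P.coeff α * ∏ i, x i ^ α i := by
  rw [polyFun, MvPolynomial.eval_eq']
  refine Finset.sum_subset (fun α hα => ?_) fun α _ hα => ?_
  · rw [mem_exponents]
    have := MvPolynomial.le_totalDegree hα
    rw [Finsupp.sum_fintype _ _ fun _ => rfl] at this
    exact this.trans hP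
  · rw [MvPolynomial.notMem_support_iff.1 hα, zero_mul]

/-- The coefficients of a polynomial, its values and its derivatives on a ball are bounded by its
mean square on the unit ball. -/
lemma exists_polynomial_bound (d K : ℕ) (χ : ℝ) :
    ∃ c : ℝ, 0 ≤ c ∧ ∀ P : MvPolynomial (Fin d) ℝ, P.totalDegree ≤ K →
      (∀ y ∈ Metric.closedBall (0 : Space d) χ,
        |polyFun P y| ≤ c * √(∫ x in Metric.closedBall (0 : Space d) 1, polyFun P x ^ 2)) ∧
      (∀ y ∈ Metric.closedBall (0 : Space d) χ,
        ‖fderiv ℝ (polyFun P) y‖ ≤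
          c * √(∫ x in Metric.closedBall (0 : Space d) 1, polyFun P x ^ 2)) ∧
      ∑ α ∈ exponents d K, |P.coeff α| ≤
        c * √(∫ x in Metric.closedBall (0 : Space d) 1, polyFun P x ^ 2) := by
  let E := MvPolynomial.restrictTotalDegree (Fin d) ℝ K
  let B := Metric.closedBall (0 : Space d) χ
  have : CompactSpace B := isCompact_iff_compactSpace.1 (isCompact_closedBall _ _)
  let N₁ : E →ₗ[ℝ] C(B, ℝ) :=
    { toFun := fun P =>
        ⟨fun y => polyFun P.1 y, (continuous_polyFun P.1).comp continuous_subtype_val⟩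
      map_add' := fun P R => by ext y; exact polyFun_add _ _ _
      map_smul' := fun c P => by ext y; exact polyFun_smul _ _ _ }
  have hD (P : MvPolynomial (Fin d) ℝ) : Continuous fun y => fderiv ℝ (polyFun P) y :=
    (contDiff_polyFun P).continuous_fderiv (by simp)
  let N₂ : E →ₗ[ℝ] C(B, Space d →L[ℝ] ℝ) :=
    { toFun := fun P => ⟨fun y => fderiv ℝ (polyFun P.1) y, (hD P.1).comp continuous_subtype_val⟩
      map_add' := fun P R => by
        ext1 y
        have : polyFun (P + R : E).1 = polyFun P.1 + polyFun R.1 := by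
          funext x; exact polyFun_add _ _ _
        change fderiv ℝ (polyFun (P + R : E).1) y = _
        rw [this, fderiv_add (differentiable_polyFun _ _) (differentiable_polyFun _ _)]
        rfl
      map_smul' := fun c P => by
        ext1 y
        have : polyFun (c • P : E).1 = c • polyFun P.1 := by
          funext x; exact polyFun_smul _ _ _
        change fderiv ℝ (polyFun (c • P : E).1) y = _
        rw [this, fderiv_const_smul (differentiable_polyFun _ _)]
        rfl }
  let N₃ (α : Fin d →₀ ℕ) : E →ₗ[ℝ] ℝ := (MvPolynomial.lcoeff ℝ α).comp E.subtype
  obtain ⟨c₁, hc₁, h₁⟩ := exists_bound_of_injective _ (polyLp_injective d K) N₁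
  obtain ⟨c₂, hc₂, h₂⟩ := exists_bound_of_injective (F := C(B, Space d →L[ℝ] ℝ)) _
    (polyLp_injective d K) N₂
  choose c₃ hc₃ h₃ using fun α => exists_bound_of_injective _ (polyLp_injective d K) (N₃ α)
  have hs : 0 ≤ ∑ α ∈ exponents d K, c₃ α := Finset.sum_nonneg fun α _ => hc₃ α
  refine ⟨c₁ + c₂ + ∑ α ∈ exponents d K, c₃ α, by positivity, fun P hP => ?_⟩
  let P' : E := ⟨P, (MvPolynomial.mem_restrictTotalDegree _ _ _).2 hP⟩
  have hn : √(∫ x in Metric.closedBall (0 : Space d) 1, polyFun P x ^ 2) = ‖polyLp d K P'‖ := by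
    rw [← norm_polyLp K P', Real.sqrt_sq (norm_nonneg _)]
  rw [hn]
  have hn0 := norm_nonneg (polyLp d K P')
  refine ⟨fun y hy => ?_, fun y hy => ?_, ?_⟩
  · have : |polyFun P y| ≤ ‖N₁ P'‖ := (N₁ P').norm_coe_le_norm ⟨y, hy⟩
    refine (this.trans (h₁ P')).trans (mul_le_mul_of_nonneg_right ?_ hn0)
    linarith
  · have : ‖fderiv ℝ (polyFun P) y‖ ≤ ‖N₂ P'‖ := (N₂ P').norm_coe_le_norm ⟨y, hy⟩
    refine (this.trans (h₂ P')).trans (mul_le_mul_of_nonneg_right ?_ hn0)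
    linarith
  · calc ∑ α ∈ exponents d K, |P.coeff α| ≤ ∑ α ∈ exponents d K, c₃ α * ‖polyLp d K P'‖ :=
          Finset.sum_le_sum fun α _ => h₃ α P'
      _ = (∑ α ∈ exponents d K, c₃ α) * ‖polyLp d K P'‖ := by rw [Finset.sum_mul]
      _ ≤ _ := mul_le_mul_of_nonneg_right (by linarith) hn0

end Polynomials

namespace Triangulation

variable {d : ℕ} {M : Triangulation d}

/-- The root mean square of a function over an element. -/
noncomputable def Cell.rms (T : M.Cell) (f : Space d → ℝ) : ℝ :=
  √((∫ x in T.simplex, f x ^ 2) / T.vol)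

lemma Cell.rms_nonneg (T : M.Cell) (f : Space d → ℝ) : 0 ≤ T.rms f := Real.sqrt_nonneg _

lemma Cell.vol_mul_rms_sq (T : M.Cell) (f : Space d → ℝ) :
    T.vol * T.rms f ^ 2 = ∫ x in T.simplex, f x ^ 2 := by
  have : 0 ≤ ∫ x in T.simplex, f x ^ 2 := integral_nonneg fun x => sq_nonneg _
  have hv := T.vol_pos
  rw [Cell.rms, Real.sq_sqrt (by positivity)]
  field_simp

/-- Inverse estimates for polynomials on shape regular elements. -/
lemma exists_inverse_estimate (d K : ℕ) (χ : ℝ) :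
    ∃ c : ℝ, 0 ≤ c ∧ ∀ (M : Triangulation d) (T : M.Cell) (x₀ : Space d) (r : ℝ), 0 < r →
      Metric.closedBall x₀ r ⊆ T.simplex → T.diam ≤ χ * r →
      ∀ P : MvPolynomial (Fin d) ℝ, P.totalDegree ≤ K →
        (∀ x ∈ T.simplex, |polyFun P x| ≤ c * T.rms (polyFun P)) ∧
        (∀ x ∈ T.simplex, T.diam * ‖fderiv ℝ (polyFun P) x‖ ≤ c * T.rms (polyFun P)) ∧
        ∃ a : (Fin d →₀ ℕ) → ℝ, ∑ α ∈ exponents d K, |a α| ≤ c * T.rms (polyFun P) ∧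
          ∀ x, polyFun P x = ∑ α ∈ exponents d K, a α * ∏ i, (r⁻¹ * (x i - x₀ i)) ^ α i := by
  obtain ⟨c, hc, h⟩ := exists_polynomial_bound d K χ
  set b := volume.real (Metric.ball (0 : Space d) 1)
  refine ⟨(1 + |χ|) * (c * √(|χ| ^ d * b)), by positivity, ?_⟩
  intro M T x₀ r hr hball hdiam P hP
  have hx₀ : x₀ ∈ T.simplex := hball (Metric.mem_closedBall_self hr.le)
  have hχ : 0 ≤ χ := nonneg_of_mul_nonneg_left (T.diam_nonneg.trans hdiam) hr
  rw [abs_of_nonneg hχ]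
  obtain ⟨R, hRd, hR⟩ := exists_polyFun_comp P x₀ r
  obtain ⟨h₁, h₂, h₃⟩ := h R (hRd.trans hP)
  have hv := T.vol_pos
  have hvol : T.vol ≤ (χ * r) ^ d * b := by
    have h1 : volume.real (Metric.closedBall x₀ (χ * r)) = (χ * r) ^ d * b := by
      rw [Measure.real, Measure.addHaar_closedBall _ _ (by positivity), ENNReal.toReal_mul,
        finrank_euclideanSpace_fin, ENNReal.toReal_ofReal (by positivity)]
      rfl
    rw [← h1]
    exact measureReal_mono (fun x hx => (T.dist_le_diam hx hx₀).trans hdiam)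
      (measure_closedBall_lt_top).ne
  have hint : ∫ y in Metric.closedBall (0 : Space d) 1, polyFun R y ^ 2 =
      (r ^ d)⁻¹ * ∫ x in Metric.closedBall x₀ r, polyFun P x ^ 2 := by
    let f : Space d → ℝ := (Metric.closedBall x₀ r).indicator fun x => polyFun P x ^ 2
    have e1 : ∀ y, f (x₀ + r • y) =
        (Metric.closedBall (0 : Space d) 1).indicator (fun y => polyFun R y ^ 2) y := by
      intro y
      have : x₀ + r • y ∈ Metric.closedBall x₀ r ↔ y ∈ Metric.closedBall (0 : Space d) 1 := by
        rw [Metric.mem_closedBall, Metric.mem_closedBall, dist_eq_norm, dist_zero_right,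
          add_sub_cancel_left, norm_smul, Real.norm_of_nonneg hr.le]
        exact mul_le_iff_le_one_right hr
      by_cases hy : y ∈ Metric.closedBall (0 : Space d) 1
      · rw [Set.indicator_of_mem hy, hR]
        exact Set.indicator_of_mem (this.2 hy) _
      · rw [Set.indicator_of_notMem hy]
        exact Set.indicator_of_notMem (fun h => hy (this.1 h)) _
    rw [← integral_indicator Metric.isClosed_closedBall.measurableSet,
      ← integral_indicator Metric.isClosed_closedBall.measurableSet]
    simp_rw [← e1]
    rw [Measure.integral_comp_smul volume (fun z => f (x₀ + z)) r,
      integral_add_left_eq_self f x₀, finrank_euclideanSpace_fin,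
      abs_of_nonneg (by positivity), smul_eq_mul]
  have hkey : √(∫ y in Metric.closedBall (0 : Space d) 1, polyFun R y ^ 2) ≤
      √(χ ^ d * b) * T.rms (polyFun P) := by
    rw [Cell.rms, ← Real.sqrt_mul (by positivity), hint]
    refine Real.sqrt_le_sqrt ?_
    have h1 : ∫ x in Metric.closedBall x₀ r, polyFun P x ^ 2 ≤
        ∫ x in T.simplex, polyFun P x ^ 2 :=
      setIntegral_mono_set
        (((continuous_polyFun P).pow 2).continuousOn.integrableOn_compact (isCompact_simplex T))
        (.of_forall fun x => sq_nonneg _) (LE.le.eventuallyLE hball)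
    have h2 : 0 ≤ ∫ x in T.simplex, polyFun P x ^ 2 := integral_nonneg fun x => sq_nonneg _
    rw [inv_mul_le_iff₀ (by positivity)]
    refine h1.trans ?_
    calc _ = T.vol * ((∫ x in T.simplex, polyFun P x ^ 2) / T.vol) := by field_simp
      _ ≤ ((χ * r) ^ d * b) * ((∫ x in T.simplex, polyFun P x ^ 2) / T.vol) := by gcongr
      _ = _ := by rw [mul_pow]; ring
  have hrms := T.rms_nonneg (polyFun P)
  have hy (x : Space d) : x = x₀ + r • (r⁻¹ • (x - x₀)) := by
    rw [smul_smul, mul_inv_cancel₀ hr.ne', one_smul]; abel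
  have hmem (x : Space d) (hx : x ∈ T.simplex) :
      r⁻¹ • (x - x₀) ∈ Metric.closedBall (0 : Space d) χ := by
    rw [mem_closedBall_zero_iff, norm_smul, norm_inv, Real.norm_of_nonneg hr.le, ← dist_eq_norm,
      inv_mul_le_iff₀ hr, mul_comm]
    exact (T.dist_le_diam hx hx₀).trans hdiam
  have hc' : c * √(∫ y in Metric.closedBall (0 : Space d) 1, polyFun R y ^ 2) ≤
      c * √(χ ^ d * b) * T.rms (polyFun P) := by
    rw [mul_assoc]; gcongr
  have hn : 0 ≤ c * √(χ ^ d * b) * T.rms (polyFun P) := by positivity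
  refine ⟨fun x hx => ?_, fun x hx => ?_, R.coeff, ?_, fun x => ?_⟩
  · rw [hy x, ← hR]
    refine ((h₁ _ (hmem x hx)).trans hc').trans ?_
    nlinarith
  · have hD : fderiv ℝ (polyFun P) x = r⁻¹ • fderiv ℝ (polyFun R) (r⁻¹ • (x - x₀)) := by
      have e : polyFun P = fun x => polyFun R (r⁻¹ • (x - x₀)) := by
        funext z; rw [hR, ← hy z]
      have h1 : HasFDerivAt (fun x : Space d => r⁻¹ • (x - x₀))
          (r⁻¹ • ContinuousLinearMap.id ℝ (Space d)) x :=
        ((hasFDerivAt_id x).sub_const x₀).const_smul r⁻¹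
      have h2 := ((differentiable_polyFun R (r⁻¹ • (x - x₀))).hasFDerivAt).comp x h1
      conv_lhs => rw [e]
      refine h2.fderiv.trans ?_
      ext v
      simp
    rw [hD, norm_smul, norm_inv, Real.norm_of_nonneg hr.le]
    calc _ ≤ (χ * r) * (r⁻¹ * ‖fderiv ℝ (polyFun R) (r⁻¹ • (x - x₀))‖) := by gcongr
      _ = χ * ‖fderiv ℝ (polyFun R) (r⁻¹ • (x - x₀))‖ := by field_simp
      _ ≤ χ * (c * √(χ ^ d * b) * T.rms (polyFun P)) := by
          gcongr
          exact (h₂ _ (hmem x hx)).trans hc'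
      _ ≤ _ := by nlinarith
  · refine (h₃.trans hc').trans ?_
    nlinarith
  · conv_lhs => rw [hy x, ← hR, polyFun_eq_sum (hRd.trans hP)]
    simp

/-- The local `L²`-projection to the polynomials of degree at most `K`. -/
lemma exists_local_projection (K : ℕ) (T : M.Cell) {u : Space d → ℝ}
    (hu : IntegrableOn u T.simplex) :
    ∃ P : MvPolynomial (Fin d) ℝ, P.totalDegree ≤ K ∧
      ∀ R : MvPolynomial (Fin d) ℝ, R.totalDegree ≤ K →
        ∫ x in T.simplex, polyFun P x * polyFun R x = ∫ x in T.simplex, u x * polyFun R x := by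
  let E := MvPolynomial.restrictTotalDegree (Fin d) ℝ K
  have hint (v : Space d → ℝ) (hv : IntegrableOn v T.simplex) (R : MvPolynomial (Fin d) ℝ) :
      IntegrableOn (fun x => v x * polyFun R x) T.simplex :=
    hv.mul_continuousOn (continuous_polyFun R).continuousOn (isCompact_simplex T)
  have hP (P : MvPolynomial (Fin d) ℝ) : IntegrableOn (polyFun P) T.simplex :=
    (continuous_polyFun P).continuousOn.integrableOn_compact (isCompact_simplex T)
  let ℓ (v : Space d → ℝ) (hv : IntegrableOn v T.simplex) : E →ₗ[ℝ] ℝ :=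
    { toFun := fun R => ∫ x in T.simplex, v x * polyFun R.1 x
      map_add' := fun R S => by
        rw [← integral_add (hint v hv _) (hint v hv _)]
        refine integral_congr_ae (.of_forall fun x => ?_)
        simp [polyFun_add, mul_add]
      map_smul' := fun c R => by
        rw [RingHom.id_apply, smul_eq_mul, ← integral_const_mul]
        refine integral_congr_ae (.of_forall fun x => ?_)
        simp [polyFun_smul, mul_left_comm] }
  let Φ : E →ₗ[ℝ] Module.Dual ℝ E :=
    { toFun := fun P => ℓ (polyFun P.1) (hP P.1)
      map_add' := fun P R => by
        ext S
        simp only [ℓ, LinearMap.coe_mk, AddHom.coe_mk, LinearMap.add_apply]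
        rw [← integral_add (hint _ (hP _) _) (hint _ (hP _) _)]
        refine integral_congr_ae (.of_forall fun x => ?_)
        simp [polyFun_add, add_mul]
      map_smul' := fun c P => by
        ext S
        simp only [ℓ, LinearMap.coe_mk, AddHom.coe_mk, LinearMap.smul_apply, RingHom.id_apply,
          smul_eq_mul]
        rw [← integral_const_mul]
        refine integral_congr_ae (.of_forall fun x => ?_)
        simp [polyFun_smul, mul_assoc] }
  have hΦ : Function.Injective Φ := by
    rw [injective_iff_map_eq_zero]
    intro P hP0
    refine Subtype.ext (polyFun_eq_zero_of_integral (isCompact_simplex T) T.nonempty_interior ?_)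
    have := LinearMap.congr_fun hP0 P
    simpa [Φ, ℓ, sq] using this
  obtain ⟨P, hPu⟩ := (LinearMap.injective_iff_surjective_of_finrank_eq_finrank
    Subspace.dual_finrank_eq.symm).1 hΦ (ℓ u hu)
  refine ⟨P.1, (MvPolynomial.mem_restrictTotalDegree _ _ _).1 P.2, fun R hR => ?_⟩
  exact LinearMap.congr_fun hPu ⟨R, (MvPolynomial.mem_restrictTotalDegree _ _ _).2 hR⟩

end Triangulation

/-! ### Weighted stability in terms of the elements -/

lemma GradedBound.mono {ι : Type} [Fintype ι] {G : SimpleGraph ι} {μ V U U' : ι → ℝ} {γ C c : ℝ}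
    (h : GradedBound G μ γ C V U) (hμ : ∀ i, 0 < μ i) (hU : ∀ i, 0 ≤ U i)
    (hUU' : ∀ i, U i ≤ c * U' i) : GradedBound G μ γ (C * c) V U' := by
  intro w hw hwγ
  refine (h w hw hwγ).trans ?_
  rw [mul_pow, mul_assoc]
  refine mul_le_mul_of_nonneg_left ?_ (sq_nonneg C)
  rw [Finset.mul_sum]
  refine Finset.sum_le_sum fun i _ => ?_
  have h1 : (w i * U i) ^ 2 ≤ (w i * (c * U' i)) ^ 2 :=
    pow_le_pow_left₀ (mul_nonneg (hw i).le (hU i))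
      (mul_le_mul_of_nonneg_left (hUU' i) (hw i).le) 2
  calc μ i * (w i * U i) ^ 2 ≤ μ i * (w i * (c * U' i)) ^ 2 :=
        mul_le_mul_of_nonneg_left h1 (hμ i).le
    _ = _ := by ring

lemma LpBound.mono_const {ι : Type} [Fintype ι] {μ r V U : ι → ℝ} {p : ℝ≥0∞} {c c' : ℝ}
    (h : LpBound μ r p c V U) (hμ : ∀ i, 0 ≤ μ i) (hc : 0 ≤ c) (hcc' : c ≤ c')
    (hU : ∀ i, 0 ≤ r i * U i) : LpBound μ r p c' V U := by
  refine ⟨fun hp => (h.1 hp).trans ?_, fun hp A hA i => (h.2 hp A hA i).trans ?_⟩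
  · refine mul_le_mul_of_nonneg_right (Real.rpow_le_rpow hc hcc' ENNReal.toReal_nonneg) ?_
    exact Finset.sum_nonneg fun i _ => mul_nonneg (hμ i) (Real.rpow_nonneg (hU i) _)
  · exact mul_le_mul_of_nonneg_right hcc' ((hU i).trans (hA i))

namespace Triangulation

variable {d : ℕ} {M : Triangulation d}

/-- The mean value of a function over an element. -/
noncomputable def Cell.avg (T : M.Cell) (f : Space d → ℝ) : ℝ := (∫ x in T.simplex, f x) / T.vol

lemma Cell.vol_mul_avg (T : M.Cell) (f : Space d → ℝ) :
    T.vol * T.avg f = ∫ x in T.simplex, f x := by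
  have := T.vol_pos
  rw [Cell.avg]; field_simp

lemma Cell.avg_nonneg (T : M.Cell) {f : Space d → ℝ} (hf : ∀ x, 0 ≤ f x) : 0 ≤ T.avg f :=
  div_nonneg (integral_nonneg hf) T.vol_pos.le

lemma Cell.rms_congr (T : M.Cell) {f g : Space d → ℝ}
    (h : ∀ᵐ x ∂volume.restrict T.simplex, f x = g x) : T.rms f = T.rms g := by
  rw [Cell.rms, Cell.rms]
  congr 2
  refine integral_congr_ae ?_
  filter_upwards [h] with x hx
  rw [hx]

lemma eLpNorm_stepFun_mul {f : Space d → ℝ} (hf : MemLp f 2 (volume.restrict M.Ω))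
    (w : M.Cell → ℝ) :
    eLpNorm (fun x => stepFun (fun T _ => w T) x * f x) 2 (volume.restrict M.Ω) =
      ENNReal.ofReal √(∑ T : M.Cell, T.vol * (w T * T.rms f) ^ 2) := by
  have hT (T : M.Cell) : MemLp f 2 (volume.restrict T.simplex) :=
    hf.mono_measure (restrict_simplex_le T)
  have h1 : ∫⁻ x in M.Ω, ‖stepFun (fun T _ => w T) x * f x‖ₑ ^ (2 : ℝ) =
      ENNReal.ofReal (∑ T : M.Cell, T.vol * (w T * T.rms f) ^ 2) := by
    rw [lintegral_Ω_eq_sum, ENNReal.ofReal_sum_of_nonneg fun T _ =>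
      mul_nonneg T.vol_pos.le (sq_nonneg _)]
    refine Finset.sum_congr rfl fun T _ => ?_
    have e1 : ∫⁻ x in T.simplex, ‖stepFun (fun T _ => w T) x * f x‖ₑ ^ (2 : ℝ) =
        ∫⁻ x in T.simplex, ENNReal.ofReal ((w T) ^ 2 * f x ^ 2) := by
      refine lintegral_congr_ae ?_
      filter_upwards [stepFun_ae (fun T _ => w T) T] with x hx
      rw [hx, ← ofReal_norm, ENNReal.ofReal_rpow_of_nonneg (norm_nonneg _) (by norm_num)]
      congr 1
      rw [Real.rpow_two, Real.norm_eq_abs, sq_abs, mul_pow]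
    rw [e1, ← ofReal_integral_eq_lintegral_ofReal ((hT T).integrable_sq.const_mul _)
      (.of_forall fun x => by positivity), integral_const_mul, ← T.vol_mul_rms_sq]
    congr 1
    ring
  rw [eLpNorm_eq_lintegral_rpow_enorm_toReal (by norm_num) (by norm_num), ENNReal.toReal_ofNat, h1,
    ENNReal.ofReal_rpow_of_nonneg
      (Finset.sum_nonneg fun T _ => mul_nonneg T.vol_pos.le (sq_nonneg _)) (by norm_num),
    Real.sqrt_eq_rpow]

lemma integrableOn_of_memLp {E : Type*} [NormedAddCommGroup E] {p : ℝ≥0∞} (hp : 1 ≤ p)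
    {u : Space d → E} (hu : MemLp u p (volume.restrict M.Ω)) : IntegrableOn u M.Ω := by
  have := M.isFiniteMeasure
  exact hu.integrable hp

/-- The weighted stability of the projection for one triangulation, in terms of the mean squares
over the elements. -/
lemma gradedBound_of_stable {K : ℕ} {γ C : ℝ} (hγ : 1 ≤ γ) (hC : 0 ≤ C)
    (h : ∀ ρ, M.IsWeight ρ γ → ∀ u, MemLp u 2 (volume.restrict M.Ω) →
      eLpNorm (fun x => ρ x * M.Q K u x) 2 (volume.restrict M.Ω) ≤
        ENNReal.ofReal C * eLpNorm (fun x => ρ x * u x) 2 (volume.restrict M.Ω))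
    {u v : Space d → ℝ} (hu : MemLp u 2 (volume.restrict M.Ω)) (hv : M.IsL2Projection K u v) :
    GradedBound M.neighborGraph (fun T : M.Cell => T.vol) γ C (fun T => T.rms v)
      (fun T => T.rms u) := by
  intro w hw hwγ
  have hQ := isL2Projection_Q K (integrableOn_of_memLp one_le_two hu)
  have hQ2 := memLp_two_of_memLagrange hQ.1
  have h1 := h _ (isWeight_stepFun hγ hw hwγ) u hu
  rw [eLpNorm_stepFun_mul hu, eLpNorm_stepFun_mul hQ2, ← ENNReal.ofReal_mul hC,
    ENNReal.ofReal_le_ofReal_iff (by positivity)] at h1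
  have e (T : M.Cell) : T.rms v = T.rms (M.Q K u) :=
    T.rms_congr (ae_Ω_iff.1 (hv.ae_eq hQ) T)
  have hs (f : M.Cell → ℝ) : 0 ≤ ∑ T : M.Cell, T.vol * f T ^ 2 :=
    Finset.sum_nonneg fun T _ => mul_nonneg T.vol_pos.le (sq_nonneg _)
  have h2 := pow_le_pow_left₀ (Real.sqrt_nonneg _) h1 2
  rw [mul_pow, Real.sq_sqrt (hs _), Real.sq_sqrt (hs _)] at h2
  simpa only [e] using h2

lemma MemLagrange.exists_polyFun {K : ℕ} {v : Space d → ℝ} (hv : M.MemLagrange K v) (T : M.Cell) :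
    ∃ P : MvPolynomial (Fin d) ℝ, P.totalDegree ≤ K ∧
      ∀ᵐ x ∂volume.restrict T.simplex, v x = polyFun P x := by
  obtain ⟨P, hP, hP', -⟩ := hv.2 T
  refine ⟨P, hP, ?_⟩
  filter_upwards [ae_Ω_iff.1 hP' T, ae_restrict_mem (isCompact_simplex T).measurableSet]
    with x hx hxT
  exact hx hxT

lemma integrableOn_mul_polyFun (T : M.Cell) {u : Space d → ℝ} (hu : IntegrableOn u T.simplex)
    (P : MvPolynomial (Fin d) ℝ) : IntegrableOn (fun x => u x * polyFun P x) T.simplex :=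
  hu.mul_continuousOn (continuous_polyFun P).continuousOn (isCompact_simplex T)

/-- The global projection only depends on the local projections to polynomials. Hence the data
enter the weighted stability only through the mean squares of the local projections. -/
lemma exists_gradedBound {K : ℕ} {γ C : ℝ} (hγ : 1 ≤ γ) (hC : 0 ≤ C)
    (h : ∀ ρ, M.IsWeight ρ γ → ∀ u, MemLp u 2 (volume.restrict M.Ω) →
      eLpNorm (fun x => ρ x * M.Q K u x) 2 (volume.restrict M.Ω) ≤
        ENNReal.ofReal C * eLpNorm (fun x => ρ x * u x) 2 (volume.restrict M.Ω))
    {u v : Space d → ℝ} (hu : IntegrableOn u M.Ω) (hv : M.IsL2Projection K u v) :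
    ∃ P : M.Cell → MvPolynomial (Fin d) ℝ, (∀ T, (P T).totalDegree ≤ K) ∧
      (∀ T, T.vol * T.rms (polyFun (P T)) ^ 2 = ∫ x in T.simplex, u x * polyFun (P T) x) ∧
      GradedBound M.neighborGraph (fun T : M.Cell => T.vol) γ C (fun T => T.rms v)
        (fun T => T.rms (polyFun (P T))) := by
  have huT (T : M.Cell) : IntegrableOn u T.simplex := integrableOn_Ω_iff.1 hu T
  choose P hPd hP using fun T : M.Cell => exists_local_projection K T (huT T)
  refine ⟨P, hPd, fun T => ?_, ?_⟩
  · rw [T.vol_mul_rms_sq, ← hP T _ (hPd T)]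
    simp_rw [sq]
  let ũ : Space d → ℝ := stepFun fun T => polyFun (P T)
  have hũT (T : M.Cell) : ∀ᵐ x ∂volume.restrict T.simplex, ũ x = polyFun (P T) x :=
    stepFun_ae (fun T => polyFun (P T)) T
  have hũ2 : MemLp ũ 2 (volume.restrict M.Ω) := by
    have hm : AEStronglyMeasurable ũ (volume.restrict M.Ω) := by
      refine (Finset.measurable_fun_sum _ fun T _ => ?_).aestronglyMeasurable
      exact (continuous_polyFun (P T)).measurable.indicator isOpen_interior.measurableSet
    refine (memLp_two_iff_integrable_sq hm).2 (integrableOn_Ω_iff.2 fun T => ?_)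
    have hc : IntegrableOn (fun x => polyFun (P T) x ^ 2) T.simplex :=
      ((continuous_polyFun (P T)).pow 2).continuousOn.integrableOn_compact (isCompact_simplex T)
    refine hc.congr ?_
    filter_upwards [hũT T] with x hx
    rw [hx]
  have hv' : M.IsL2Projection K ũ v := by
    refine ⟨hv.1, fun z hz => (hv.2 z hz).trans ?_⟩
    have hzT (T : M.Cell) := hz.exists_polyFun T
    have key (f : Space d → ℝ) (T : M.Cell) (R : MvPolynomial (Fin d) ℝ)
        (hR : ∀ᵐ x ∂volume.restrict T.simplex, z x = polyFun R x) :
        (fun x => f x * polyFun R x) =ᵐ[volume.restrict T.simplex] fun x => f x * z x := by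
      filter_upwards [hR] with x hx
      rw [hx]
    rw [integral_Ω_eq_sum, integral_Ω_eq_sum]
    · refine Finset.sum_congr rfl fun T _ => ?_
      obtain ⟨R, hRd, hR⟩ := hzT T
      rw [← integral_congr_ae (key u T R hR), ← integral_congr_ae (key ũ T R hR), ← hP T R hRd]
      refine integral_congr_ae ?_
      filter_upwards [hũT T] with x hx
      rw [hx]
    · exact hũ2.integrable_mul (memLp_two_of_memLagrange hz)
    · refine integrableOn_Ω_iff.2 fun T => ?_
      obtain ⟨R, hRd, hR⟩ := hzT T
      exact (integrableOn_mul_polyFun T (huT T) R).congr (key u T R hR)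
  have hb := gradedBound_of_stable hγ hC h hũ2 hv'
  have e (T : M.Cell) : T.rms ũ = T.rms (polyFun (P T)) := T.rms_congr (hũT T)
  simpa only [e] using hb

/-- On each element, the mass of the mean value is at most that of the function. -/
lemma Cell.vol_mul_avg_rpow_le {E : Type*} [NormedAddCommGroup E] (T : M.Cell) {g : Space d → E}
    (hg : IntegrableOn g T.simplex) {p : ℝ≥0∞} (hp : 1 ≤ p) (hpt : p ≠ ⊤) :
    ENNReal.ofReal (T.vol * T.avg (fun x => ‖g x‖) ^ p.toReal) ≤
      ∫⁻ x in T.simplex, ‖g x‖ₑ ^ p.toReal := by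
  have hp1 : 1 ≤ p.toReal := by
    rw [← ENNReal.toReal_one]
    exact ENNReal.toReal_mono hpt hp
  have hp0 : 0 < p.toReal := by linarith
  have hv := T.vol_pos
  have ha : 0 ≤ T.avg (fun x => ‖g x‖) := T.avg_nonneg fun x => norm_nonneg _
  have h1 := eLpNorm_le_eLpNorm_mul_rpow_measure_univ (μ := volume.restrict T.simplex) hp
    hg.aestronglyMeasurable
  have e1 : eLpNorm g 1 (volume.restrict T.simplex) =
      ENNReal.ofReal (T.vol * T.avg fun x => ‖g x‖) := by
    rw [eLpNorm_one_eq_lintegral_enorm, T.vol_mul_avg, ofReal_integral_norm_eq_lintegral_enorm hg]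
  rw [e1, Measure.restrict_apply_univ, ← T.ofReal_vol, ENNReal.toReal_one, div_one] at h1
  have h2 := ENNReal.rpow_le_rpow h1 hp0.le
  rw [ENNReal.mul_rpow_of_nonneg _ _ hp0.le,
    eLpNorm_eq_lintegral_rpow_enorm_toReal (by positivity) hpt, ← ENNReal.rpow_mul, one_div,
    inv_mul_cancel₀ hp0.ne', ENNReal.rpow_one, ENNReal.ofReal_rpow_of_nonneg (by positivity) hp0.le,
    ENNReal.ofReal_rpow_of_pos hv, ENNReal.ofReal_rpow_of_pos (by positivity),
    ← Real.rpow_mul hv.le,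
    sub_mul, one_mul, inv_mul_cancel₀ hp0.ne', Real.mul_rpow hv.le ha] at h2
  have h3 : T.vol ^ p.toReal = T.vol * T.vol ^ (p.toReal - 1) := by
    rw [Real.rpow_sub_one hv.ne']; field_simp
  have h4 : 0 < T.vol ^ (p.toReal - 1) := Real.rpow_pos_of_pos hv _
  rw [h3, mul_right_comm, ENNReal.ofReal_mul (by positivity)] at h2
  exact (ENNReal.mul_le_mul_iff_left (ENNReal.ofReal_pos.2 h4).ne' ENNReal.ofReal_ne_top).1 h2

lemma eLpNorm_rpow_eq_sum {E : Type*} [NormedAddCommGroup E] {p : ℝ≥0∞} (hp : 1 ≤ p) (hpt : p ≠ ⊤)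
    (k : Space d → E) : eLpNorm k p (volume.restrict M.Ω) ^ p.toReal =
      ∑ T : M.Cell, ∫⁻ x in T.simplex, ‖k x‖ₑ ^ p.toReal := by
  have hp0 : p.toReal ≠ 0 := (ENNReal.toReal_pos (by positivity) hpt).ne'
  rw [eLpNorm_eq_lintegral_rpow_enorm_toReal (by positivity) hpt, ← ENNReal.rpow_mul, one_div,
    inv_mul_cancel₀ hp0, ENNReal.rpow_one, lintegral_Ω_eq_sum]

/-- The discrete `ℓᵖ`-bound on the elements yields a bound in the weighted `Lᵖ`-norms. -/
lemma eLpNorm_le_of_lpBound {E F : Type*} [NormedAddCommGroup E] [NormedSpace ℝ E]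
    [NormedAddCommGroup F] [NormedSpace ℝ F] {ρ : Space d → ℝ} {γ : ℝ} (hρ : M.IsWeight ρ γ)
    {p : ℝ≥0∞} (hp : 1 ≤ p) {c a : ℝ} (hc : 0 < c) (ha : 0 < a) {V : M.Cell → ℝ}
    {f : Space d → E} {g : Space d → F} (hg : IntegrableOn g M.Ω)
    (hV : ∀ T, 0 ≤ V T)
    (hf : ∀ T : M.Cell, ∀ᵐ x ∂volume.restrict T.simplex, ‖f x‖ ≤ a * V T)
    (h : LpBound (fun T : M.Cell => T.vol) (fun T => T.weight ρ) p c V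
      (fun T => T.avg fun x => ‖g x‖)) :
    eLpNorm (fun x => ρ x • f x) p (volume.restrict M.Ω) ≤
      ENNReal.ofReal (γ * a * c) * eLpNorm (fun x => ρ x • g x) p (volume.restrict M.Ω) := by
  have hγ : 0 < γ := by linarith [hρ.one_le]
  have hgT (T : M.Cell) : IntegrableOn g T.simplex := integrableOn_Ω_iff.1 hg T
  have hf' (T : M.Cell) : ∀ᵐ x ∂volume.restrict T.simplex,
      ‖ρ x • f x‖ ≤ γ * a * (T.weight ρ * V T) := by
    filter_upwards [hf T, hρ.le_weight T, ae_Ω_iff.1 hρ.pos T] with x h1 h2 h3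
    rw [norm_smul, Real.norm_of_nonneg h3.le]
    have := hρ.weight_pos T
    calc _ ≤ (γ * T.weight ρ) * (a * V T) := by gcongr
      _ = _ := by ring
  have hg' (T : M.Cell) : ∀ᵐ x ∂volume.restrict T.simplex, T.weight ρ * ‖g x‖ ≤ ‖ρ x • g x‖ := by
    filter_upwards [hρ.weight_le T, ae_Ω_iff.1 hρ.pos T] with x h2 h3
    rw [norm_smul, Real.norm_of_nonneg h3.le]
    gcongr
  have hr (T : M.Cell) : 0 < T.weight ρ := hρ.weight_pos T
  have hU (T : M.Cell) : 0 ≤ T.avg fun x => ‖g x‖ := T.avg_nonneg fun x => norm_nonneg _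
  rcases eq_or_ne p ⊤ with rfl | hpt
  · rw [eLpNorm_exponent_top, eLpNorm_exponent_top]
    rcases eq_or_ne (eLpNormEssSup (fun x => ρ x • g x) (volume.restrict M.Ω)) ⊤ with htop | htop
    · rw [htop, ENNReal.mul_top (ENNReal.ofReal_pos.2 (by positivity)).ne']
      exact le_top
    set A := (eLpNormEssSup (fun x => ρ x • g x) (volume.restrict M.Ω)).toReal with hA
    have h1 : ∀ T : M.Cell, T.weight ρ * T.avg (fun x => ‖g x‖) ≤ A := by
      intro T
      have h2 : ∀ᵐ x ∂volume.restrict T.simplex, T.weight ρ * ‖g x‖ ≤ A := by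
        filter_upwards [hg' T, ae_Ω_iff.1 (enorm_ae_le_eLpNormEssSup (fun x => ρ x • g x)
          (volume.restrict M.Ω)) T] with x hx1 hx2
        refine hx1.trans ?_
        have := ENNReal.toReal_mono htop hx2
        rwa [toReal_enorm] at this
      have h3 := integral_mono_ae ((hgT T).norm.const_mul _) (integrable_const A) h2
      rw [integral_const_mul, ← T.vol_mul_avg, integral_const, smul_eq_mul,
        measureReal_restrict_apply_univ] at h3
      refine le_of_mul_le_mul_left ?_ T.vol_pos
      change _ ≤ T.vol * A at h3
      linarith
    have h2 := h.2 rfl A h1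
    have hA' : eLpNormEssSup (fun x => ρ x • g x) (volume.restrict M.Ω) = ENNReal.ofReal A :=
      (ENNReal.ofReal_toReal htop).symm
    rw [hA', ← ENNReal.ofReal_mul (by positivity)]
    refine eLpNormEssSup_le_of_ae_bound (ae_Ω_iff.2 fun T => ?_)
    filter_upwards [hf' T] with x hx
    refine hx.trans ?_
    rw [mul_assoc (γ * a)]
    exact mul_le_mul_of_nonneg_left (h2 T) (by positivity)
  · have hp1 : 1 ≤ p.toReal := by
      rw [← ENNReal.toReal_one]
      exact ENNReal.toReal_mono hpt hp
    have hp0 : 0 < p.toReal := by linarith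
    rw [← ENNReal.rpow_le_rpow_iff hp0, ENNReal.mul_rpow_of_nonneg _ _ hp0.le]
    have hn (W : M.Cell → ℝ) (hW : ∀ T, 0 ≤ W T) (T : M.Cell) :
        0 ≤ T.vol * (T.weight ρ * W T) ^ p.toReal :=
      mul_nonneg T.vol_pos.le (Real.rpow_nonneg (mul_nonneg (hr T).le (hW T)) _)
    calc eLpNorm (fun x => ρ x • f x) p (volume.restrict M.Ω) ^ p.toReal
        = ∑ T : M.Cell, ∫⁻ x in T.simplex, ‖ρ x • f x‖ₑ ^ p.toReal := eLpNorm_rpow_eq_sum hp hpt _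
      _ ≤ ∑ T : M.Cell, ENNReal.ofReal
            ((γ * a) ^ p.toReal * (T.vol * (T.weight ρ * V T) ^ p.toReal)) := by
          refine Finset.sum_le_sum fun T _ => ?_
          have hn := mul_nonneg (hr T).le (hV T)
          calc _ ≤ ∫⁻ _ in T.simplex,
                ENNReal.ofReal ((γ * a * (T.weight ρ * V T)) ^ p.toReal) := by
                refine lintegral_mono_ae ?_
                filter_upwards [hf' T] with x hx
                rw [← ofReal_norm, ENNReal.ofReal_rpow_of_nonneg (norm_nonneg _) hp0.le]
                exact ENNReal.ofReal_le_ofReal (Real.rpow_le_rpow (norm_nonneg _) hx hp0.le)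
            _ = _ := by
                rw [lintegral_const, Measure.restrict_apply_univ, ← T.ofReal_vol,
                  ← ENNReal.ofReal_mul (by positivity), Real.mul_rpow (by positivity) hn]
                congr 1
                ring
      _ = ENNReal.ofReal ((γ * a) ^ p.toReal *
            ∑ T : M.Cell, T.vol * (T.weight ρ * V T) ^ p.toReal) := by
          rw [Finset.mul_sum, ENNReal.ofReal_sum_of_nonneg]
          exact fun T _ => mul_nonneg (by positivity) (hn V hV T)
      _ ≤ ENNReal.ofReal ((γ * a) ^ p.toReal * (c ^ p.toReal *
            ∑ T : M.Cell, T.vol * (T.weight ρ * T.avg fun x => ‖g x‖) ^ p.toReal)) := by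
          refine ENNReal.ofReal_le_ofReal (mul_le_mul_of_nonneg_left (h.1 hpt) (by positivity))
      _ = ENNReal.ofReal (γ * a * c) ^ p.toReal * ∑ T : M.Cell, ENNReal.ofReal
            (T.weight ρ ^ p.toReal * (T.vol * (T.avg fun x => ‖g x‖) ^ p.toReal)) := by
          have e (T : M.Cell) : T.vol * (T.weight ρ * T.avg fun x => ‖g x‖) ^ p.toReal =
              T.weight ρ ^ p.toReal * (T.vol * (T.avg fun x => ‖g x‖) ^ p.toReal) := by
            rw [Real.mul_rpow (hr T).le (hU T)]; ring
          simp_rw [e]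
          rw [← ENNReal.ofReal_sum_of_nonneg, ENNReal.ofReal_rpow_of_nonneg (by positivity) hp0.le,
            ← ENNReal.ofReal_mul (by positivity), Real.mul_rpow (by positivity) hc.le, mul_assoc]
          · intro T _
            have := hU T
            have := T.vol_pos
            have := hr T
            positivity
      _ ≤ ENNReal.ofReal (γ * a * c) ^ p.toReal *
            ∑ T : M.Cell, ∫⁻ x in T.simplex, ‖ρ x • g x‖ₑ ^ p.toReal := by
          gcongr with T
          calc _ = ENNReal.ofReal (T.weight ρ ^ p.toReal) *
                ENNReal.ofReal (T.vol * (T.avg fun x => ‖g x‖) ^ p.toReal) := by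
                rw [ENNReal.ofReal_mul (Real.rpow_nonneg (hr T).le _)]
            _ ≤ ENNReal.ofReal (T.weight ρ ^ p.toReal) *
                ∫⁻ x in T.simplex, ‖g x‖ₑ ^ p.toReal := by
                gcongr
                exact T.vol_mul_avg_rpow_le (hgT T) hp hpt
            _ = ∫⁻ x in T.simplex, ENNReal.ofReal (T.weight ρ ^ p.toReal) * ‖g x‖ₑ ^ p.toReal :=
                (lintegral_const_mul' _ _ ENNReal.ofReal_ne_top).symm
            _ ≤ _ := by
                refine lintegral_mono_ae ?_
                filter_upwards [hg' T] with x hx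
                rw [← ofReal_norm, ← ofReal_norm,
                  ENNReal.ofReal_rpow_of_nonneg (norm_nonneg _) hp0.le,
                  ENNReal.ofReal_rpow_of_nonneg (norm_nonneg _) hp0.le,
                  ← ENNReal.ofReal_mul (Real.rpow_nonneg (hr T).le _),
                  ← Real.mul_rpow (hr T).le (norm_nonneg _)]
                exact ENNReal.ofReal_le_ofReal (Real.rpow_le_rpow
                  (mul_nonneg (hr T).le (norm_nonneg _)) hx hp0.le)
      _ = _ := by rw [eLpNorm_rpow_eq_sum hp hpt]

end Triangulation

/-! ### Stability in `Lᵖ` -/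

/-- A grading below the worst grading is smaller than some admissible grading. -/
lemma exists_stable_of_lt_gammaMax {d : ℕ} {𝔉 : Set (Triangulation d)} {K : ℕ} {x : ℝ}
    (h : ENNReal.ofReal x < gammaMax 𝔉 K) :
    ∃ γ C : ℝ, 1 ≤ γ ∧ x < γ ∧ 0 ≤ C ∧ ∀ M ∈ 𝔉, ∀ ρ, M.IsWeight ρ γ →
      ∀ u, MemLp u 2 (volume.restrict M.Ω) →
        eLpNorm (fun x => ρ x * M.Q K u x) 2 (volume.restrict M.Ω) ≤
          ENNReal.ofReal C * eLpNorm (fun x => ρ x * u x) 2 (volume.restrict M.Ω) := by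
  obtain ⟨_, ⟨γ, hγ, ⟨C, hC⟩, rfl⟩, hlt⟩ := lt_sSup_iff.1 h
  refine ⟨γ, C, hγ, (ENNReal.ofReal_lt_ofReal_iff (by linarith)).1 hlt, C.2, ?_⟩
  rw [ENNReal.ofReal_coe_nnreal]
  exact hC

namespace Triangulation

variable {d : ℕ} {M : Triangulation d}

/-- A mean square bounded by a linear functional that is bounded on polynomials. -/
lemma Cell.rms_le_of_vol_mul_sq_le (T : M.Cell) {f : Space d → ℝ} {a : ℝ} (ha : 0 ≤ a)
    (h : T.vol * T.rms f ^ 2 ≤ T.vol * (a * T.rms f)) : T.rms f ≤ a := by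
  have h1 := le_of_mul_le_mul_left h T.vol_pos
  rcases (T.rms_nonneg f).eq_or_lt with h0 | h0
  · rwa [← h0]
  · rw [sq] at h1
    exact le_of_mul_le_mul_right h1 h0

end Triangulation

open Triangulation in
theorem exists_Lp_stability {d : ℕ} (hd : 1 ≤ d) (K : ℕ) (𝔉 : Set (Triangulation d))
    {p : ℝ≥0∞} (hp : 1 ≤ p) {γρ γh : ℝ} (χ₀ κ : ℝ) (hγρ : 1 ≤ γρ) (hγh : 1 ≤ γh)
    (hlt : ENNReal.ofReal (γρ * γh ^ ((d : ℝ) * |1 / 2 - (p⁻¹).toReal|)) < gammaMax 𝔉 K) :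
    ∃ c : ℝ≥0, ∀ M ∈ 𝔉, M.ShapeRegular χ₀ → ∀ ρ h : Space d → ℝ,
      M.IsWeight ρ γρ → M.IsMeshSize h γh κ →
      ∀ u : Space d → ℝ, MemLp u p (volume.restrict M.Ω) →
        eLpNorm (fun x => ρ x * M.Q K u x) p (volume.restrict M.Ω) ≤
          c * eLpNorm (fun x => ρ x * u x) p (volume.restrict M.Ω) := by
  obtain ⟨γ, C, hγ, hγlt, hC, hstab⟩ := exists_stable_of_lt_gammaMax hlt
  obtain ⟨ci, hci, hinv⟩ := exists_inverse_estimate d K χ₀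
  rw [Real.rpow_mul (by linarith), Real.rpow_natCast] at hγlt
  obtain ⟨c, hc, hdisc⟩ := exists_discrete_bound d (B := (|κ| ^ 2 * |χ₀|) ^ d) (C := C * ci)
    (by positivity) (by positivity) (one_le_pow₀ hγh : 1 ≤ γh ^ d) hγρ hp hγlt
  refine ⟨(γρ * (ci + 1) * (c + 1)).toNNReal, fun M hM hχ ρ h hρ hh u hu => ?_⟩
  have hmesh := hh.meshBounds hd hχ
  have hui := integrableOn_of_memLp hp hu
  have hQ := isL2Projection_Q K hui
  obtain ⟨P, hPd, hP, hgb⟩ := exists_gradedBound hγ hC (hstab M hM) hui hQ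
  have hgr := hmesh.growthBound
  rw [← abs_of_pos hmesh.κ_pos, ← abs_of_pos hmesh.χ_pos] at hgr
  have hPu (T : M.Cell) : T.rms (polyFun (P T)) ≤ ci * T.avg fun x => ‖u x‖ := by
    obtain ⟨x₀, r, hr, hball, hdiam⟩ := hχ T
    obtain ⟨h1, -, -⟩ := hinv M T x₀ r hr hball hdiam (P T) (hPd T)
    refine T.rms_le_of_vol_mul_sq_le (mul_nonneg hci (T.avg_nonneg fun x => norm_nonneg _)) ?_
    have huT : IntegrableOn u T.simplex := integrableOn_Ω_iff.1 hui T
    calc T.vol * T.rms (polyFun (P T)) ^ 2 = ∫ x in T.simplex, u x * polyFun (P T) x := hP T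
      _ ≤ ∫ x in T.simplex, ‖u x‖ * (ci * T.rms (polyFun (P T))) := by
          refine setIntegral_mono_on (integrableOn_mul_polyFun T huT _) (huT.norm.mul_const _)
            (isCompact_simplex T).measurableSet fun x hx => ?_
          refine (le_abs_self _).trans ?_
          rw [abs_mul]
          exact mul_le_mul_of_nonneg_left (h1 x hx) (abs_nonneg _)
      _ = _ := by
          rw [integral_mul_const, ← T.vol_mul_avg]; ring
  have hgb' := hgb.mono (fun T => T.vol_pos) (fun T => T.rms_nonneg _) hPu
  have hlp := hdisc M.Cell M.neighborGraph _ (fun T => T.weight ρ) _ _ M.connected_neighborGraph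
    (fun T => T.vol_pos) hgr (fun T => hρ.weight_pos T) (fun T T' h => hρ.weight_graded h)
    (fun T => T.rms_nonneg _) (fun T => T.avg_nonneg fun x => norm_nonneg _) hgb'
  have hlp' := hlp.mono_const (c' := c + 1) (fun T => T.vol_pos.le) hc (by linarith)
    (fun T => mul_nonneg (hρ.weight_pos T).le (T.avg_nonneg fun x => norm_nonneg _))
  have key := eLpNorm_le_of_lpBound (a := ci + 1) hρ hp (by linarith) (by linarith) hui
    (f := M.Q K u) (fun T => T.rms_nonneg _) (fun T => ?_) hlp'
  · exact key
  · obtain ⟨R, hRd, hR⟩ := hQ.1.exists_polyFun T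
    obtain ⟨x₀, r, hr, hball, hdiam⟩ := hχ T
    obtain ⟨h1, -, -⟩ := hinv M T x₀ r hr hball hdiam R hRd
    filter_upwards [hR, ae_restrict_mem (isCompact_simplex T).measurableSet] with x hx hxT
    rw [hx, T.rms_congr hR]
    refine (h1 x hxT).trans (mul_le_mul_of_nonneg_right (by linarith) (T.rms_nonneg _))

/-! ### Lipschitz test functions -/

section Mollification

variable {d : ℕ}

/-- The convolution with a normed bump function. -/
noncomputable def mollify (b : ContDiffBump (0 : Space d)) (ψ : Space d → ℝ) : Space d → ℝ :=
  convolution (b.normed volume) ψ (ContinuousLinearMap.lsmul ℝ ℝ) volume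

variable (b : ContDiffBump (0 : Space d))

lemma mollify_eq (ψ : Space d → ℝ) (x : Space d) :
    mollify b ψ x = ∫ t, b.normed volume t * ψ (x - t) := rfl

lemma mollify_eq_swap (ψ : Space d → ℝ) (x : Space d) :
    mollify b ψ x = ∫ y, b.normed volume (x - y) * ψ y := convolution_eq_swap _

lemma abs_mollify_le {ψ : Space d → ℝ} {C : ℝ} (hψ : ∀ x, |ψ x| ≤ C) (x : Space d) :
    |mollify b ψ x| ≤ C := by
  rw [mollify_eq]
  have h : ∫ t, b.normed volume t * C = C := by
    rw [integral_mul_const, b.integral_normed, one_mul]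
  rw [← h, ← Real.norm_eq_abs]
  refine norm_integral_le_of_norm_le (b.integrable_normed.mul_const C) (.of_forall fun t => ?_)
  rw [norm_mul, Real.norm_of_nonneg (b.nonneg_normed t)]
  exact mul_le_mul_of_nonneg_left (hψ _) (b.nonneg_normed t)

lemma contDiff_mollify {ψ : Space d → ℝ} (hψ : Continuous ψ) : ContDiff ℝ ∞ (mollify b ψ) :=
  b.hasCompactSupport_normed.contDiff_convolution_left _ b.contDiff_normed
    hψ.locallyIntegrable

lemma fderiv_mollify {φ : Space d → ℝ} {C : ℝ≥0} (hφ : LipschitzWith C φ) (x e : Space d) :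
    fderiv ℝ (mollify b φ) x e = mollify b (fun y => lineDeriv ℝ φ y e) x := by
  have hc := hφ.continuous
  have hd := (contDiff_mollify b hc).differentiable (by simp) x
  have h1 : Filter.Tendsto (fun t : ℝ => t⁻¹ • (mollify b φ (x + t • e) - mollify b φ x))
      (nhdsWithin 0 (Set.Ioi 0)) (nhds (fderiv ℝ (mollify b φ) x e)) :=
    (hasLineDerivAt_iff_tendsto_slope_zero.1 (hd.hasFDerivAt.hasLineDerivAt e)).mono_left
      (nhdsWithin_mono _ fun t ht => ne_of_gt ht)
  have hg : Continuous fun y => b.normed volume (x - y) :=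
    b.continuous_normed.comp (continuous_const.sub continuous_id)
  have hgi : Integrable fun y => b.normed volume (x - y) := b.integrable_normed.comp_sub_left x
  have hsup (z : Space d) : HasCompactSupport fun y => b.normed volume (z - y) :=
    b.hasCompactSupport_normed.comp_homeomorph (Homeomorph.subLeft z)
  have hi (z : Space d) : Integrable fun y => b.normed volume (z - y) * φ y :=
    ((b.continuous_normed.comp (continuous_const.sub continuous_id)).mul
      hc).integrable_of_hasCompactSupport ((hsup z).mul_right)
  have h2 := hφ.integral_inv_smul_sub_mul_tendsto_integral_lineDeriv_mul hgi e
  have h3 (t : ℝ) : ∫ y, t⁻¹ • (φ (y + t • e) - φ y) * b.normed volume (x - y) =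
      t⁻¹ • (mollify b φ (x + t • e) - mollify b φ x) := by
    have e1 : mollify b φ (x + t • e) = ∫ y, b.normed volume (x - y) * φ (y + t • e) := by
      rw [mollify_eq_swap, ← integral_add_right_eq_self _ (t • e)]
      refine integral_congr_ae (.of_forall fun y => ?_)
      simp only [add_sub_add_right_eq_sub]
    have hi' : Integrable fun y => b.normed volume (x - y) * φ (y + t • e) := by
      refine ((hi (x + t • e)).comp_add_right (t • e)).congr (.of_forall fun y => ?_)
      simp only [add_sub_add_right_eq_sub]
    rw [e1, mollify_eq_swap, ← integral_sub hi' (hi x), smul_eq_mul, ← integral_const_mul]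
    refine integral_congr_ae (.of_forall fun y => ?_)
    simp only [smul_eq_mul]; ring
  simp_rw [h3] at h2
  rw [tendsto_nhds_unique h1 h2, mollify_eq_swap]
  refine integral_congr_ae (.of_forall fun y => ?_)
  simp only [mul_comm]

/-- A sequence of bump functions with supports shrinking to the origin. -/
noncomputable def bumpSeq (d n : ℕ) : ContDiffBump (0 : Space d) where
  rIn := 1 / (n + 1)
  rOut := 2 / (n + 1)
  rIn_pos := by positivity
  rIn_lt_rOut := by gcongr; norm_num

lemma tendsto_bumpSeq : Filter.Tendsto (fun n => (bumpSeq d n).rOut) Filter.atTop (nhds 0) := by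
  have := (tendsto_one_div_add_atTop_nhds_zero_nat (𝕜 := ℝ)).const_mul 2
  rw [mul_zero] at this
  refine this.congr fun n => ?_
  simp only [bumpSeq]
  ring

end Mollification

variable {d : ℕ} {Ω : Set (Space d)} {u : Space d → ℝ} {g : Space d → Space d}

lemma integrable_mul_of_bound {μ : Measure (Space d)} {f φ : Space d → ℝ} (hf : Integrable f μ)
    (hφ : AEStronglyMeasurable φ μ) {C : ℝ} (hC : ∀ x, |φ x| ≤ C) :
    Integrable (fun x => f x * φ x) μ := by
  refine (hf.bdd_mul hφ (.of_forall hC)).congr (.of_forall fun x => ?_)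
  simp only [mul_comm]

lemma integrable_inner_const {μ : Measure (Space d)} (hg : Integrable g μ) (e : Space d) :
    Integrable (fun x => (inner ℝ (g x) e : ℝ)) μ := hg.inner_const e

lemma tendsto_integral_mul_of_bound {μ : Measure (Space d)} {f : Space d → ℝ} (hf : Integrable f μ)
    {φ : ℕ → Space d → ℝ} {ψ : Space d → ℝ} (hφ : ∀ n, AEStronglyMeasurable (φ n) μ) {C : ℝ}
    (hC : ∀ n, ∀ᵐ x ∂μ, |φ n x| ≤ C)
    (h : ∀ᵐ x ∂μ, Filter.Tendsto (fun n => φ n x) Filter.atTop (nhds (ψ x))) :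
    Filter.Tendsto (fun n => ∫ x, f x * φ n x ∂μ) Filter.atTop (nhds (∫ x, f x * ψ x ∂μ)) := by
  refine tendsto_integral_of_dominated_convergence (fun x => ‖f x‖ * C)
    (fun n => hf.aestronglyMeasurable.mul (hφ n)) (hf.norm.mul_const C)
    (fun n => ?_) ?_
  · filter_upwards [hC n] with x hx
    rw [norm_mul]
    exact mul_le_mul_of_nonneg_left hx (norm_nonneg _)
  · filter_upwards [h] with x hx
    exact hx.const_mul _

namespace HasWeakGradient

/-- The definition of the weak gradient extends to Lipschitz test functions with compact support. -/
lemma integral_lineDeriv_of_hasCompactSupport (hug : HasWeakGradient Ω u g) (hΩ : IsOpen Ω)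
    (hu : IntegrableOn u Ω) (hg : IntegrableOn g Ω) {φ : Space d → ℝ} {C : ℝ≥0}
    (hφ : LipschitzWith C φ) (hc : HasCompactSupport φ) (hs : tsupport φ ⊆ Ω) (e : Space d) :
    ∫ x in Ω, u x * lineDeriv ℝ φ x e = - ∫ x in Ω, inner ℝ (g x) e * φ x := by
  obtain ⟨δ, hδ, hδΩ⟩ := IsCompact.exists_cthickening_subset_open hc hΩ hs
  obtain ⟨A, hA⟩ := hφ.continuous.bounded_above_of_compact_support hc
  have hlim := tendsto_bumpSeq (d := d)
  have hD : ∀ y, |lineDeriv ℝ φ y e| ≤ C * ‖e‖ := fun y => norm_lineDeriv_le_of_lipschitz ℝ hφ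
  have hDm : Measurable fun y => lineDeriv ℝ φ y e := measurable_lineDeriv hφ.continuous
  have hDl : LocallyIntegrable fun y => lineDeriv ℝ φ y e := by
    have h1 : LocallyIntegrable (fun _ : Space d => C * ‖e‖) := locallyIntegrable_const _
    exact h1.mono hDm.aestronglyMeasurable (.of_forall fun y => (hD y).trans (le_abs_self _))
  have hsm (n : ℕ) := contDiff_mollify (bumpSeq d n) hφ.continuous
  have h1 : Filter.Tendsto
      (fun n => ∫ x in Ω, u x * fderiv ℝ (mollify (bumpSeq d n) φ) x e) Filter.atTop
      (nhds (∫ x in Ω, u x * lineDeriv ℝ φ x e)) := by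
    refine tendsto_integral_mul_of_bound hu (C := C * ‖e‖) (fun n => ?_)
      (fun n => .of_forall fun x => ?_) ?_
    · exact (((hsm n).continuous_fderiv (by simp)).clm_apply
        continuous_const).aestronglyMeasurable
    · rw [fderiv_mollify _ hφ]
      exact abs_mollify_le _ hD x
    · refine ae_restrict_of_ae ?_
      filter_upwards [ContDiffBump.ae_convolution_tendsto_right_of_locallyIntegrable hlim (K := 2)
        (.of_forall fun n => by simp only [bumpSeq]; exact le_of_eq (by ring)) hDl] with x hx
      refine hx.congr fun n => ?_
      rw [fderiv_mollify _ hφ]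
      rfl
  have h2 : Filter.Tendsto
      (fun n => ∫ x in Ω, inner ℝ (g x) e * mollify (bumpSeq d n) φ x) Filter.atTop
      (nhds (∫ x in Ω, inner ℝ (g x) e * φ x)) := by
    refine tendsto_integral_mul_of_bound (integrable_inner_const hg e) (C := A)
      (fun n => (hsm n).continuous.aestronglyMeasurable)
      (fun n => .of_forall (abs_mollify_le _ hA)) ?_
    exact .of_forall fun x => ContDiffBump.convolution_tendsto_right_of_continuous hlim
      hφ.continuous x
  refine tendsto_nhds_unique h1 (h2.neg.congr' ?_)
  filter_upwards [hlim.eventually_lt_const hδ] with n hn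
  refine (hug _ (hsm n) ?_ ?_ e).symm
  · exact (bumpSeq d n).hasCompactSupport_normed.convolution _ hc
  · refine le_trans (closure_minimal ?_ Metric.isClosed_cthickening) hδΩ
    refine (support_convolution_subset _).trans ?_
    rintro _ ⟨t, ht, y, hy, rfl⟩
    rw [(bumpSeq d n).support_normed_eq, mem_ball_zero_iff] at ht
    refine Metric.mem_cthickening_of_dist_le _ y _ _ (subset_tsupport φ hy) ?_
    simp only [dist_eq_norm, add_sub_cancel_right]
    exact ht.le.trans hn.le

/-- The definition of the weak gradient extends to nonnegative Lipschitz functions that vanish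
outside the domain. -/
lemma integral_lineDeriv (hug : HasWeakGradient Ω u g) (hΩ : IsOpen Ω)
    (hb : Bornology.IsBounded Ω) (hu : IntegrableOn u Ω) (hg : IntegrableOn g Ω)
    {φ : Space d → ℝ} {C : ℝ≥0} (hφ : LipschitzWith C φ) (h0 : ∀ x, 0 ≤ φ x)
    (hz : ∀ x, x ∉ Ω → φ x = 0) (e : Space d) :
    ∫ x in Ω, u x * lineDeriv ℝ φ x e = - ∫ x in Ω, inner ℝ (g x) e * φ x := by
  -- the truncations `(φ - ε)₊` have compact support in the domain
  let ε (n : ℕ) : ℝ := 1 / ((n : ℝ) + 1)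
  have hε (n : ℕ) : 0 < ε n := by positivity
  have hε0 : Filter.Tendsto ε Filter.atTop (nhds 0) := tendsto_one_div_add_atTop_nhds_zero_nat
  let ψ (n : ℕ) (x : Space d) : ℝ := max (φ x - ε n) 0
  have hψ (n : ℕ) : LipschitzWith C (ψ n) := by
    have : LipschitzWith C fun x => φ x - ε n :=
      LipschitzWith.of_dist_le_mul fun x y => by
        rw [dist_sub_right]; exact hφ.dist_le_mul x y
    exact this.max_const 0
  have hψs (n : ℕ) : tsupport (ψ n) ⊆ {x | ε n ≤ φ x} := by
    refine closure_minimal (fun x hx => ?_) (isClosed_le continuous_const hφ.continuous)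
    by_contra hlt
    refine hx (max_eq_right ?_)
    have : φ x < ε n := not_le.1 hlt
    linarith
  have hsub (n : ℕ) : {x | ε n ≤ φ x} ⊆ Ω := fun x hx => by
    by_contra h
    have : ε n ≤ φ x := hx
    rw [hz x h] at this
    linarith [hε n]
  have hcpt (n : ℕ) : HasCompactSupport (ψ n) :=
    Metric.isCompact_of_isClosed_isBounded (isClosed_tsupport _)
      (hb.subset ((hψs n).trans (hsub n)))
  have key (n : ℕ) := hug.integral_lineDeriv_of_hasCompactSupport hΩ hu hg (hψ n) (hcpt n)
    ((hψs n).trans (hsub n)) e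
  obtain ⟨A, hA⟩ : ∃ A, ∀ x, |φ x| ≤ A := by
    obtain ⟨A, hA⟩ := hb.isCompact_closure.exists_bound_of_continuousOn hφ.continuous.continuousOn
    refine ⟨|A|, fun x => ?_⟩
    by_cases hx : x ∈ Ω
    · exact (hA x (subset_closure hx)).trans (le_abs_self A)
    · rw [hz x hx, abs_zero]; exact abs_nonneg A
  have h1 : Filter.Tendsto (fun n => ∫ x in Ω, u x * lineDeriv ℝ (ψ n) x e) Filter.atTop
      (nhds (∫ x in Ω, u x * lineDeriv ℝ φ x e)) := by
    refine tendsto_integral_mul_of_bound hu (C := C * ‖e‖)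
      (fun n => aestronglyMeasurable_lineDeriv (hψ n).continuous _)
      (fun n => .of_forall fun x => norm_lineDeriv_le_of_lipschitz ℝ (hψ n))
      (.of_forall fun x => ?_)
    rcases (h0 x).eq_or_lt with hx | hx
    · -- at a zero of `φ` both derivatives vanish
      have e1 : lineDeriv ℝ φ x e = 0 := by
        refine IsLocalMin.deriv_eq_zero (.of_forall fun t => ?_)
        simp only [zero_smul, add_zero, ← hx]
        exact h0 _
      have e2 (n : ℕ) : lineDeriv ℝ (ψ n) x e = 0 := by
        have : ψ n =ᶠ[nhds x] fun _ => 0 := by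
          have := hφ.continuous.continuousAt.eventually_lt_const (hx ▸ hε n : φ x < ε n)
          filter_upwards [this] with y hy
          exact max_eq_right (by linarith)
        rw [this.lineDeriv_eq]
        simp [lineDeriv]
      simp only [e1, e2]
      exact tendsto_const_nhds
    · refine tendsto_const_nhds.congr' ?_
      filter_upwards [hε0.eventually_lt_const hx] with n hn
      have : ψ n =ᶠ[nhds x] fun y => φ y - ε n := by
        have := hφ.continuous.continuousAt.eventually_const_lt hn
        filter_upwards [this] with y hy
        exact max_eq_left (by linarith)
      rw [this.lineDeriv_eq]
      simp [lineDeriv]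
  have h2 : Filter.Tendsto (fun n => ∫ x in Ω, inner ℝ (g x) e * ψ n x) Filter.atTop
      (nhds (∫ x in Ω, inner ℝ (g x) e * φ x)) := by
    refine tendsto_integral_mul_of_bound (integrable_inner_const hg e) (C := A)
      (fun n => (hψ n).continuous.aestronglyMeasurable) (fun n => .of_forall fun x => ?_)
      (.of_forall fun x => ?_)
    · rw [abs_of_nonneg (le_max_right _ _)]
      refine max_le ?_ ((abs_nonneg _).trans (hA x))
      linarith [le_abs_self (φ x), hA x, hε n]
    · have : Filter.Tendsto (fun n => max (φ x - ε n) 0) Filter.atTop (nhds (max (φ x - 0) 0)) :=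
        (tendsto_const_nhds.sub hε0).max tendsto_const_nhds
      rwa [sub_zero, max_eq_left (h0 x)] at this
  exact tendsto_nhds_unique h1 (h2.neg.congr fun n => (key n).symm)

end HasWeakGradient

/-- A function on a segment that is Lipschitz at every point, with a uniform constant, is
Lipschitz. -/
lemma abs_sub_le_of_eventually {f : ℝ → ℝ} {L : ℝ}
    (h : ∀ t ∈ Set.Icc (0 : ℝ) 1, ∀ᶠ s in nhdsWithin t (Set.Icc 0 1), |f s - f t| ≤ L * |s - t|) :
    |f 1 - f 0| ≤ L := by
  have hc : ContinuousOn f (Set.Icc 0 1) := by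
    intro t ht
    rw [ContinuousWithinAt, tendsto_iff_dist_tendsto_zero]
    have h1 : Filter.Tendsto (fun s => L * |s - t|) (nhdsWithin t (Set.Icc 0 1)) (nhds 0) := by
      have : Continuous fun s => L * |s - t| := by fun_prop
      have := (this.tendsto t).mono_left (nhdsWithin_le_nhds (s := Set.Icc (0 : ℝ) 1))
      simpa using this
    refine tendsto_of_tendsto_of_tendsto_of_le_of_le' tendsto_const_nhds h1
      (.of_forall fun s => dist_nonneg) ?_
    filter_upwards [h t ht] with s hs
    exact hs
  have key (σ : ℝ) (hσ : |σ| = 1) : σ * (f 1 - f 0) ≤ L := by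
    have := image_le_of_liminf_slope_right_le_deriv_boundary (f := fun t => σ * (f t - f 0))
      (a := 0) (b := 1) (B := fun t => L * t) (B' := fun _ => L)
      (continuousOn_const.mul (hc.sub continuousOn_const)) (by simp)
      (by fun_prop) (fun x _ => by simpa using ((hasDerivAt_id x).const_mul L).hasDerivWithinAt)
      (fun t ht r hr => ?_) (Set.right_mem_Icc.2 zero_le_one)
    · simpa using this
    · have h1 : nhdsWithin t (Set.Ioo t 1) = nhdsWithin t (Set.Ioi t) :=
        nhdsWithin_Ioo_eq_nhdsGT ht.2
      refine Filter.Eventually.frequently ?_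
      rw [← h1]
      filter_upwards [(h t ⟨ht.1, ht.2.le⟩).filter_mono
        (nhdsWithin_mono _ fun s (hs : s ∈ Set.Ioo t 1) =>
        (⟨ht.1.trans hs.1.le, hs.2.le⟩ : s ∈ Set.Icc (0 : ℝ) 1)), self_mem_nhdsWithin] with s hs hs'
      refine lt_of_le_of_lt ?_ hr
      have hst : 0 < s - t := sub_pos.2 hs'.1
      rw [slope_def_field, div_le_iff₀ hst]
      rw [abs_of_pos hst] at hs
      have := (le_abs_self (σ * (f s - f t)))
      rw [abs_mul, hσ, one_mul] at this
      linarith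
  rw [abs_le]
  have h1 := key 1 (by simp)
  have h2 := key (-1) (by simp)
  constructor <;> linarith

lemma lipschitzWith_of_eventually {f : Space d → ℝ} {L : ℝ≥0}
    (h : ∀ x, ∀ᶠ y in nhds x, |f y - f x| ≤ L * ‖y - x‖) : LipschitzWith L f := by
  refine LipschitzWith.of_dist_le_mul fun x y => ?_
  have := abs_sub_le_of_eventually (f := fun t : ℝ => f (y + t • (x - y))) (L := L * dist x y)
    fun t _ => ?_
  · simpa [Real.dist_eq] using this
  · have hc : Continuous fun s : ℝ => y + s • (x - y) := by fun_prop
    filter_upwards [(hc.tendsto t).mono_left nhdsWithin_le_nhds (h (y + t • (x - y)))] with s hs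
    refine le_trans hs (le_of_eq ?_)
    rw [add_sub_add_left_eq_sub, ← sub_smul, norm_smul, Real.norm_eq_abs, dist_eq_norm]
    ring

namespace Triangulation

variable {M : Triangulation d}

/-- Near a point there are only elements that contain the point. -/
lemma eventually_mem_simplex (x : Space d) :
    ∀ᶠ y in nhds x, ∀ T : M.Cell, y ∈ T.simplex → x ∈ T.simplex := by
  rw [Filter.eventually_all]
  intro T
  by_cases hx : x ∈ T.simplex
  · exact .of_forall fun _ _ => hx
  · filter_upwards [(isCompact_simplex T).isClosed.isOpen_compl.mem_nhds hx] with y hy hy'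
    exact (hy hy').elim

lemma exists_lipschitzOn {f : M.Cell → Space d → ℝ} (hf : ∀ T, ContDiff ℝ 1 (f T)) :
    ∃ L : ℝ≥0, ∀ T : M.Cell, ∀ x ∈ T.simplex, ∀ y ∈ T.simplex,
      |f T y - f T x| ≤ L * ‖y - x‖ := by
  have h1 (T : M.Cell) : ∃ L : ℝ≥0, ∀ x ∈ T.simplex, ∀ y ∈ T.simplex,
      |f T y - f T x| ≤ L * ‖y - x‖ := by
    obtain ⟨A, hA⟩ := (isCompact_simplex T).exists_bound_of_continuousOn
      ((hf T).continuous_fderiv one_ne_zero).continuousOn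
    refine ⟨A.toNNReal, fun x hx y hy => ?_⟩
    have h2 := T.convex_simplex.norm_image_sub_le_of_norm_fderiv_le
      (fun z _ => (hf T).differentiable one_ne_zero z) hA hx hy
    exact h2.trans (mul_le_mul_of_nonneg_right (Real.le_coe_toNNReal A) (norm_nonneg _))
  choose L hL using h1
  refine ⟨∑ T, L T, fun T x hx y hy => (hL T x hx y hy).trans ?_⟩
  refine mul_le_mul_of_nonneg_right ?_ (norm_nonneg _)
  exact_mod_cast Finset.single_le_sum (f := L) (fun _ _ => zero_le) (Finset.mem_univ T)

/-- The weak gradient may be tested with functions that are given on the elements by nonnegative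
smooth functions which agree where elements meet and vanish on the boundary of the domain. -/
theorem sum_integral_eq_zero {u : Space d → ℝ} {g : Space d → Space d}
    (hug : HasWeakGradient M.Ω u g) (hu : IntegrableOn u M.Ω) (hg : IntegrableOn g M.Ω)
    {f : M.Cell → Space d → ℝ} (hf : ∀ T, ContDiff ℝ 1 (f T))
    (h0 : ∀ T : M.Cell, ∀ x ∈ T.simplex, 0 ≤ f T x)
    (hfT : ∀ T T' : M.Cell, ∀ x, x ∈ T.simplex → x ∈ T'.simplex → f T x = f T' x)
    (hz : ∀ T : M.Cell, ∀ x ∈ T.simplex, x ∈ frontier M.Ω → f T x = 0) (e : Space d) :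
    ∑ T : M.Cell, ((∫ x in T.simplex, u x * fderiv ℝ (f T) x e) +
      ∫ x in T.simplex, inner ℝ (g x) e * f T x) = 0 := by
  classical
  obtain ⟨L, hL⟩ := exists_lipschitzOn hf
  let φ (x : Space d) : ℝ := if h : ∃ T : M.Cell, x ∈ T.simplex then f h.choose x else 0
  have hφ (T : M.Cell) (x : Space d) (hx : x ∈ T.simplex) : φ x = f T x := by
    have h : ∃ T : M.Cell, x ∈ T.simplex := ⟨T, hx⟩
    simp only [φ, dif_pos h]
    exact hfT _ _ x h.choose_spec hx
  have hφn (x : Space d) (hx : x ∉ closure M.Ω) : φ x = 0 := by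
    rw [closure_eq_iUnion, Set.mem_iUnion] at hx
    simp only [φ, dif_neg hx]
  have hex {x : Space d} (hx : x ∈ closure M.Ω) : ∃ T : M.Cell, x ∈ T.simplex := by
    rwa [closure_eq_iUnion, Set.mem_iUnion] at hx
  have hφ0 (x : Space d) : 0 ≤ φ x := by
    by_cases hx : x ∈ closure M.Ω
    · obtain ⟨T, hT⟩ := hex hx
      rw [hφ T x hT]; exact h0 T x hT
    · rw [hφn x hx]
  have hφz (x : Space d) (hx : x ∉ M.Ω) : φ x = 0 := by
    by_cases hx' : x ∈ closure M.Ω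
    · obtain ⟨T, hT⟩ := hex hx'
      rw [hφ T x hT]
      refine hz T x hT ⟨hx', ?_⟩
      rwa [M.isOpen.interior_eq]
    · exact hφn x hx'
  have hlip : LipschitzWith L φ := by
    refine lipschitzWith_of_eventually fun x => ?_
    have hcell : ∀ᶠ y in nhds x, y ∈ closure M.Ω → |φ y - φ x| ≤ L * ‖y - x‖ := by
      filter_upwards [eventually_mem_simplex (M := M) x] with y hy hyc
      obtain ⟨T, hT⟩ := hex hyc
      rw [hφ T y hT, hφ T x (hy T hT)]
      exact hL T x (hy T hT) y hT
    by_cases hx : x ∈ M.Ω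
    · filter_upwards [hcell, M.isOpen.mem_nhds hx] with y hy hyΩ
      exact hy (subset_closure hyΩ)
    · filter_upwards [hcell] with y hy
      by_cases hyc : y ∈ closure M.Ω
      · exact hy hyc
      · rw [hφn y hyc, hφz x hx]
        simpa using by positivity
  have key := hug.integral_lineDeriv M.isOpen M.isBounded hu hg hlip hφ0 hφz e
  obtain ⟨A, hA⟩ : ∃ A, ∀ x, |φ x| ≤ A := by
    obtain ⟨A, hA⟩ := M.isBounded.isCompact_closure.exists_bound_of_continuousOn
      hlip.continuous.continuousOn
    refine ⟨|A|, fun x => ?_⟩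
    by_cases hx : x ∈ closure M.Ω
    · exact (hA x hx).trans (le_abs_self A)
    · rw [hφn x hx, abs_zero]; exact abs_nonneg A
  rw [integral_Ω_eq_sum, integral_Ω_eq_sum] at key
  · have e1 (T : M.Cell) : ∫ x in T.simplex, u x * lineDeriv ℝ φ x e =
        ∫ x in T.simplex, u x * fderiv ℝ (f T) x e := by
      refine integral_congr_ae ?_
      filter_upwards [T.ae_interior] with x hx
      have : φ =ᶠ[nhds x] f T := by
        filter_upwards [isOpen_interior.mem_nhds hx] with y hy
        exact hφ T y (interior_subset hy)
      rw [this.lineDeriv_eq,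
        ((hf T).differentiable one_ne_zero x).lineDeriv_eq_fderiv]
    have e2 (T : M.Cell) : ∫ x in T.simplex, inner ℝ (g x) e * φ x =
        ∫ x in T.simplex, inner ℝ (g x) e * f T x := by
      refine setIntegral_congr_fun (isCompact_simplex T).measurableSet fun x hx => ?_
      simp only [hφ T x hx]
    simp only [e1, e2] at key
    rw [Finset.sum_add_distrib, key]
    ring
  · exact integrable_mul_of_bound (integrable_inner_const hg e)
      hlip.continuous.aestronglyMeasurable hA
  · exact integrable_mul_of_bound hu (aestronglyMeasurable_lineDeriv hlip.continuous _)
      (C := L * ‖e‖) fun x => norm_lineDeriv_le_of_lipschitz ℝ hlip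

end Triangulation

/-! ### Moments of Sobolev functions on an element -/

variable {d : ℕ}

lemma hasWeakGradient_const (Ω : Set (Space d)) (c : ℝ) :
    HasWeakGradient Ω (fun _ => c) (fun _ => 0) := by
  intro φ h1 h2 h3 e
  have hc : Continuous fun x => fderiv ℝ φ x e :=
    (h1.continuous_fderiv (by simp)).clm_apply continuous_const
  have hi : Integrable fun x => c * fderiv ℝ φ x e :=
    (hc.integrable_of_hasCompactSupport (h2.fderiv_apply ℝ e)).const_mul c
  have h := integral_mul_fderiv_eq_neg_fderiv_mul_of_integrable (μ := volume) (v := e)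
    (f := fun _ : Space d => c) (g := φ) (by simp) hi
    ((h1.continuous.integrable_of_hasCompactSupport h2).const_mul c)
    (fun _ _ => differentiableAt_const c) (fun x _ => h1.differentiable (by simp) x)
  simp only [fderiv_fun_const, Pi.zero_apply, _root_.zero_apply, zero_mul,
    integral_zero, neg_zero] at h
  simp only [inner_zero_left, zero_mul, integral_zero, neg_zero]
  rw [setIntegral_eq_integral_of_forall_compl_eq_zero, h]
  intro x hx
  have : fderiv ℝ φ x = 0 :=
    image_eq_zero_of_notMem_tsupport fun h => hx (h3 (tsupport_fderiv_subset ℝ h))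
  simp [this]

lemma HasWeakGradient.sub_const {Ω : Set (Space d)} {u : Space d → ℝ} {g : Space d → Space d}
    (hug : HasWeakGradient Ω u g) (hu : IntegrableOn u Ω) (hΩ : IntegrableOn (fun _ => (1 : ℝ)) Ω)
    (c : ℝ) : HasWeakGradient Ω (fun x => u x - c) g := by
  intro φ h1 h2 h3 e
  have hc : Continuous fun x => fderiv ℝ φ x e :=
    (h1.continuous_fderiv (by simp)).clm_apply continuous_const
  obtain ⟨A, hA⟩ := hc.bounded_above_of_compact_support (h2.fderiv_apply ℝ e)
  have h := hasWeakGradient_const Ω c φ h1 h2 h3 e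
  simp only [inner_zero_left, zero_mul, integral_zero, neg_zero] at h
  simp only [sub_mul]
  rw [integral_sub (integrable_mul_of_bound hu hc.aestronglyMeasurable hA)
    (integrable_mul_of_bound ?_ hc.aestronglyMeasurable hA), h, sub_zero, hug φ h1 h2 h3 e]
  simpa using hΩ.const_mul c

namespace Triangulation

variable {M : Triangulation d} {u : Space d → ℝ} {g : Space d → Space d}

lemma integrableOn_const_Ω (M : Triangulation d) (c : ℝ) : IntegrableOn (fun _ => c) M.Ω := by
  have := M.isFiniteMeasure
  exact integrable_const c

namespace Cell

/-- The weak gradient may be tested with nonnegative functions on one element that vanish on its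
boundary. -/
lemma integral_add_eq_zero (T : M.Cell) (hug : HasWeakGradient M.Ω u g) (hu : IntegrableOn u M.Ω)
    (hg : IntegrableOn g M.Ω) {f : Space d → ℝ} (hf : ContDiff ℝ 1 f)
    (h0 : ∀ x ∈ T.simplex, 0 ≤ f x)
    (hz : ∀ x ∈ T.simplex, x ∉ interior T.simplex → f x = 0) (e : Space d) :
    (∫ x in T.simplex, u x * fderiv ℝ f x e) + ∫ x in T.simplex, inner ℝ (g x) e * f x = 0 := by
  classical
  have h := sum_integral_eq_zero hug hu hg (f := fun T' => if T' = T then f else fun _ => 0)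
    (fun T' => ?_) (fun T' x hx => ?_) (fun T' T'' x hx' hx'' => ?_) (fun T' x hx hxf => ?_) e
  · rw [Finset.sum_eq_single T] at h
    · simpa using h
    · intro T' _ hT'
      simp [hT']
    · simp
  · split_ifs
    · exact hf
    · exact contDiff_const
  · split_ifs with hT
    · subst hT; exact h0 x hx
    · exact le_rfl
  · by_cases hxi : x ∈ interior T.simplex
    · rw [← eq_of_mem_interior hxi hx', ← eq_of_mem_interior hxi hx'']
    · split_ifs with h1 h2 h2
      · rfl
      · subst h1; exact hz x hx' hxi
      · subst h2; exact (hz x hx'' hxi).symm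
      · rfl
  · split_ifs with hT
    · subst hT
      refine hz x hx fun hxi => ?_
      have := T'.interior_subset_domain hxi
      rw [M.isOpen.frontier_eq] at hxf
      exact hxf.2 this
    · rfl

/-- For the derivative in the direction of an edge of an element, the test function need not vanish
on those facets of the element that contain the edge. -/
lemma integral_edge_add_eq_zero (T : M.Cell) (hug : HasWeakGradient M.Ω u g)
    (hu : IntegrableOn u M.Ω) (hg : IntegrableOn g M.Ω) {i j : Space d} (hi : i ∈ T.1)
    (hj : j ∈ T.1) {f : Space d → ℝ} (hf : ContDiff ℝ 1 f) (h0 : ∀ x ∈ T.simplex, 0 ≤ f x)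
    (hzi : ∀ x ∈ T.simplex, T.lam i x = 0 → f x = 0)
    (hzj : ∀ x ∈ T.simplex, T.lam j x = 0 → f x = 0) :
    (∫ x in T.simplex, u x * fderiv ℝ f x (i - j)) +
      ∫ x in T.simplex, inner ℝ (g x) (i - j) * f x = 0 := by
  classical
  -- the cut-off functions `η n` are constant along the edge and vanish on the facets containing it
  let s : Finset (Space d) := T.1.filter fun p => p ≠ i ∧ p ≠ j
  let η (n : ℕ) (x : Space d) : ℝ := ∏ p ∈ s, (1 - (1 - T.lam p x) ^ (n + 1))
  have hη (n : ℕ) : ContDiff ℝ 1 (η n) := by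
    refine contDiff_prod fun p _ => contDiff_const.sub ((contDiff_const.sub ?_).pow _)
    exact_mod_cast T.contDiff_lam p (n := 1)
  have hfac (n : ℕ) (p : Space d) {x : Space d} (hx : x ∈ T.simplex) :
      0 ≤ 1 - (1 - T.lam p x) ^ (n + 1) ∧ 1 - (1 - T.lam p x) ^ (n + 1) ≤ 1 := by
    have h1 := T.mem_simplex_iff.1 hx p
    have h2 := T.lam_le_one hx p
    exact ⟨sub_nonneg.2 (pow_le_one₀ (by linarith) (by linarith)),
      sub_le_self _ (pow_nonneg (by linarith) _)⟩
  have hη0 (n : ℕ) {x : Space d} (hx : x ∈ T.simplex) : 0 ≤ η n x :=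
    Finset.prod_nonneg fun p _ => (hfac n p hx).1
  have hη1 (n : ℕ) {x : Space d} (hx : x ∈ T.simplex) : η n x ≤ 1 :=
    Finset.prod_le_one (fun p _ => (hfac n p hx).1) fun p _ => (hfac n p hx).2
  have hηd (n : ℕ) (x : Space d) : fderiv ℝ (η n) x (i - j) = 0 := by
    rw [← ((hη n).differentiable one_ne_zero x).lineDeriv_eq_fderiv, lineDeriv]
    have hc (t : ℝ) : η n (x + t • (i - j)) = η n x := by
      refine Finset.prod_congr rfl fun p hp => ?_
      have hp := (Finset.mem_filter.1 hp).2
      rw [T.lam_add, map_smul, T.dlam_sub, T.lam_of_ne hi hp.1, T.lam_of_ne hj hp.2]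
      simp
    simp [hc]
  have hlim {x : Space d} (hx : x ∈ interior T.simplex) :
      Filter.Tendsto (fun n => η n x) Filter.atTop (nhds 1) := by
    have : Filter.Tendsto (fun n => η n x) Filter.atTop (nhds (∏ p ∈ s, (1 - 0))) := by
      refine tendsto_finsetProd _ fun p hp => tendsto_const_nhds.sub ?_
      have hp := (Finset.mem_filter.1 hp).1
      have h1 := T.mem_interior_iff.1 hx p hp
      have h2 := T.lam_le_one (interior_subset hx) p
      exact (tendsto_pow_atTop_nhds_zero_of_lt_one (by linarith) (by linarith)).comp
        (Filter.tendsto_add_atTop_nat 1)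
    simpa using this
  have key (n : ℕ) := T.integral_add_eq_zero hug hu hg (hf.mul (hη n))
    (fun x hx => mul_nonneg (h0 x hx) (hη0 n hx)) (fun x hx hxi => ?_) (i - j)
  · have hfd (n : ℕ) (x : Space d) : fderiv ℝ (fun y => f y * η n y) x (i - j) =
        fderiv ℝ f x (i - j) * η n x := by
      rw [fderiv_fun_mul (hf.differentiable one_ne_zero x) ((hη n).differentiable one_ne_zero x)]
      simp [hηd, mul_comm]
    have hfc : Continuous fun x => fderiv ℝ f x (i - j) :=
      (hf.continuous_fderiv one_ne_zero).clm_apply continuous_const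
    have hl {v φ : Space d → ℝ} (hv : IntegrableOn v M.Ω) (hφ : Continuous φ) :
        Filter.Tendsto (fun n => ∫ x in T.simplex, v x * (φ x * η n x)) Filter.atTop
          (nhds (∫ x in T.simplex, v x * φ x)) := by
      obtain ⟨A, hA⟩ := (isCompact_simplex T).exists_bound_of_continuousOn hφ.continuousOn
      refine tendsto_integral_mul_of_bound (integrableOn_Ω_iff.1 hv T) (C := A)
        (fun n => (hφ.mul (hη n).continuous).aestronglyMeasurable) (fun n => ?_) ?_
      · filter_upwards [ae_restrict_mem (isCompact_simplex T).measurableSet] with x hx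
        rw [abs_mul, abs_of_nonneg (hη0 n hx)]
        exact (mul_le_of_le_one_right (abs_nonneg _) (hη1 n hx)).trans (hA x hx)
      · filter_upwards [T.ae_interior] with x hx
        simpa using (hlim hx).const_mul (φ x)
    refine tendsto_nhds_unique ((hl hu hfc).add (hl (integrable_inner_const hg (i - j))
      hf.continuous)) (tendsto_const_nhds.congr fun n => ?_)
    rw [← key n]
    simp only [hfd]
  · rw [T.mem_interior_iff] at hxi
    push Not at hxi
    obtain ⟨p, hp, hpx⟩ := hxi
    have hp0 : T.lam p x = 0 := le_antisymm hpx (T.mem_simplex_iff.1 hx p)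
    by_cases h1 : p = i
    · rw [hzi x hx (h1 ▸ hp0), zero_mul]
    by_cases h2 : p = j
    · rw [hzj x hx (h2 ▸ hp0), zero_mul]
    · have : η n x = 0 := Finset.prod_eq_zero (Finset.mem_filter.2 ⟨hp, h1, h2⟩) (by simp [hp0])
      rw [this, mul_zero]

/-- The monomials in the barycentric coordinates. -/
noncomputable def mono (T : M.Cell) (α : Space d → ℕ) (x : Space d) : ℝ :=
  ∏ p ∈ T.1, T.lam p x ^ α p

lemma contDiff_mono (T : M.Cell) (α : Space d → ℕ) {n : ℕ∞} : ContDiff ℝ n (T.mono α) :=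
  contDiff_prod fun p _ => (T.contDiff_lam p).pow _

lemma mono_nonneg (T : M.Cell) (α : Space d → ℕ) {x : Space d} (hx : x ∈ T.simplex) :
    0 ≤ T.mono α x := Finset.prod_nonneg fun p _ => pow_nonneg (T.mem_simplex_iff.1 hx p) _

lemma mono_le_one (T : M.Cell) (α : Space d → ℕ) {x : Space d} (hx : x ∈ T.simplex) :
    T.mono α x ≤ 1 :=
  Finset.prod_le_one (fun p _ => pow_nonneg (T.mem_simplex_iff.1 hx p) _)
    fun p _ => pow_le_one₀ (T.mem_simplex_iff.1 hx p) (T.lam_le_one hx p)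

lemma mono_zero (T : M.Cell) (x : Space d) : T.mono 0 x = 1 := by simp [mono]

open Classical in
lemma mono_add_single (T : M.Cell) (α : Space d → ℕ) {p : Space d} (hp : p ∈ T.1) (x : Space d) :
    T.mono (α + Pi.single p 1) x = T.lam p x * T.mono α x := by
  simp only [mono, Pi.add_apply, pow_add, Finset.prod_mul_distrib]
  rw [mul_comm]
  congr 1
  rw [Finset.prod_eq_single p (fun q _ hq => by simp [hq]) (fun h => (h hp).elim)]
  simp

open Classical in
lemma hasFDerivAt_mono (T : M.Cell) (α : Space d → ℕ) (x : Space d) :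
    HasFDerivAt (T.mono α)
      (∑ p ∈ T.1, ((α p : ℝ) * T.mono (α - Pi.single p 1) x) • T.dlam p) x := by
  have h := HasFDerivAt.finsetProd (u := T.1) (g := fun p y => T.lam p y ^ α p)
    (g' := fun p => ((α p : ℝ) * T.lam p x ^ (α p - 1)) • T.dlam p) (x := x) fun p _ => by
      simpa using (T.hasFDerivAt_lam p x).pow (α p)
  refine h.congr_fderiv ?_
  refine Finset.sum_congr rfl fun p hp => ?_
  rw [smul_smul]
  congr 1
  rw [mono, ← Finset.mul_prod_erase _ _ hp]
  have : ∀ q ∈ T.1.erase p, T.lam q x ^ (α - Pi.single p 1 : Space d → ℕ) q = T.lam q x ^ α q :=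
    fun q hq => by simp [Finset.ne_of_mem_erase hq]
  rw [Finset.prod_congr rfl this]
  simp
  ring

end Cell
end Triangulation

namespace Triangulation

variable {d : ℕ} {M : Triangulation d} {u : Space d → ℝ} {g : Space d → Space d}

namespace Cell

lemma integrableOn_mul (T : M.Cell) (hu : IntegrableOn u M.Ω) {φ : Space d → ℝ}
    (hφ : Continuous φ) : IntegrableOn (fun x => u x * φ x) T.simplex :=
  (integrableOn_Ω_iff.1 hu T).mul_continuousOn hφ.continuousOn (isCompact_simplex T)

/-- Elementary bound for the right hand sides that occur when the weak gradient is tested. -/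
lemma abs_integral_inner_mul_le (T : M.Cell) (hg : IntegrableOn g M.Ω) {φ : Space d → ℝ}
    (hφ : ∀ x ∈ T.simplex, |φ x| ≤ 1) (e : Space d) :
    |∫ x in T.simplex, inner ℝ (g x) e * φ x| ≤ ‖e‖ * ∫ x in T.simplex, ‖g x‖ := by
  rw [← Real.norm_eq_abs, ← integral_const_mul]
  refine norm_integral_le_of_norm_le ((integrableOn_Ω_iff.1 hg T).norm.const_mul _) ?_
  filter_upwards [ae_restrict_mem (isCompact_simplex T).measurableSet] with x hx
  rw [norm_mul]
  refine (mul_le_of_le_one_right (norm_nonneg _) (hφ x hx)).trans ?_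
  rw [mul_comm]
  exact norm_inner_le_norm _ _

/-- The total degree of a monomial. -/
def deg (T : M.Cell) (α : Space d → ℕ) : ℕ := ∑ p ∈ T.1, α p

/-- The product of the factorials of the exponents of a monomial. -/
def factorials (T : M.Cell) (α : Space d → ℕ) : ℕ := ∏ p ∈ T.1, (α p).factorial

lemma factorials_pos (T : M.Cell) (α : Space d → ℕ) : 0 < T.factorials α :=
  Finset.prod_pos fun p _ => (α p).factorial_pos

lemma factorials_le (T : M.Cell) (α : Space d → ℕ) : T.factorials α ≤ (T.deg α).factorial :=
  Nat.le_of_dvd (Nat.factorial_pos _) (Nat.prod_factorial_dvd_factorial_sum _ _)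

open Classical in
lemma deg_add_single (T : M.Cell) (α : Space d → ℕ) {p : Space d} (hp : p ∈ T.1) :
    T.deg (α + Pi.single p 1) = T.deg α + 1 := by
  simp [deg, Finset.sum_add_distrib, hp]

open Classical in
lemma factorials_add_single (T : M.Cell) (α : Space d → ℕ) {p : Space d} (hp : p ∈ T.1) :
    T.factorials (α + Pi.single p 1) = (α p + 1) * T.factorials α := by
  simp only [factorials]
  rw [← Finset.mul_prod_erase _ _ hp, ← Finset.mul_prod_erase _ _ hp, ← mul_assoc]
  congr 1
  · simp [Nat.factorial_succ]
  · exact Finset.prod_congr rfl fun q hq => by simp [Finset.ne_of_mem_erase hq]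

/-- The moments of a function with respect to the monomials in the barycentric coordinates,
normalized such that they depend on the degree only if the function is constant. -/
noncomputable def moment (T : M.Cell) (u : Space d → ℝ) (α : Space d → ℕ) : ℝ :=
  (∫ x in T.simplex, u x * T.mono α x) / T.factorials α

lemma integral_mul_mono (T : M.Cell) (u : Space d → ℝ) (α : Space d → ℕ) :
    ∫ x in T.simplex, u x * T.mono α x = T.factorials α * T.moment u α := by
  have : (T.factorials α : ℝ) ≠ 0 := by exact_mod_cast (T.factorials_pos α).ne'
  rw [moment]; field_simp

lemma moment_zero (T : M.Cell) (u : Space d → ℝ) :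
    T.moment u 0 = ∫ x in T.simplex, u x := by
  simp [moment, mono_zero, factorials]

open Classical in
lemma moment_eq_sum (T : M.Cell) (hu : IntegrableOn u M.Ω) (α : Space d → ℕ) :
    T.moment u α = ∑ p ∈ T.1, ((α p : ℝ) + 1) * T.moment u (α + Pi.single p 1) := by
  have hN : (T.factorials α : ℝ) ≠ 0 := by exact_mod_cast (T.factorials_pos α).ne'
  have h1 : ∫ x in T.simplex, u x * T.mono α x =
      ∑ p ∈ T.1, ∫ x in T.simplex, u x * T.mono (α + Pi.single p 1) x := by
    rw [← integral_finsetSum _ fun p _ =>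
      T.integrableOn_mul hu (T.contDiff_mono _ (n := 0)).continuous]
    refine integral_congr_ae (.of_forall fun x => ?_)
    dsimp only
    rw [Finset.sum_congr rfl fun p hp => by rw [T.mono_add_single α hp], ← Finset.mul_sum,
      ← Finset.sum_mul, T.sum_lam, one_mul]
  refine mul_left_cancel₀ hN ?_
  rw [← integral_mul_mono, h1, Finset.mul_sum]
  refine Finset.sum_congr rfl fun p hp => ?_
  rw [integral_mul_mono, T.factorials_add_single α hp]
  push_cast
  ring

open Classical in
/-- Integration by parts along an edge compares two moments of the same degree. -/
lemma abs_moment_sub_le (T : M.Cell) (hug : HasWeakGradient M.Ω u g) (hu : IntegrableOn u M.Ω)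
    (hg : IntegrableOn g M.Ω) (β : Space d → ℕ) {i j : Space d} (hi : i ∈ T.1) (hj : j ∈ T.1) :
    |T.moment u (β + Pi.single j 1) - T.moment u (β + Pi.single i 1)| ≤
      T.diam * ∫ x in T.simplex, ‖g x‖ := by
  have hG : 0 ≤ ∫ x in T.simplex, ‖g x‖ := integral_nonneg fun x => norm_nonneg _
  rcases eq_or_ne i j with rfl | hij
  · simpa using mul_nonneg T.diam_nonneg hG
  set α : Space d → ℕ := β + Pi.single i 1 + Pi.single j 1 with hα
  have hm (x : Space d) : T.mono α x = T.lam i x * T.lam j x * T.mono β x := by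
    rw [hα, T.mono_add_single _ hj, T.mono_add_single _ hi]; ring
  have hd (x : Space d) : fderiv ℝ (T.mono α) x (i - j) =
      (β i + 1) * T.mono (β + Pi.single j 1) x - (β j + 1) * T.mono (β + Pi.single i 1) x := by
    rw [(T.hasFDerivAt_mono α x).fderiv]
    have h1 (p : Space d) (hp : p ∈ T.1) : T.dlam p (i - j) =
        (if p = i then 1 else 0) - if p = j then 1 else 0 := by
      rw [T.dlam_sub]
      congr 1
      · split_ifs with h
        · rw [h, T.lam_self hi]
        · exact T.lam_of_ne hi h
      · split_ifs with h
        · rw [h, T.lam_self hj]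
        · exact T.lam_of_ne hj h
    simp only [FunLike.coe_sum, Finset.sum_apply, FunLike.coe_smul, Pi.smul_apply,
      smul_eq_mul]
    rw [Finset.sum_congr rfl fun p hp => by rw [h1 p hp]]
    simp only [mul_sub, Finset.sum_sub_distrib, mul_ite, mul_one, mul_zero, Finset.sum_ite_eq',
      hi, hj, if_true]
    have e1 : α - Pi.single i 1 = β + Pi.single j 1 := by
      rw [hα, add_right_comm, add_tsub_cancel_right]
    have e2 : α - Pi.single j 1 = β + Pi.single i 1 := by
      rw [hα, add_tsub_cancel_right]
    rw [e1, e2]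
    simp [hα, hij, hij.symm]
  have key := T.integral_edge_add_eq_zero hug hu hg hi hj (T.contDiff_mono α (n := 1))
    (fun x hx => T.mono_nonneg α hx) (fun x _ h => by rw [hm, h]; ring)
    (fun x _ h => by rw [hm, h]; ring)
  have hint (γ : Space d → ℕ) := T.integrableOn_mul hu (T.contDiff_mono γ (n := 0)).continuous
  have h2 : ∫ x in T.simplex, u x * fderiv ℝ (T.mono α) x (i - j) =
      T.factorials α * (T.moment u (β + Pi.single j 1) - T.moment u (β + Pi.single i 1)) := by
    have : ∀ x, u x * fderiv ℝ (T.mono α) x (i - j) =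
        (β i + 1) * (u x * T.mono (β + Pi.single j 1) x) -
          (β j + 1) * (u x * T.mono (β + Pi.single i 1) x) := fun x => by rw [hd]; ring
    simp only [this]
    rw [integral_sub ((hint _).const_mul _) ((hint _).const_mul _), integral_const_mul,
      integral_const_mul, integral_mul_mono, integral_mul_mono, T.factorials_add_single β hi,
      T.factorials_add_single β hj, hα, T.factorials_add_single _ hj, T.factorials_add_single β hi]
    simp only [Pi.add_apply, Pi.single_apply, hij.symm, if_false]
    push_cast
    ring
  have hN : (1 : ℝ) ≤ T.factorials α := by exact_mod_cast T.factorials_pos α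
  have h3 := T.abs_integral_inner_mul_le hg (φ := T.mono α) (fun x hx => by
    rw [abs_of_nonneg (T.mono_nonneg α hx)]; exact T.mono_le_one α hx) (i - j)
  have h4 : ‖i - j‖ ≤ T.diam := by
    rw [← dist_eq_norm]; exact T.dist_le_diam (T.subset_simplex hi) (T.subset_simplex hj)
  have h5 : |(T.factorials α : ℝ) *
      (T.moment u (β + Pi.single j 1) - T.moment u (β + Pi.single i 1))| ≤
        T.diam * ∫ x in T.simplex, ‖g x‖ := by
    rw [← h2, eq_neg_of_add_eq_zero_left key, abs_neg]
    exact h3.trans (mul_le_mul_of_nonneg_right h4 hG)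
  rw [abs_mul, abs_of_pos (by linarith)] at h5
  exact (le_mul_of_one_le_left (abs_nonneg _) hN).trans h5

/-- The normalized moments of the constant function `1`, on an element of volume `1`. -/
noncomputable def momentRatio (d : ℕ) : ℕ → ℝ
  | 0 => 1
  | n + 1 => momentRatio d n / (n + d + 1)

lemma momentRatio_pos (d n : ℕ) : 0 < momentRatio d n := by
  induction n with
  | zero => simp [momentRatio]
  | succ n ih => rw [momentRatio]; positivity

/-- The moments of a Sobolev function differ from those of its mean value by a quantity controlled
by the gradient. -/
theorem abs_moment_sub_momentRatio_le (T : M.Cell) (hug : HasWeakGradient M.Ω u g)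
    (hu : IntegrableOn u M.Ω) (hg : IntegrableOn g M.Ω) (n : ℕ) (α : Space d → ℕ)
    (hα : T.deg α = n) :
    |T.moment u α - momentRatio d n * ∫ x in T.simplex, u x| ≤
      n * (T.diam * ∫ x in T.simplex, ‖g x‖) := by
  classical
  set D := T.diam * ∫ x in T.simplex, ‖g x‖ with hD
  have hD0 : 0 ≤ D := mul_nonneg T.diam_nonneg (integral_nonneg fun x => norm_nonneg _)
  induction n generalizing α with
  | zero =>
    have h0 : ∀ p ∈ T.1, α p = 0 := by
      simpa [deg] using hα
    have h1 : T.moment u α = T.moment u 0 := by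
      rw [moment, moment]
      congr 1
      · refine integral_congr_ae (.of_forall fun x => ?_)
        simp only [mono]
        congr 1
        exact Finset.prod_congr rfl fun p hp => by simp [h0 p hp]
      · simp only [factorials]
        congr 1
        exact Finset.prod_congr rfl fun p hp => by simp [h0 p hp]
    rw [h1, moment_zero]
    simp [momentRatio]
  | succ n ih =>
    obtain ⟨j, hj, hαj⟩ : ∃ j ∈ T.1, α j ≠ 0 := by
      by_contra! h
      rw [deg, Finset.sum_eq_zero h] at hα
      omega
    set β := α - Pi.single j 1 with hβ
    have hβα : α = β + Pi.single j 1 := by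
      rw [hβ, tsub_add_cancel_of_le]
      intro q
      by_cases hq : q = j
      · subst hq; simpa using Nat.one_le_iff_ne_zero.2 hαj
      · simp [hq]
    have hβn : T.deg β = n := by
      have := T.deg_add_single β hj
      rw [← hβα, hα] at this
      omega
    have h1 := ih β hβn
    have hsum : ∑ p ∈ T.1, ((β p : ℝ) + 1) = n + d + 1 := by
      rw [Finset.sum_add_distrib, ← Nat.cast_sum, Finset.sum_const, T.card_eq]
      have : ∑ p ∈ T.1, β p = n := hβn
      rw [this]
      simp; ring
    have h2 : |(n + d + 1 : ℝ) * T.moment u α - T.moment u β| ≤ (n + d + 1) * D := by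
      rw [T.moment_eq_sum hu β, ← hsum, Finset.sum_mul, ← Finset.sum_sub_distrib, Finset.sum_mul]
      refine (Finset.abs_sum_le_sum_abs _ _).trans (Finset.sum_le_sum fun p hp => ?_)
      rw [← mul_sub, abs_mul, abs_of_nonneg (by positivity)]
      refine mul_le_mul_of_nonneg_left ?_ (by positivity)
      rw [hβα]
      exact T.abs_moment_sub_le hug hu hg β hp hj
    have hN : (1 : ℝ) ≤ n + d + 1 := by
      have : (0 : ℝ) ≤ n := by positivity
      have : (0 : ℝ) ≤ d := by positivity
      linarith
    have h3 : (n + d + 1 : ℝ) * |T.moment u α - momentRatio d (n + 1) * ∫ x in T.simplex, u x| ≤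
        (n + d + 1) * ((n + 1) * D) := by
      rw [← abs_of_pos (by linarith : (0 : ℝ) < n + d + 1), ← abs_mul,
        abs_of_pos (by linarith : (0 : ℝ) < n + d + 1)]
      have e1 : (n + d + 1 : ℝ) * (T.moment u α - momentRatio d (n + 1) * ∫ x in T.simplex, u x) =
          ((n + d + 1 : ℝ) * T.moment u α - T.moment u β) +
            (T.moment u β - momentRatio d n * ∫ x in T.simplex, u x) := by
        rw [momentRatio]; field_simp; ring
      rw [e1]
      refine (abs_add_le _ _).trans ((add_le_add h2 h1).trans ?_)
      have : (n : ℝ) * D ≤ (n + d + 1) * (n * D) :=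
        le_mul_of_one_le_left (by positivity) hN
      linarith
    have h4 := le_of_mul_le_mul_left h3 (by linarith)
    push_cast
    exact h4

/-- Bounds for the moments of the product of `u` and a polynomial `f` of degree `k`. This form is
stable under the multiplication of `f` with affine functions. -/
def MomentBound (T : M.Cell) (u : Space d → ℝ) (D : ℝ) (k : ℕ) (c : ℝ) (f : Space d → ℝ) : Prop :=
  Continuous f ∧ ∀ α, |∫ x in T.simplex, u x * (f x * T.mono α x)| ≤
    c * (((k + T.deg α) * (k + T.deg α).factorial : ℕ) : ℝ) * D

lemma momentBound_one (T : M.Cell) (hug : HasWeakGradient M.Ω u g) (hu : IntegrableOn u M.Ω)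
    (hg : IntegrableOn g M.Ω) (h0 : ∫ x in T.simplex, u x = 0) :
    T.MomentBound u (T.diam * ∫ x in T.simplex, ‖g x‖) 0 1 fun _ => 1 := by
  refine ⟨continuous_const, fun α => ?_⟩
  have h := T.abs_moment_sub_momentRatio_le hug hu hg _ α rfl
  have hG : 0 ≤ ∫ x in T.simplex, ‖g x‖ := integral_nonneg fun x => norm_nonneg _
  have hD := mul_nonneg T.diam_nonneg hG
  rw [h0, mul_zero, sub_zero] at h
  simp only [one_mul, zero_add]
  rw [integral_mul_mono, abs_mul, Nat.abs_cast]
  refine (mul_le_mul (Nat.cast_le.2 (T.factorials_le α)) h (abs_nonneg _) (by positivity)).trans ?_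
  push_cast
  exact le_of_eq (by ring)

lemma MomentBound.mul_affine {T : M.Cell} {D c χ : ℝ} {k : ℕ} {f : Space d → ℝ}
    (hf : T.MomentBound u D k c f) (hu : IntegrableOn u M.Ω)
    (ℓ : Space d →ᵃ[ℝ] ℝ) (hℓ : ∀ p ∈ T.1, |ℓ p| ≤ χ) :
    T.MomentBound u D (k + 1) ((d + 1) * χ * c) fun x => f x * ℓ x := by
  classical
  refine ⟨hf.1.mul ℓ.continuous_of_finiteDimensional, fun α => ?_⟩
  have h1 : ∫ x in T.simplex, u x * (f x * ℓ x * T.mono α x) =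
      ∑ p ∈ T.1, ℓ p * ∫ x in T.simplex, u x * (f x * T.mono (α + Pi.single p 1) x) := by
    simp only [← integral_const_mul]
    rw [← integral_finsetSum]
    · refine integral_congr_ae (.of_forall fun x => ?_)
      dsimp only
      rw [T.affine_eq_sum ℓ x, Finset.mul_sum, Finset.sum_mul, Finset.mul_sum]
      refine Finset.sum_congr rfl fun p hp => ?_
      rw [T.mono_add_single α hp]
      ring
    · exact fun p _ => (T.integrableOn_mul hu
        (hf.1.mul (T.contDiff_mono _ (n := 0)).continuous)).const_mul _
  rw [h1]
  refine (Finset.abs_sum_le_sum_abs _ _).trans ?_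
  have h2 : ∀ p ∈ T.1, |ℓ p * ∫ x in T.simplex, u x * (f x * T.mono (α + Pi.single p 1) x)| ≤
      χ * (c * (((k + 1 + T.deg α) * (k + 1 + T.deg α).factorial : ℕ) : ℝ) * D) := by
    intro p hp
    rw [abs_mul]
    have := hf.2 (α + Pi.single p 1)
    rw [T.deg_add_single α hp, ← add_assoc, add_right_comm] at this
    exact mul_le_mul (hℓ p hp) this (abs_nonneg _) ((abs_nonneg _).trans (hℓ p hp))
  refine (Finset.sum_le_sum h2).trans (le_of_eq ?_)
  rw [Finset.sum_const, T.card_eq, nsmul_eq_mul]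
  push_cast
  ring

lemma MomentBound.mul_pow {T : M.Cell} {D c χ : ℝ} {k : ℕ} {f : Space d → ℝ}
    (hf : T.MomentBound u D k c f) (hu : IntegrableOn u M.Ω)
    (ℓ : Space d →ᵃ[ℝ] ℝ) (hℓ : ∀ p ∈ T.1, |ℓ p| ≤ χ) (n : ℕ) :
    T.MomentBound u D (k + n) (((d + 1) * χ) ^ n * c) fun x => f x * ℓ x ^ n := by
  induction n with
  | zero => simpa using hf
  | succ n ih =>
    have := ih.mul_affine hu ℓ hℓ
    simpa only [pow_succ, ← mul_assoc, ← add_assoc, mul_comm, mul_left_comm] using this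

lemma momentBound_prod (T : M.Cell) {D χ : ℝ} (hu : IntegrableOn u M.Ω)
    (h1 : T.MomentBound u D 0 1 fun _ => 1) (ℓ : Fin d → Space d →ᵃ[ℝ] ℝ)
    (hℓ : ∀ i, ∀ p ∈ T.1, |ℓ i p| ≤ χ) (α : Fin d → ℕ) (s : Finset (Fin d)) :
    T.MomentBound u D (∑ i ∈ s, α i) (((d + 1) * χ) ^ (∑ i ∈ s, α i))
      fun x => ∏ i ∈ s, ℓ i x ^ α i := by
  induction s using Finset.induction_on with
  | empty => simpa using h1
  | insert i s hi ih =>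
    have := ih.mul_pow hu (ℓ i) (hℓ i) (α i)
    simp only [Finset.sum_insert hi, Finset.prod_insert hi, pow_add]
    rw [add_comm]
    simpa only [mul_comm] using this

/-- Against polynomials of bounded degree, a Sobolev function with mean value zero is controlled by
its gradient. This is a weak form of the Poincaré inequality that needs no compactness. -/
theorem exists_integral_mul_polyFun_le (d K : ℕ) (χ : ℝ) :
    ∃ c : ℝ, 0 ≤ c ∧ ∀ (M : Triangulation d) (T : M.Cell) (x₀ : Space d) (r : ℝ), 0 < r →
      Metric.closedBall x₀ r ⊆ T.simplex → T.diam ≤ χ * r →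
      ∀ (u : Space d → ℝ) (g : Space d → Space d), HasWeakGradient M.Ω u g →
      IntegrableOn u M.Ω → IntegrableOn g M.Ω → ∫ x in T.simplex, u x = 0 →
      ∀ P : MvPolynomial (Fin d) ℝ, P.totalDegree ≤ K →
        |∫ x in T.simplex, u x * polyFun P x| ≤
          c * T.rms (polyFun P) * (T.diam * ∫ x in T.simplex, ‖g x‖) := by
  obtain ⟨c, hc, h⟩ := exists_inverse_estimate d K χ
  set A : ℝ := max 1 ((d + 1) * χ) with hA
  have hA1 : 1 ≤ A := le_max_left _ _
  refine ⟨A ^ K * ((K * K.factorial : ℕ) : ℝ) * c, by positivity, ?_⟩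
  intro M T x₀ r hr hball hdiam u g hug hu hg h0 P hP
  obtain ⟨-, -, a, ha, hPa⟩ := h M T x₀ r hr hball hdiam P hP
  set D := T.diam * ∫ x in T.simplex, ‖g x‖ with hD
  have hD0 : 0 ≤ D := mul_nonneg T.diam_nonneg (integral_nonneg fun x => norm_nonneg _)
  have hχ0 : 0 ≤ χ := by
    by_contra hlt
    have := mul_neg_of_neg_of_pos (not_le.1 hlt) hr
    linarith [T.diam_nonneg]
  -- the affine functions in the representation of `P`
  let ℓ (i : Fin d) : Space d →ᵃ[ℝ] ℝ :=
    (r⁻¹ • (EuclideanSpace.proj i : Space d →L[ℝ] ℝ).toLinearMap).toAffineMap -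
      AffineMap.const ℝ _ (r⁻¹ * x₀ i)
  have hℓ (i : Fin d) (x : Space d) : ℓ i x = r⁻¹ * (x i - x₀ i) := by
    simp [ℓ]; ring
  have hℓχ (i : Fin d) (p : Space d) (hp : p ∈ T.1) : |ℓ i p| ≤ χ := by
    rw [hℓ, abs_mul, abs_of_pos (inv_pos.2 hr), inv_mul_le_iff₀ hr, mul_comm r]
    refine le_trans ?_ hdiam
    have h1 : |p i - x₀ i| ≤ ‖p - x₀‖ := by
      simpa using PiLp.norm_apply_le (p - x₀) i
    refine h1.trans ?_
    rw [← dist_eq_norm]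
    exact T.dist_le_diam (T.subset_simplex hp) (hball (Metric.mem_closedBall_self hr.le))
  have hmono (α : Fin d →₀ ℕ) (hα : α ∈ exponents d K) :
      |∫ x in T.simplex, u x * ∏ i, (r⁻¹ * (x i - x₀ i)) ^ α i| ≤
        A ^ K * ((K * K.factorial : ℕ) : ℝ) * D := by
    have h1 := (T.momentBound_prod hu (T.momentBound_one hug hu hg h0) ℓ hℓχ α
      Finset.univ).2 0
    simp only [mono_zero, mul_one, hℓ] at h1
    refine h1.trans ?_
    have hαK := mem_exponents.1 hα
    have h2 : T.deg 0 = 0 := by simp [deg]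
    rw [h2, add_zero]
    refine mul_le_mul_of_nonneg_right ?_ hD0
    refine mul_le_mul ?_ ?_ (by positivity) (by positivity)
    · exact (pow_le_pow_left₀ (by positivity) (le_max_right _ _) _).trans
        (pow_le_pow_right₀ hA1 hαK)
    · exact_mod_cast Nat.mul_le_mul hαK (Nat.factorial_le hαK)
  have hcont (α : Fin d →₀ ℕ) : Continuous fun x : Space d => ∏ i, (r⁻¹ * (x i - x₀ i)) ^ α i := by
    fun_prop
  have h1 : ∫ x in T.simplex, u x * polyFun P x =
      ∑ α ∈ exponents d K, a α * ∫ x in T.simplex, u x * ∏ i, (r⁻¹ * (x i - x₀ i)) ^ α i := by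
    simp only [← integral_const_mul]
    rw [← integral_finsetSum _ fun α _ => (T.integrableOn_mul hu (hcont α)).const_mul _]
    refine integral_congr_ae (.of_forall fun x => ?_)
    dsimp only
    rw [hPa, Finset.mul_sum]
    exact Finset.sum_congr rfl fun α _ => by ring
  rw [h1]
  calc |∑ α ∈ exponents d K, a α * ∫ x in T.simplex, u x * ∏ i, (r⁻¹ * (x i - x₀ i)) ^ α i|
      ≤ ∑ α ∈ exponents d K, |a α| * (A ^ K * ((K * K.factorial : ℕ) : ℝ) * D) := by
        refine (Finset.abs_sum_le_sum_abs _ _).trans (Finset.sum_le_sum fun α hα => ?_)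
        rw [abs_mul]
        exact mul_le_mul_of_nonneg_left (hmono α hα) (abs_nonneg _)
    _ ≤ c * T.rms (polyFun P) * (A ^ K * ((K * K.factorial : ℕ) : ℝ) * D) := by
        rw [← Finset.sum_mul]
        exact mul_le_mul_of_nonneg_right ha (by positivity)
    _ = _ := by ring

end Cell
end Triangulation

namespace Triangulation

/-! ### Mean values on elements with a common facet, and at the boundary -/

variable {d : ℕ} {M : Triangulation d} {u : Space d → ℝ} {g : Space d → Space d}

namespace Cell

/-- An element contains a ball whose radius is comparable to the diameter. -/
def IsRegular (T : M.Cell) (χ : ℝ) : Prop :=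
  ∃ (x : Space d) (r : ℝ), 0 < r ∧ Metric.closedBall x r ⊆ T.simplex ∧ T.diam ≤ χ * r

lemma IsRegular.nonneg {T : M.Cell} {χ : ℝ} (h : T.IsRegular χ) : 0 ≤ χ := by
  obtain ⟨x, r, hr, -, h⟩ := h
  by_contra hlt
  have := mul_neg_of_neg_of_pos (not_le.1 hlt) hr
  linarith [T.diam_nonneg]

lemma IsRegular.diam_mul_abs_dlam_le {T : M.Cell} {χ : ℝ} (h : T.IsRegular χ) (p e : Space d) :
    T.diam * |T.dlam p e| ≤ χ * ‖e‖ := by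
  have hχ := h.nonneg
  obtain ⟨x, r, hr, hball, h⟩ := h
  rcases eq_or_ne e 0 with rfl | he
  · simp
  have he' : 0 < ‖e‖ := norm_pos_iff.2 he
  have hmem : x + (r / ‖e‖) • e ∈ T.simplex := by
    refine hball ?_
    rw [Metric.mem_closedBall, dist_self_add_left, norm_smul, Real.norm_of_nonneg (by positivity),
      div_mul_cancel₀ _ he'.ne']
  have hx : x ∈ T.simplex := hball (Metric.mem_closedBall_self hr.le)
  have h1 : T.lam p (x + (r / ‖e‖) • e) - T.lam p x = r / ‖e‖ * T.dlam p e := by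
    rw [T.lam_add, map_smul, smul_eq_mul]; ring
  have h2 : |r / ‖e‖ * T.dlam p e| ≤ 1 := by
    rw [← h1, abs_le]
    have a1 := T.mem_simplex_iff.1 hmem p
    have a2 := T.lam_le_one hmem p
    have a3 := T.mem_simplex_iff.1 hx p
    have a4 := T.lam_le_one hx p
    constructor <;> linarith
  rw [abs_mul, abs_of_pos (by positivity), div_mul_eq_mul_div, div_le_one he'] at h2
  calc T.diam * |T.dlam p e| ≤ χ * r * |T.dlam p e| := by gcongr
    _ = χ * (r * |T.dlam p e|) := by ring
    _ ≤ χ * ‖e‖ := by gcongr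

lemma sum_dlam (T : M.Cell) (e : Space d) : ∑ p ∈ T.1, T.dlam p e = 0 := by
  have h1 := T.sum_lam (0 + e)
  simp only [T.lam_add, Finset.sum_add_distrib, T.sum_lam] at h1
  linarith

open Classical in
lemma IsFacet.exists_opposite {T : M.Cell} {F : Finset (Space d)} (h : T.IsFacet F) :
    ∃ a, a ∉ F ∧ insert a F = T.1 := by
  have := Finset.exists_eq_insert_iff.2 ⟨h.1, by rw [h.2, T.card_eq]⟩
  obtain ⟨a, ha, h⟩ := this
  exact ⟨a, ha, h⟩

open Classical in
/-- The exponents of the product of the barycentric coordinates of the vertices in `F`. -/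
noncomputable def bubbleExp (F : Finset (Space d)) (p : Space d) : ℕ := if p ∈ F then 1 else 0

/-- The product of the barycentric coordinates of the vertices of a facet: a function that vanishes
on all the other facets. -/
noncomputable def bubble (T : M.Cell) (F : Finset (Space d)) : Space d → ℝ := T.mono (bubbleExp F)

lemma bubble_eq_prod {T : M.Cell} {F : Finset (Space d)} (hF : F ⊆ T.1) (x : Space d) :
    T.bubble F x = ∏ p ∈ F, T.lam p x := by
  rw [bubble, mono, ← Finset.prod_subset hF]
  · exact Finset.prod_congr rfl fun p hp => by simp [bubbleExp, hp]
  · intro p _ hp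
    simp [bubbleExp, hp]

lemma bubble_eq_zero_iff {T : M.Cell} {F : Finset (Space d)} (hF : F ⊆ T.1) {x : Space d} :
    T.bubble F x = 0 ↔ ∃ p ∈ F, T.lam p x = 0 := by
  rw [bubble_eq_prod hF, Finset.prod_eq_zero_iff]

open Classical in
/-- Integrating by parts against the bubble function of a facet yields the mean value, up to terms
controlled by the gradient. -/
lemma abs_integral_fderiv_bubble_le (T : M.Cell) {χ : ℝ} (hT : T.IsRegular χ)
    (hug : HasWeakGradient M.Ω u g) (hu : IntegrableOn u M.Ω) (hg : IntegrableOn g M.Ω)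
    {F : Finset (Space d)} (hF : F.card = d) {a : Space d} (ha : a ∉ F) (haF : insert a F = T.1)
    (e : Space d) :
    |(∫ x in T.simplex, u x * fderiv ℝ (T.bubble F) x e) +
      momentRatio d (d - 1) * T.dlam a e * ∫ x in T.simplex, u x| ≤
      d ^ 2 * χ * ‖e‖ * ∫ x in T.simplex, ‖g x‖ := by
  have hFT : F ⊆ T.1 := haF ▸ Finset.subset_insert a F
  have hχ := hT.nonneg
  have hI : 0 ≤ ∫ x in T.simplex, ‖g x‖ := integral_nonneg fun x => norm_nonneg _
  have hdeg (p : Space d) (hp : p ∈ F) : T.deg (bubbleExp F - Pi.single p 1) = d - 1 := by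
    have h1 : bubbleExp F - Pi.single p 1 + Pi.single p 1 = bubbleExp F := by
      funext q
      by_cases hq : q = p
      · subst hq; simp [bubbleExp, hp]
      · simp [hq]
    have h2 := T.deg_add_single (bubbleExp F - Pi.single p 1) (hFT hp)
    have h3 : T.deg (bubbleExp F) = d := by
      rw [deg, ← Finset.sum_subset hFT fun q _ hq => by simp [bubbleExp, hq]]
      have : ∀ q ∈ F, bubbleExp F q = 1 := fun q hq => by simp [bubbleExp, hq]
      rw [Finset.sum_congr rfl this, Finset.sum_const, hF]
      simp
    rw [h1, h3] at h2
    omega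
  have hfac (p : Space d) : T.factorials (bubbleExp F - Pi.single p 1) = 1 := by
    refine Finset.prod_eq_one fun q _ => ?_
    have : (bubbleExp F - Pi.single p 1 : Space d → ℕ) q ≤ 1 := by
      refine (Nat.sub_le _ _).trans ?_
      simp only [bubbleExp]
      split_ifs <;> simp
    exact Nat.factorial_eq_one.2 this
  have h1 : ∫ x in T.simplex, u x * fderiv ℝ (T.bubble F) x e =
      ∑ p ∈ F, T.dlam p e * T.moment u (bubbleExp F - Pi.single p 1) := by
    have h2 (x : Space d) : u x * fderiv ℝ (T.bubble F) x e =
        ∑ p ∈ F, T.dlam p e * (u x * T.mono (bubbleExp F - Pi.single p 1) x) := by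
      rw [bubble, (T.hasFDerivAt_mono _ x).fderiv]
      simp only [FunLike.coe_sum, Finset.sum_apply, FunLike.coe_smul, Pi.smul_apply, smul_eq_mul]
      rw [← Finset.sum_subset hFT fun q _ hq => by simp [bubbleExp, hq], Finset.mul_sum]
      refine Finset.sum_congr rfl fun p hp => ?_
      simp only [bubbleExp, hp, if_true]
      push_cast
      ring
    simp only [h2]
    rw [integral_finsetSum _ fun p _ =>
      (T.integrableOn_mul hu (T.contDiff_mono _ (n := 0)).continuous).const_mul _]
    refine Finset.sum_congr rfl fun p _ => ?_
    rw [integral_const_mul, integral_mul_mono, hfac, Nat.cast_one, one_mul]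
  have h2 : T.dlam a e = - ∑ p ∈ F, T.dlam p e := by
    have := T.sum_dlam e
    rw [← haF, Finset.sum_insert ha] at this
    linarith
  have h3 : (∫ x in T.simplex, u x * fderiv ℝ (T.bubble F) x e) +
      momentRatio d (d - 1) * T.dlam a e * ∫ x in T.simplex, u x =
      ∑ p ∈ F, T.dlam p e * (T.moment u (bubbleExp F - Pi.single p 1) -
        momentRatio d (d - 1) * ∫ x in T.simplex, u x) := by
    rw [h1, h2]
    simp only [mul_sub, Finset.sum_sub_distrib, ← Finset.sum_mul]
    ring
  rw [h3]
  refine (Finset.abs_sum_le_sum_abs _ _).trans ?_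
  have h4 : ∀ p ∈ F, |T.dlam p e * (T.moment u (bubbleExp F - Pi.single p 1) -
        momentRatio d (d - 1) * ∫ x in T.simplex, u x)| ≤
      d * (χ * ‖e‖ * ∫ x in T.simplex, ‖g x‖) := by
    intro p hp
    have h5 := T.abs_moment_sub_momentRatio_le hug hu hg _ _ (hdeg p hp)
    have h6 := hT.diam_mul_abs_dlam_le p e
    have h7 : ((d - 1 : ℕ) : ℝ) ≤ d := by exact_mod_cast Nat.sub_le _ _
    rw [abs_mul]
    calc |T.dlam p e| * |T.moment u (bubbleExp F - Pi.single p 1) -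
          momentRatio d (d - 1) * ∫ x in T.simplex, u x|
        ≤ |T.dlam p e| * (d * (T.diam * ∫ x in T.simplex, ‖g x‖)) := by
          refine mul_le_mul_of_nonneg_left (h5.trans ?_) (abs_nonneg _)
          exact mul_le_mul_of_nonneg_right h7 (mul_nonneg T.diam_nonneg hI)
      _ = d * ((T.diam * |T.dlam p e|) * ∫ x in T.simplex, ‖g x‖) := by ring
      _ ≤ d * (χ * ‖e‖ * ∫ x in T.simplex, ‖g x‖) := by gcongr
  refine (Finset.sum_le_sum h4).trans (le_of_eq ?_)
  rw [Finset.sum_const, hF, nsmul_eq_mul]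
  ring

/-- If two elements share a facet, then they lie on different sides of it. -/
lemma lam_opposite_neg (hd : 1 ≤ d) {T T' : M.Cell} {F : Finset (Space d)} (hF : F.card = d)
    (hFT : F ⊆ T.1) (hFT' : F ⊆ T'.1) {a a' : Space d} (hT : ∀ q ∈ T.1, q = a ∨ q ∈ F)
    (ha : a ∉ F) (ha' : a' ∈ T'.1) (haT : a' ∉ T.1) : T.lam a a' < 0 := by
  by_contra! hneg
  have hd0 : (0 : ℝ) < d := by exact_mod_cast hd
  -- a point of the second element near the centroid of the facet
  let m : Space d := (d : ℝ)⁻¹ • ∑ p ∈ F, p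
  have hm : m ∈ convexHull ℝ (F : Set (Space d)) := by
    rw [Finset.mem_convexHull']
    refine ⟨fun _ => (d : ℝ)⁻¹, fun _ _ => by positivity, ?_, ?_⟩
    · rw [Finset.sum_const, hF, nsmul_eq_mul, mul_inv_cancel₀ hd0.ne']
    · rw [← Finset.smul_sum]
  have hmT : m ∈ T.simplex := convexHull_mono (by exact_mod_cast hFT) hm
  have hmT' : m ∈ T'.simplex := convexHull_mono (by exact_mod_cast hFT') hm
  have hline (f : Space d →ᵃ[ℝ] ℝ) (ε : ℝ) :
      f (m + ε • (a' - m)) = f m + ε * (f a' - f m) := by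
    have := f.apply_lineMap m a' ε
    rw [AffineMap.lineMap_apply, AffineMap.lineMap_apply] at this
    simp only [vsub_eq_sub, vadd_eq_add, smul_eq_mul] at this
    rw [add_comm m, this, add_comm]
  have hlm (p : Space d) (hp : p ∈ F) : T.lam p m = (d : ℝ)⁻¹ := by
    have h1 : T.lam p m = T.lam p 0 + T.dlam p m := by
      rw [← T.lam_add, zero_add]
    have h2 (q : Space d) (hq : q ∈ F) : T.dlam p q = T.lam p q - T.lam p 0 := by
      rw [← T.dlam_sub, sub_zero]
    have h3 : ∑ q ∈ F, T.lam p q = 1 := by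
      rw [Finset.sum_eq_single p (fun q hq hqp => T.lam_of_ne (hFT hq) hqp.symm)
        (fun h => (h hp).elim), T.lam_self (hFT hp)]
    rw [h1, map_smul, map_sum, Finset.sum_congr rfl h2, Finset.sum_sub_distrib, h3,
      Finset.sum_const, hF, nsmul_eq_mul, smul_eq_mul]
    field_simp
    ring
  have hev : ∀ᶠ ε in nhdsWithin (0 : ℝ) (Set.Ioi 0), ∀ p ∈ F, 0 < T.lam p (m + ε • (a' - m)) := by
    rw [Finset.eventually_all]
    intro p hp
    have hc : Continuous fun ε : ℝ => T.lam p (m + ε • (a' - m)) :=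
      (T.continuous_lam p).comp (by fun_prop)
    have h0 : 0 < T.lam p (m + (0 : ℝ) • (a' - m)) := by
      rw [zero_smul, add_zero, hlm p hp]; positivity
    exact (hc.continuousAt.eventually_const_lt h0).filter_mono nhdsWithin_le_nhds
  have hev1 : ∀ᶠ ε in nhdsWithin (0 : ℝ) (Set.Ioi 0), ε < 1 :=
    (continuousAt_id.eventually_lt_const zero_lt_one).filter_mono nhdsWithin_le_nhds
  obtain ⟨ε, hε, hε1, hε0⟩ := (hev.and (hev1.and self_mem_nhdsWithin)).exists
  have hε0 : 0 < ε := hε0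
  set y := m + ε • (a' - m) with hy
  have hyT : y ∈ T.simplex := by
    rw [T.mem_simplex_iff]
    intro p
    by_cases hp : p ∈ T.1
    · rcases hT p hp with rfl | hpF
      · rw [hy, hline]
        have := T.mem_simplex_iff.1 hmT p
        nlinarith
      · exact (hε p hpF).le
    · rw [T.lam_of_notMem hp]
  have hyT' : y ∈ T'.simplex := by
    have h1 := T'.convex_simplex hmT' (T'.subset_simplex ha') (a := 1 - ε) (b := ε) (by linarith)
      hε0.le (by ring)
    convert h1 using 1
    rw [hy, smul_sub, sub_smul, one_smul]
    abel
  refine haT (mem_of_lam_ne_zero (T := T') T.2.1 hyT' hyT ?_)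
  have h1 : 0 ≤ T'.lam a' m := T'.mem_simplex_iff.1 hmT' a'
  rw [hy, hline, T'.lam_self ha']
  nlinarith

open Classical in
lemma opposite_notMem {T T' : M.Cell} (h : T ≠ T') {F : Finset (Space d)} {a' : Space d}
    (hFT : F ⊆ T.1) (haF : insert a' F = T'.1) : a' ∉ T.1 := by
  intro ha
  refine h (Subtype.ext (Finset.eq_of_subset_of_card_le ?_ ?_).symm)
  · rw [← haF]
    exact Finset.insert_subset ha hFT
  · rw [T.card_eq, T'.card_eq]

/-- A facet belongs to at most two elements. -/
lemma eq_or_eq_of_isFacet (hd : 1 ≤ d) {T T' T'' : M.Cell} {F : Finset (Space d)}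
    (hne : T ≠ T') (hF : T.IsFacet F) (hF' : T'.IsFacet F) (hF'' : T''.IsFacet F) :
    T'' = T ∨ T'' = T' := by
  classical
  by_contra! h
  obtain ⟨a, ha, haF⟩ := hF.exists_opposite
  obtain ⟨a', ha', haF'⟩ := hF'.exists_opposite
  obtain ⟨a'', ha'', haF''⟩ := hF''.exists_opposite
  have hT : ∀ q ∈ T.1, q = a ∨ q ∈ F := fun q hq => by rwa [← haF, Finset.mem_insert] at hq
  have hT' : ∀ q ∈ T'.1, q = a' ∨ q ∈ F := fun q hq => by rwa [← haF', Finset.mem_insert] at hq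
  have m' : a' ∈ T'.1 := haF' ▸ Finset.mem_insert_self a' F
  have m'' : a'' ∈ T''.1 := haF'' ▸ Finset.mem_insert_self a'' F
  have h1 := lam_opposite_neg hd hF.2 hF.1 hF'.1 hT ha m' (opposite_notMem hne hF.1 haF')
  have h2 := lam_opposite_neg hd hF.2 hF.1 hF''.1 hT ha m'' (opposite_notMem h.1.symm hF.1 haF'')
  have h3 := lam_opposite_neg hd hF.2 hF'.1 hF''.1 hT' ha' m''
    (opposite_notMem h.2.symm hF'.1 haF'')
  have h4 : T.lam a a'' = T'.lam a' a'' * T.lam a a' := by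
    rw [T'.affine_eq_sum (T.lam a) a'']
    refine Finset.sum_eq_single a' (fun q hq hqa => ?_) (fun h => (h m').elim)
    have hqF := (hT' q hq).resolve_left hqa
    rw [T.lam_of_ne (hF.1 hqF) (ne_of_mem_of_not_mem hqF ha).symm, mul_zero]
  nlinarith [mul_pos_of_neg_of_neg h3 h1]

end Cell

/-- Two distinct elements have the common facet `F`, which is not part of the boundary. -/
structure IsInteriorFacet (F : Finset (Space d)) (T T' : M.Cell) : Prop where
  ne : T ≠ T'
  left : T.IsFacet F
  right : T'.IsFacet F
  interior : ¬ convexHull ℝ (F : Set (Space d)) ⊆ frontier M.Ω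

lemma IsInteriorFacet.symm {F : Finset (Space d)} {T T' : M.Cell} (h : IsInteriorFacet F T T') :
    IsInteriorFacet F T' T := ⟨h.ne.symm, h.right, h.left, h.interior⟩

open Classical in
/-- The weak gradient may be tested with the bubble function of an interior facet. -/
lemma IsInteriorFacet.integral_bubble_eq_zero (hd : 1 ≤ d) {F : Finset (Space d)} {T T' : M.Cell}
    (h : IsInteriorFacet F T T') (hug : HasWeakGradient M.Ω u g) (hu : IntegrableOn u M.Ω)
    (hg : IntegrableOn g M.Ω) (e : Space d) :
    ((∫ x in T.simplex, u x * fderiv ℝ (T.bubble F) x e) +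
      ∫ x in T.simplex, inner ℝ (g x) e * T.bubble F x) +
    ((∫ x in T'.simplex, u x * fderiv ℝ (T'.bubble F) x e) +
      ∫ x in T'.simplex, inner ℝ (g x) e * T'.bubble F x) = 0 := by
  -- a point of another element at which the bubble function does not vanish would make `F` a facet
  have hother {S S' : M.Cell} (hS : F ⊆ S.1) (hS' : ¬ F ⊆ S'.1) {x : Space d} (hx : x ∈ S.simplex)
      (hx' : x ∈ S'.simplex) : S.bubble F x = 0 := by
    rw [Cell.bubble_eq_zero_iff hS]
    by_contra! h0
    exact hS' fun p hp => Cell.mem_of_lam_ne_zero S'.2.1 hx hx' (h0 p hp)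
  let f (S : M.Cell) : Space d → ℝ := if F ⊆ S.1 then S.bubble F else fun _ => 0
  have hfS {S : M.Cell} (hS : F ⊆ S.1) : f S = S.bubble F := if_pos hS
  have hfn {S : M.Cell} (hS : ¬ F ⊆ S.1) : f S = fun _ => 0 := if_neg hS
  have key := sum_integral_eq_zero hug hu hg (f := f) (fun S => ?_) (fun S x hx => ?_)
    (fun S S' x hx hx' => ?_) (fun S x hx hxf => ?_) e
  · have h2 : ∀ S : M.Cell, S ∉ ({T, T'} : Finset M.Cell) →
        ((∫ x in S.simplex, u x * fderiv ℝ (f S) x e) +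
          ∫ x in S.simplex, inner ℝ (g x) e * f S x) = 0 := by
      intro S hS
      have hSF : ¬ F ⊆ S.1 := fun hSF => by
        rcases Cell.eq_or_eq_of_isFacet hd h.ne h.left h.right ⟨hSF, h.left.2⟩ with rfl | rfl <;>
          simp at hS
      rw [hfn hSF]
      simp
    rw [← Finset.sum_subset (Finset.subset_univ {T, T'}) fun S _ hS => h2 S hS,
      Finset.sum_pair h.ne, hfS h.left.1, hfS h.right.1] at key
    exact key
  · by_cases hS : F ⊆ S.1
    · rw [hfS hS]; exact S.contDiff_mono _ (n := 1)
    · rw [hfn hS]; exact contDiff_const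
  · by_cases hS : F ⊆ S.1
    · rw [hfS hS]; exact S.mono_nonneg _ hx
    · rw [hfn hS]
  · by_cases hS : F ⊆ S.1 <;> by_cases hS' : F ⊆ S'.1
    · rw [hfS hS, hfS hS', Cell.bubble_eq_prod hS, Cell.bubble_eq_prod hS']
      exact Finset.prod_congr rfl fun p _ => Cell.lam_eq_lam hx hx' p
    · rw [hfS hS, hfn hS', hother hS hS' hx hx']
    · rw [hfn hS, hfS hS', hother hS' hS hx' hx]
    · rw [hfn hS, hfn hS']
  · by_cases hS : F ⊆ S.1
    · rw [hfS hS, Cell.bubble_eq_zero_iff hS]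
      by_contra! h0
      obtain ⟨B, hB, hBf⟩ := M.frontier_resolved
      rw [hBf, Set.mem_iUnion₂] at hxf
      obtain ⟨s, hs, hxs⟩ := hxf
      have hFs : F ⊆ s := fun p hp => Cell.mem_of_lam_ne_zero (hB s hs).1 hx hxs (h0 p hp)
      have hFs : F = s := Finset.eq_of_subset_of_card_le hFs (by rw [(hB s hs).2, h.left.2])
      refine h.interior ?_
      rw [hBf, hFs]
      exact Set.subset_biUnion_of_mem (u := fun F : Finset (Space d) =>
        convexHull ℝ (F : Set (Space d))) hs
    · rw [hfn hS]

/-- The constant in the estimates for mean values on elements with a common facet. -/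
noncomputable def facetConst (d : ℕ) (χ : ℝ) : ℝ := (d ^ 2 * χ + 1) / Cell.momentRatio d (d - 1)

lemma facetConst_nonneg {χ : ℝ} (hχ : 0 ≤ χ) : 0 ≤ facetConst d χ :=
  div_nonneg (by positivity) (Cell.momentRatio_pos _ _).le

lemma Cell.bubble_abs_le_one (T : M.Cell) (F : Finset (Space d)) {x : Space d}
    (hx : x ∈ T.simplex) : |T.bubble F x| ≤ 1 := by
  rw [Cell.bubble, abs_of_nonneg (T.mono_nonneg _ hx)]
  exact T.mono_le_one _ hx

open Classical in
/-- The mean values on two elements with a common interior facet differ by a quantity that is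
controlled by the gradient. -/
theorem IsInteriorFacet.vol_mul_abs_avg_sub_le (hd : 1 ≤ d) {F : Finset (Space d)} {T T' : M.Cell}
    (h : IsInteriorFacet F T T') {χ : ℝ} (hT : T.IsRegular χ) (hT' : T'.IsRegular χ)
    (hug : HasWeakGradient M.Ω u g) (hu : IntegrableOn u M.Ω) (hg : IntegrableOn g M.Ω) :
    T.vol * |T.avg u - T'.avg u| ≤
      facetConst d χ * (T.diam * ((∫ x in T.simplex, ‖g x‖) + ∫ x in T'.simplex, ‖g x‖)) := by
  obtain ⟨a, ha, haF⟩ := h.left.exists_opposite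
  obtain ⟨a', ha', haF'⟩ := h.right.exists_opposite
  obtain ⟨p, hp⟩ : F.Nonempty := Finset.card_pos.1 (by rw [h.left.2]; exact hd)
  have haT : a ∈ T.1 := haF ▸ Finset.mem_insert_self a F
  have hχ := hT.nonneg
  -- with this direction of differentiation the barycentric coordinate of `a` has derivative `1`
  set e := a - p with he
  have hea : T.dlam a e = 1 := by
    rw [he, T.dlam_sub, T.lam_self haT, T.lam_of_ne (h.left.1 hp) (ne_of_mem_of_not_mem hp ha).symm,
      sub_zero]
  have hnorm : ‖e‖ ≤ T.diam := by
    rw [he, ← dist_eq_norm]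
    exact T.dist_le_diam (T.subset_simplex haT) (T.subset_simplex (h.left.1 hp))
  set k := Cell.momentRatio d (d - 1) with hk
  have hk0 : 0 < k := Cell.momentRatio_pos _ _
  -- the case of constant functions yields the relation between the volumes
  have hvol : T.vol + T'.dlam a' e * T'.vol = 0 := by
    have h1 := hasWeakGradient_const M.Ω (1 : ℝ)
    have hi : IntegrableOn (fun _ : Space d => (1 : ℝ)) M.Ω := M.integrableOn_const_Ω 1
    have hi0 : IntegrableOn (fun _ : Space d => (0 : Space d)) M.Ω := integrableOn_zero
    have e1 := h.integral_bubble_eq_zero hd h1 hi hi0 e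
    have e2 := T.abs_integral_fderiv_bubble_le hT h1 hi hi0 h.left.2 ha haF e
    have e3 := T'.abs_integral_fderiv_bubble_le hT' h1 hi hi0 h.left.2 ha' haF' e
    simp only [norm_zero, integral_zero, mul_zero, abs_nonpos_iff, integral_const, inner_zero_left,
      zero_mul, smul_eq_mul, mul_one, add_zero, hea, measureReal_restrict_apply_univ] at e1 e2 e3
    have : k * (T.vol + T'.dlam a' e * T'.vol) = 0 := by
      rw [Cell.vol, Cell.vol]; linarith
    exact (mul_eq_zero.1 this).resolve_left hk0.ne'
  have e1 := h.integral_bubble_eq_zero hd hug hu hg e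
  have e2 := T.abs_integral_fderiv_bubble_le hT hug hu hg h.left.2 ha haF e
  have e3 := T'.abs_integral_fderiv_bubble_le hT' hug hu hg h.left.2 ha' haF' e
  have e4 := T.abs_integral_inner_mul_le hg (φ := T.bubble F) (fun x => T.bubble_abs_le_one F) e
  have e5 := T'.abs_integral_inner_mul_le hg (φ := T'.bubble F) (fun x => T'.bubble_abs_le_one F) e
  rw [hea, mul_one, ← T.vol_mul_avg u] at e2
  rw [mul_assoc k, ← T'.vol_mul_avg u, ← mul_assoc (T'.dlam a' e),
    eq_neg_of_add_eq_zero_right hvol] at e3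
  set I := ∫ x in T.simplex, ‖g x‖ with hI
  set I' := ∫ x in T'.simplex, ‖g x‖ with hI'
  have hI0 : 0 ≤ I := integral_nonneg fun x => norm_nonneg _
  have hI0' : 0 ≤ I' := integral_nonneg fun x => norm_nonneg _
  have h6 : k * (T.vol * |T.avg u - T'.avg u|) ≤ (d ^ 2 * χ + 1) * (‖e‖ * (I + I')) := by
    have : k * (T.vol * |T.avg u - T'.avg u|) = |k * (T.vol * (T.avg u - T'.avg u))| := by
      rw [abs_mul, abs_mul, abs_of_pos hk0, abs_of_pos T.vol_pos]
    rw [this, abs_le]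
    rw [abs_le] at e2 e3 e4 e5
    constructor <;> nlinarith
  rw [facetConst, div_mul_eq_mul_div, le_div_iff₀ hk0, mul_comm]
  refine h6.trans ?_
  gcongr

open Classical in
/-- Poincaré's inequality for the mean value, on an element with a facet on which the trace
vanishes. -/
theorem vol_mul_abs_avg_le (hd : 1 ≤ d) {F : Finset (Space d)} {T : M.Cell}
    (hF : T.IsFacet F) (hΓ : convexHull ℝ (F : Set (Space d)) ⊆ M.Γ) {χ : ℝ} (hT : T.IsRegular χ)
    (hug : HasWeakGradient M.Ω u g) (hu : IntegrableOn u M.Ω) (hg : IntegrableOn g M.Ω)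
    (h0 : M.HasZeroTrace u g) :
    T.vol * |T.avg u| ≤ facetConst d χ * (T.diam * ∫ x in T.simplex, ‖g x‖) := by
  obtain ⟨a, ha, haF⟩ := hF.exists_opposite
  obtain ⟨p, hp⟩ : F.Nonempty := Finset.card_pos.1 (by rw [hF.2]; exact hd)
  have haT : a ∈ T.1 := haF ▸ Finset.mem_insert_self a F
  have hχ := hT.nonneg
  set e := a - p with he
  have hea : T.dlam a e = 1 := by
    rw [he, T.dlam_sub, T.lam_self haT, T.lam_of_ne (hF.1 hp) (ne_of_mem_of_not_mem hp ha).symm,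
      sub_zero]
  have hnorm : ‖e‖ ≤ T.diam := by
    rw [he, ← dist_eq_norm]
    exact T.dist_le_diam (T.subset_simplex haT) (T.subset_simplex (hF.1 hp))
  set k := Cell.momentRatio d (d - 1) with hk
  have hk0 : 0 < k := Cell.momentRatio_pos _ _
  have e1 := h0 T F hF hΓ (T.bubble F) (T.contDiff_mono _ (n := ⊤)) (fun F' hF' hne x hx => ?_) e
  · have hcd : ContDiff ℝ 1 (T.bubble F) := T.contDiff_mono _ (n := 1)
    rw [integral_add (T.integrableOn_mul hu
      ((hcd.continuous_fderiv one_ne_zero).clm_apply continuous_const))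
      (T.integrableOn_mul (integrable_inner_const hg e) hcd.continuous)] at e1
    have e2 := T.abs_integral_fderiv_bubble_le hT hug hu hg hF.2 ha haF e
    have e4 := T.abs_integral_inner_mul_le hg (φ := T.bubble F) (fun x => T.bubble_abs_le_one F) e
    rw [hea, mul_one, ← T.vol_mul_avg u] at e2
    set I := ∫ x in T.simplex, ‖g x‖ with hI
    have hI0 : 0 ≤ I := integral_nonneg fun x => norm_nonneg _
    have h6 : k * (T.vol * |T.avg u|) ≤ (d ^ 2 * χ + 1) * (‖e‖ * I) := by
      have : k * (T.vol * |T.avg u|) = |k * (T.vol * T.avg u)| := by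
        rw [abs_mul, abs_mul, abs_of_pos hk0, abs_of_pos T.vol_pos]
      rw [this, abs_le]
      rw [abs_le] at e2 e4
      constructor <;> nlinarith
    rw [facetConst, div_mul_eq_mul_div, le_div_iff₀ hk0, mul_comm]
    refine h6.trans ?_
    gcongr
  · rw [Cell.bubble_eq_zero_iff hF.1]
    obtain ⟨q, hq, hqF⟩ : ∃ q ∈ F, q ∉ F' := by
      by_contra! hsub
      exact hne (Finset.eq_of_subset_of_card_le hsub (by rw [hF'.2, hF.2])).symm
    exact ⟨q, hq, ((T.mem_convexHull_iff hF'.1).1 hx).2 q hqF⟩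

end Triangulation

/-! ### Piecewise affine functions -/

variable {d : ℕ}

/-- The gradient of an affine function. -/
noncomputable def affineGrad (f : Space d →ᵃ[ℝ] ℝ) : Space d :=
  (InnerProductSpace.toDual ℝ (Space d)).symm f.linear.toContinuousLinearMap

lemma inner_affineGrad (f : Space d →ᵃ[ℝ] ℝ) (e : Space d) :
    inner ℝ (affineGrad f) e = f.linear e :=
  InnerProductSpace.toDual_symm_apply

lemma exists_polyFun_eq_affine (f : Space d →ᵃ[ℝ] ℝ) :
    ∃ P : MvPolynomial (Fin d) ℝ, P.totalDegree ≤ 1 ∧ ∀ x, polyFun P x = f x := by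
  refine ⟨MvPolynomial.C (f 0) + ∑ i, MvPolynomial.C (f.linear (EuclideanSpace.single i 1)) *
    MvPolynomial.X i, ?_, fun x => ?_⟩
  · refine (MvPolynomial.totalDegree_add _ _).trans (max_le (by simp) ?_)
    refine MvPolynomial.totalDegree_finsetSum_le fun i _ => ?_
    refine (MvPolynomial.totalDegree_mul _ _).trans ?_
    simp [MvPolynomial.totalDegree_X]
  · have h1 : f x = f.linear x + f 0 := by
      have := f.map_vadd 0 x
      simpa using this
    have h2 : x = ∑ i, x i • (EuclideanSpace.single i (1 : ℝ) : Space d) := by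
      ext j
      simp [Finset.sum_apply, Pi.single_apply]
    rw [h1]
    conv_rhs => rw [h2]
    simp [polyFun, map_sum, mul_comm, add_comm]

namespace Triangulation

variable {M : Triangulation d}

lemma integrableOn_stepFun {E : Type*} [NormedAddCommGroup E] {w : M.Cell → Space d → E}
    (hw : ∀ T, Continuous (w T)) : IntegrableOn (stepFun w) M.Ω := by
  rw [integrableOn_Ω_iff]
  intro T
  exact ((hw T).continuousOn.integrableOn_compact (isCompact_simplex T)).congr
    ((stepFun_ae w T).mono fun x hx => hx.symm)

lemma memLp_top_stepFun {E : Type*} [NormedAddCommGroup E] {w : M.Cell → Space d → E}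
    (hw : ∀ T, Continuous (w T)) : MemLp (stepFun w) ∞ (volume.restrict M.Ω) := by
  choose C hC using fun T : M.Cell =>
    (isCompact_simplex T).exists_bound_of_continuousOn (hw T).continuousOn
  refine memLp_top_of_bound (integrableOn_stepFun hw).aestronglyMeasurable (∑ T, |C T|) ?_
  rw [ae_Ω_iff]
  intro T
  filter_upwards [stepFun_ae w T, ae_restrict_mem (isCompact_simplex T).measurableSet] with x hx hxT
  rw [hx]
  exact (hC T x hxT).trans ((le_abs_self _).trans
    (Finset.single_le_sum (f := fun T => |C T|) (fun _ _ => abs_nonneg _) (Finset.mem_univ T)))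

/-- A piecewise affine function has a weak gradient if the affine functions agree where elements
meet, with the possible exception of a set of points that almost every line in a given direction
avoids. -/
theorem hasWeakGradient_stepFun {f : M.Cell → Space d →ᵃ[ℝ] ℝ} {S : Set (Space d)}
    (hS : ∀ e, volume {x : Space d | ∃ t : ℝ, x + t • e ∈ S} = 0)
    (hf : ∀ T T' : M.Cell, ∀ x, x ∈ T.simplex → x ∈ T'.simplex → x ∈ M.Ω → x ∉ S →
      f T x = f T' x) :
    HasWeakGradient M.Ω (stepFun fun T x => f T x) (stepFun fun T _ => affineGrad (f T)) := by
  classical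
  intro φ h1 h2 h3 e
  have hfc (T : M.Cell) : Continuous (f T) := (f T).continuous_of_finiteDimensional
  have hfd (T : M.Cell) : ContDiff ℝ 1 (f T) := by
    have : (f T : Space d → ℝ) = fun x => (f T).linear.toContinuousLinearMap x + f T 0 := by
      ext x
      simpa using (f T).map_vadd 0 x
    rw [this]
    exact (ContinuousLinearMap.contDiff _).add contDiff_const
  obtain ⟨L, hL⟩ := exists_lipschitzOn hfd
  let W (x : Space d) : ℝ :=
    if h : x ∈ M.Ω ∧ ∃ T : M.Cell, x ∈ T.simplex then f h.2.choose x else 0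
  have hWΩ {x : Space d} (hx : x ∉ M.Ω) : W x = 0 := dif_neg fun h => hx h.1
  have hW {T : M.Cell} {x : Space d} (hx : x ∈ T.simplex) (hxΩ : x ∈ M.Ω) (hxS : x ∉ S) :
      W x = f T x := by
    have h : x ∈ M.Ω ∧ ∃ T : M.Cell, x ∈ T.simplex := ⟨hxΩ, T, hx⟩
    simp only [W, dif_pos h]
    exact hf _ _ x h.2.choose_spec hx hxΩ hxS
  have hWi {T : M.Cell} {x : Space d} (hx : x ∈ interior T.simplex) : W x = f T x := by
    have h : x ∈ M.Ω ∧ ∃ T : M.Cell, x ∈ T.simplex :=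
      ⟨T.interior_subset_domain hx, T, interior_subset hx⟩
    simp only [W, dif_pos h]
    rw [← Cell.eq_of_mem_interior hx h.2.choose_spec]
  have hWstep : ∀ᵐ x ∂volume.restrict M.Ω, W x = stepFun (fun T x => f T x) x := by
    rw [ae_Ω_iff]
    intro T
    filter_upwards [T.ae_interior] with x hx
    rw [hWi hx, stepFun_eq (fun T x => f T x) hx]
  have hWint : Integrable W := by
    have : W = M.Ω.indicator W := by
      ext x
      by_cases hx : x ∈ M.Ω
      · rw [Set.indicator_of_mem hx]
      · rw [Set.indicator_of_notMem hx, hWΩ hx]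
    rw [this, integrable_indicator_iff M.isOpen.measurableSet]
    exact (integrableOn_stepFun hfc).congr (hWstep.mono fun x hx => hx.symm)
  obtain ⟨C, hC⟩ := h1.lipschitzWith_of_hasCompactSupport h2 (by simp)
  obtain ⟨δ, hδ, hδΩ⟩ := IsCompact.exists_cthickening_subset_open h2 M.isOpen h3
  obtain ⟨A, hA⟩ := h1.continuous.bounded_above_of_compact_support h2
  have hA' (t : ℝ) (x : Space d) : ‖φ (x + t • e)‖ ≤ A := hA _
  -- the derivative of the test function is a limit of difference quotients, which are moved to the
  -- piecewise affine function
  have hlim := hC.integral_inv_smul_sub_mul_tendsto_integral_lineDeriv_mul hWint e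
  have hswap (t : ℝ) : ∫ x, t⁻¹ • (φ (x + t • e) - φ x) * W x =
      ∫ x, φ x * (t⁻¹ * (W (x - t • e) - W x)) := by
    have i1 : Integrable fun x => φ (x + t • e) * W x :=
      hWint.bdd_mul (h1.continuous.comp (continuous_add_const _)).aestronglyMeasurable
        (.of_forall (hA' t))
    have i2 : Integrable fun x => φ x * W x :=
      hWint.bdd_mul h1.continuous.aestronglyMeasurable (.of_forall hA)
    have i3 : Integrable fun x => φ x * W (x - t • e) :=
      (hWint.comp_sub_right (t • e)).bdd_mul h1.continuous.aestronglyMeasurable (.of_forall hA)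
    have e1 : ∫ x, φ (x + t • e) * W x = ∫ x, φ x * W (x - t • e) := by
      rw [← integral_add_right_eq_self (fun x => φ x * W (x - t • e)) (t • e)]
      simp only [add_sub_cancel_right]
    calc ∫ x, t⁻¹ • (φ (x + t • e) - φ x) * W x
        = ∫ x, t⁻¹ * (φ (x + t • e) * W x - φ x * W x) :=
          integral_congr_ae (.of_forall fun x => by simp only [smul_eq_mul]; ring)
      _ = t⁻¹ * ((∫ x, φ x * W (x - t • e)) - ∫ x, φ x * W x) := by
          rw [integral_const_mul, integral_sub i1 i2, e1]
      _ = ∫ x, φ x * (t⁻¹ * (W (x - t • e) - W x)) := by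
          rw [← integral_sub i3 i2, ← integral_const_mul]
          exact integral_congr_ae (.of_forall fun x => by ring)
  simp only [hswap] at hlim
  have hsmall : ∀ᶠ t in nhdsWithin (0 : ℝ) (Set.Ioi 0), t * ‖e‖ < δ := by
    have : Continuous fun t : ℝ => t * ‖e‖ := by fun_prop
    exact (this.continuousAt.eventually_lt_const (by simpa using hδ)).filter_mono
      nhdsWithin_le_nhds
  have hlim2 : Filter.Tendsto (fun t : ℝ => ∫ x, φ x * (t⁻¹ * (W (x - t • e) - W x)))
      (nhdsWithin 0 (Set.Ioi 0))
      (nhds (∫ x, φ x * -inner ℝ (stepFun (fun T _ => affineGrad (f T)) x) e)) := by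
    refine tendsto_integral_filter_of_dominated_convergence (fun x => |φ x| * (L * ‖e‖)) ?_ ?_ ?_ ?_
    · exact .of_forall fun t => h1.continuous.aestronglyMeasurable.mul
        (((hWint.comp_sub_right _).sub hWint).aestronglyMeasurable.const_mul _)
    · filter_upwards [hsmall, self_mem_nhdsWithin] with t ht ht0
      have ht0 : 0 < t := ht0
      filter_upwards [measure_eq_zero_iff_ae_notMem.1 (hS e)] with x hx
      have hx : ∀ s : ℝ, x + s • e ∉ S := fun s hs => hx ⟨s, hs⟩
      rw [norm_mul, Real.norm_eq_abs, norm_mul, Real.norm_of_nonneg (inv_pos.2 ht0).le]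
      by_cases hφx : φ x = 0
      · simp [hφx]
      refine mul_le_mul_of_nonneg_left ?_ (abs_nonneg _)
      rw [inv_mul_le_iff₀ ht0]
      have hseg (s : ℝ) (hs : s ∈ Set.Icc (0 : ℝ) 1) : x - (s * t) • e ∈ M.Ω := by
        refine hδΩ (Metric.mem_cthickening_of_dist_le _ x _ _ (subset_tsupport φ hφx) ?_)
        rw [dist_eq_norm, sub_sub_cancel_left, norm_neg, norm_smul, Real.norm_eq_abs,
          abs_of_nonneg (mul_nonneg hs.1 ht0.le)]
        have : s * t * ‖e‖ ≤ t * ‖e‖ :=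
          mul_le_mul_of_nonneg_right (mul_le_of_le_one_left ht0.le hs.2) (norm_nonneg _)
        linarith
      have hnS (s : ℝ) : x - (s * t) • e ∉ S := by
        have := hx (-(s * t))
        rwa [neg_smul, ← sub_eq_add_neg] at this
      have := abs_sub_le_of_eventually (f := fun s => W (x - (s * t) • e)) (L := t * (L * ‖e‖)) ?_
      · simpa using this
      · intro s hs
        have hcont : Continuous fun s : ℝ => x - (s * t) • e := by fun_prop
        filter_upwards [(hcont.tendsto s).mono_left nhdsWithin_le_nhds
          (eventually_mem_simplex (M := M) (x - (s * t) • e)), self_mem_nhdsWithin] with s' hs' hI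
        obtain ⟨T, hT⟩ := exists_mem_simplex (hseg s' hI)
        rw [hW hT (hseg s' hI) (hnS s'), hW (hs' T hT) (hseg s hs) (hnS s)]
        refine (hL T _ (hs' T hT) _ hT).trans (le_of_eq ?_)
        rw [sub_sub_sub_cancel_left, ← sub_smul, norm_smul, ← sub_mul, norm_mul, Real.norm_eq_abs,
          Real.norm_of_nonneg ht0.le, abs_sub_comm]
        ring
    · exact (h1.continuous.integrable_of_hasCompactSupport h2).norm.mul_const _
    · have hcell : ∀ᵐ x, x ∈ M.Ω → ∃ T : M.Cell, x ∈ interior T.simplex := by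
        rw [← ae_restrict_iff' M.isOpen.measurableSet, ae_Ω_iff]
        intro T
        filter_upwards [T.ae_interior] with x hx using ⟨T, hx⟩
      filter_upwards [hcell] with x hx
      by_cases hxΩ : x ∈ M.Ω
      · obtain ⟨T, hT⟩ := hx hxΩ
        refine tendsto_const_nhds.congr' ?_
        have hcont : Continuous fun t : ℝ => x - t • e := by fun_prop
        have hint : ∀ᶠ t in nhdsWithin (0 : ℝ) (Set.Ioi 0), x - t • e ∈ interior T.simplex := by
          refine Filter.Eventually.filter_mono nhdsWithin_le_nhds
            (hcont.continuousAt.eventually (isOpen_interior.mem_nhds ?_))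
          simpa using hT
        filter_upwards [hint, self_mem_nhdsWithin] with t ht ht0
        have ht0 : 0 < t := ht0
        rw [hWi ht, hWi hT, stepFun_eq _ hT, inner_affineGrad]
        have e1 : f T (x - t • e) = f T x - t * (f T).linear e := by
          have := (f T).map_vadd x (-(t • e))
          simp only [vadd_eq_add, map_neg, map_smul, smul_eq_mul] at this
          rw [sub_eq_neg_add, this]; ring
        rw [e1]
        field_simp
        ring
      · have : φ x = 0 := image_eq_zero_of_notMem_tsupport fun h => hxΩ (h3 h)
        simp only [this, zero_mul]
        exact tendsto_const_nhds
  have key := tendsto_nhds_unique hlim hlim2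
  have e1 : ∫ x in M.Ω, stepFun (fun T x => f T x) x * fderiv ℝ φ x e =
      ∫ x, lineDeriv ℝ φ x e * W x := by
    rw [← setIntegral_eq_integral_of_forall_compl_eq_zero (s := M.Ω)
      (f := fun x => lineDeriv ℝ φ x e * W x) fun x hx => by rw [hWΩ hx, mul_zero]]
    refine integral_congr_ae ?_
    filter_upwards [hWstep] with x hx
    rw [hx, (h1.differentiable (by simp) x).lineDeriv_eq_fderiv, mul_comm]
  rw [e1, key, ← integral_neg,
    ← setIntegral_eq_integral_of_forall_compl_eq_zero (s := M.Ω) fun x hx => by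
      rw [image_eq_zero_of_notMem_tsupport fun h => hx (h3 h), zero_mul]]
  exact integral_congr_ae (.of_forall fun x => by ring)

/-- A criterion for a piecewise affine function to belong to the finite element space. -/
lemma memLagrange_stepFun {K : ℕ} (hK : 1 ≤ K) {f : M.Cell → Space d →ᵃ[ℝ] ℝ} {S : Set (Space d)}
    (hS : ∀ e, volume {x : Space d | ∃ t : ℝ, x + t • e ∈ S} = 0)
    (hf : ∀ T T' : M.Cell, ∀ x, x ∈ T.simplex → x ∈ T'.simplex → x ∈ M.Ω → x ∉ S →
      f T x = f T' x)
    (hΓ : ∀ (T : M.Cell) (F : Finset (Space d)), T.IsFacet F →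
      convexHull ℝ (F : Set (Space d)) ⊆ M.Γ → ∀ x ∈ convexHull ℝ (F : Set (Space d)), f T x = 0) :
    M.MemLagrange K (stepFun fun T x => f T x) := by
  refine ⟨⟨_, memLp_top_stepFun fun T => (f T).continuous_of_finiteDimensional,
    memLp_top_stepFun fun T => continuous_const, hasWeakGradient_stepFun hS hf⟩, fun T => ?_⟩
  obtain ⟨P, hP, hPf⟩ := exists_polyFun_eq_affine (f T)
  refine ⟨P, hP.trans hK, ae_restrict_of_ae ?_, fun F hF hFΓ x hx => ?_⟩
  · rw [← ae_restrict_iff' (isCompact_simplex T).measurableSet]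
    filter_upwards [stepFun_ae (fun T x => f T x) T] with x hx
    rw [hx]
    exact (hPf x).symm
  · exact (hPf x).trans (hΓ T F hF hFΓ x hx)

end Triangulation

namespace Triangulation

/-! ### Averaging of nodal values -/

variable {d : ℕ} {M : Triangulation d}

/-- The graph on the elements in which neighbors share an interior facet that contains the given
vertex. -/
def vertexGraph (M : Triangulation d) (z : Space d) : SimpleGraph M.Cell where
  Adj T T' := ∃ F, z ∈ F ∧ IsInteriorFacet F T T'
  symm := ⟨fun _ _ h => h.imp fun _ hF => ⟨hF.1, hF.2.symm⟩⟩
  loopless := ⟨fun _ ⟨_, _, h⟩ => h.ne rfl⟩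

lemma mem_of_vertexGraph_walk {z : Space d} {T T' : M.Cell} (p : (M.vertexGraph z).Walk T T')
    (hz : z ∈ T.1) : ∀ S ∈ p.support, z ∈ S.1 := by
  induction p with
  | nil => simpa using hz
  | cons h p ih =>
    intro S hS
    rw [SimpleGraph.Walk.support_cons, List.mem_cons] at hS
    obtain ⟨F, hzF, hF⟩ := id h
    rcases hS with rfl | hS
    · exact hz
    · exact ih (hF.right.1 hzF) S hS

open Classical in
/-- The elements that share a vertex with a given element. -/
noncomputable def Cell.patch (T : M.Cell) : Finset M.Cell :=
  {T' | T' = T ∨ M.neighborGraph.Adj T T'}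

lemma Cell.mem_patch {T T' : M.Cell} :
    T' ∈ T.patch ↔ T' = T ∨ M.neighborGraph.Adj T T' := by simp [Cell.patch]

lemma Cell.mem_patch_of_mem {T T' : M.Cell} {z : Space d} (h : z ∈ T.1) (h' : z ∈ T'.1) :
    T' ∈ T.patch := by
  rw [Cell.mem_patch]
  by_cases hT : T' = T
  · exact .inl hT
  · exact .inr (adj_of_mem (Ne.symm hT) h h')

/-- The values of a cellwise constant function whose jumps across interior facets are controlled. -/
structure JumpBound (a b : M.Cell → ℝ) : Prop where
  nonneg : ∀ T, 0 ≤ b T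
  jump : ∀ F T T', IsInteriorFacet F T T' → |a T - a T'| ≤ b T + b T'
  boundary : ∀ (T : M.Cell) F, T.IsFacet F → convexHull ℝ (F : Set (Space d)) ⊆ M.Γ → |a T| ≤ b T

variable {a b : M.Cell → ℝ}

lemma JumpBound.abs_sub_le_walk (h : JumpBound a b) {z : Space d} {T T' : M.Cell}
    (p : (M.vertexGraph z).Walk T T') :
    |a T - a T'| + b T ≤ 2 * (p.support.map b).sum := by
  induction p with
  | nil =>
    have := h.nonneg
    simp only [sub_self, abs_zero, zero_add, SimpleGraph.Walk.support_nil, List.map_cons,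
      List.map_nil, List.sum_cons, List.sum_nil, add_zero]
    linarith [h.nonneg ‹_›]
  | cons hadj p ih =>
    rename_i T S T'
    have h1 : |a T - a S| ≤ b T + b S := by
      obtain ⟨F, -, hF⟩ := id hadj
      exact h.jump F _ _ hF
    have h2 := abs_sub_le (a T) (a S) (a T')
    rw [SimpleGraph.Walk.support_cons, List.map_cons, List.sum_cons]
    linarith

lemma JumpBound.abs_sub_le (h : JumpBound a b) {z : Space d} {T T' : M.Cell} (hz : z ∈ T.1)
    (hT : (M.vertexGraph z).Reachable T T') : |a T - a T'| ≤ 2 * ∑ S ∈ T.patch, b S := by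
  classical
  obtain ⟨q⟩ := hT
  let p := q.toPath
  have h1 := h.abs_sub_le_walk p.1
  have h2 : (p.1.support.map b).sum = ∑ S ∈ p.1.support.toFinset, b S :=
    (List.sum_toFinset b p.2.support_nodup).symm
  have h3 : ∑ S ∈ p.1.support.toFinset, b S ≤ ∑ S ∈ T.patch, b S := by
    refine Finset.sum_le_sum_of_subset_of_nonneg (fun S hS => ?_) fun S _ _ => h.nonneg S
    exact Cell.mem_patch_of_mem hz (mem_of_vertexGraph_walk p.1 hz S (List.mem_toFinset.1 hS))
  linarith [h.nonneg T]

open Classical in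
/-- A nodal value at `z`, as seen from the element `T`: a vanishing value, if the elements that are
connected with `T` by interior facets containing `z` reach `Γ`, and else the value of `a` on a
representative of these elements. -/
noncomputable def nodalValue (a : M.Cell → ℝ) (z : Space d) (T : M.Cell) : ℝ :=
  if ∃ (T' : M.Cell) (F : Finset (Space d)), (M.vertexGraph z).Reachable T T' ∧ z ∈ F ∧
    T'.IsFacet F ∧ convexHull ℝ (F : Set (Space d)) ⊆ M.Γ
  then 0 else a ((M.vertexGraph z).connectedComponentMk T).out

lemma nodalValue_eq_of_reachable {z : Space d} {T T' : M.Cell}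
    (h : (M.vertexGraph z).Reachable T T') : nodalValue a z T = nodalValue a z T' := by
  have h1 : (M.vertexGraph z).connectedComponentMk T = (M.vertexGraph z).connectedComponentMk T' :=
    SimpleGraph.ConnectedComponent.sound h
  have h2 (S : M.Cell) : (M.vertexGraph z).Reachable T S ↔ (M.vertexGraph z).Reachable T' S :=
    ⟨fun hS => h.symm.trans hS, fun hS => h.trans hS⟩
  unfold nodalValue
  rw [h1]
  congr 1
  simp only [h2]

lemma nodalValue_eq_zero {z : Space d} {T : M.Cell} {F : Finset (Space d)} (hz : z ∈ F)
    (hF : T.IsFacet F) (hΓ : convexHull ℝ (F : Set (Space d)) ⊆ M.Γ) : nodalValue a z T = 0 :=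
  if_pos ⟨T, F, .refl T, hz, hF, hΓ⟩

lemma JumpBound.abs_nodalValue_sub_le (h : JumpBound a b) {z : Space d} {T : M.Cell}
    (hz : z ∈ T.1) : |nodalValue a z T - a T| ≤ 3 * ∑ S ∈ T.patch, b S := by
  have h0 : 0 ≤ ∑ S ∈ T.patch, b S := Finset.sum_nonneg fun S _ => h.nonneg S
  rw [nodalValue, abs_sub_comm]
  split_ifs with hex
  · obtain ⟨T', F, hr, hzF, hF, hΓ⟩ := hex
    have h1 := h.abs_sub_le hz hr
    have h2 := h.boundary T' F hF hΓ
    have h3 : b T' ≤ ∑ S ∈ T.patch, b S :=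
      Finset.single_le_sum (fun S _ => h.nonneg S) (Cell.mem_patch_of_mem hz (hF.1 hzF))
    have h4 := _root_.abs_sub_le (a T) (a T') 0
    rw [sub_zero (a T')] at h4
    linarith
  · have hr : (M.vertexGraph z).Reachable T ((M.vertexGraph z).connectedComponentMk T).out :=
      SimpleGraph.ConnectedComponent.exact (Quot.out_eq _).symm
    linarith [h.abs_sub_le hz hr]

/-- The affine functions given by the nodal values. -/
noncomputable def nodalAverage (a : M.Cell → ℝ) (T : M.Cell) : Space d →ᵃ[ℝ] ℝ :=
  ∑ z ∈ T.1, nodalValue a z T • T.lam z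

lemma nodalAverage_apply (a : M.Cell → ℝ) (T : M.Cell) (x : Space d) :
    nodalAverage a T x = ∑ z ∈ T.1, nodalValue a z T * T.lam z x := by
  have (s : Finset (Space d)) : (∑ z ∈ s, nodalValue a z T • T.lam z) x =
      ∑ z ∈ s, nodalValue a z T * T.lam z x := by
    classical
    induction s using Finset.induction_on with
    | empty => simp
    | insert z s hz ih => rw [Finset.sum_insert hz, Finset.sum_insert hz, ← ih]; simp
  exact this T.1

lemma JumpBound.abs_nodalAverage_sub_le (h : JumpBound a b) {T : M.Cell} {x : Space d}
    (hx : x ∈ T.simplex) : |nodalAverage a T x - a T| ≤ 3 * ∑ S ∈ T.patch, b S := by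
  have h1 : nodalAverage a T x - a T = ∑ z ∈ T.1, T.lam z x * (nodalValue a z T - a T) := by
    simp only [mul_sub, Finset.sum_sub_distrib, ← Finset.sum_mul]
    rw [T.sum_lam, one_mul, nodalAverage_apply]
    simp only [mul_comm]
  rw [h1]
  calc |∑ z ∈ T.1, T.lam z x * (nodalValue a z T - a T)|
      ≤ ∑ z ∈ T.1, T.lam z x * (3 * ∑ S ∈ T.patch, b S) := by
        refine (Finset.abs_sum_le_sum_abs _ _).trans (Finset.sum_le_sum fun z hz => ?_)
        have h0 := T.mem_simplex_iff.1 hx z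
        rw [abs_mul, abs_of_nonneg h0]
        exact mul_le_mul_of_nonneg_left (h.abs_nodalValue_sub_le hz) h0
    _ = 3 * ∑ S ∈ T.patch, b S := by rw [← Finset.sum_mul, T.sum_lam, one_mul]

lemma nodalAverage_eq_sum_facet {T : M.Cell} {F : Finset (Space d)} (hF : F ⊆ T.1) {x : Space d}
    (hx : x ∈ convexHull ℝ (F : Set (Space d))) :
    nodalAverage a T x = ∑ z ∈ F, nodalValue a z T * T.lam z x := by
  rw [nodalAverage_apply, ← Finset.sum_subset hF fun z _ hz => by
    rw [((T.mem_convexHull_iff hF).1 hx).2 z hz, mul_zero]]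

/-- The faces of the triangulation of codimension at least two. -/
def lowSkeleton (M : Triangulation d) : Set (Space d) :=
  ⋃ s ∈ {s | s ∈ M.complex.faces ∧ s.card + 1 ≤ d}, convexHull ℝ (s : Set (Space d))

lemma volume_lowSkeleton_add_line (e : Space d) :
    volume {x : Space d | ∃ t : ℝ, x + t • e ∈ M.lowSkeleton} = 0 := by
  have h : {x : Space d | ∃ t : ℝ, x + t • e ∈ M.lowSkeleton} =
      ⋃ s ∈ {s | s ∈ M.complex.faces ∧ s.card + 1 ≤ d},
        {x : Space d | ∃ t : ℝ, x + t • e ∈ convexHull ℝ (s : Set (Space d))} := by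
    ext x
    simp only [lowSkeleton, Set.mem_iUnion, Set.mem_ofPred_eq, exists_prop]
    constructor
    · rintro ⟨t, s, hs, ht⟩
      exact ⟨s, hs, t, ht⟩
    · rintro ⟨s, hs, t, ht⟩
      exact ⟨t, s, hs, ht⟩
  rw [h, measure_biUnion_null_iff (M.finite_faces.subset fun s hs => hs.1).countable]
  exact fun s hs => volume_convexHull_add_line s hs.2 e

/-- The affine functions given by the nodal values agree where elements meet in the domain, except
on faces of codimension two: there the point lies in an interior facet. -/
lemma nodalAverage_eq {T T' : M.Cell} {x : Space d} (hx : x ∈ T.simplex) (hx' : x ∈ T'.simplex)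
    (hΩ : x ∈ M.Ω) (hS : x ∉ M.lowSkeleton) : nodalAverage a T x = nodalAverage a T' x := by
  classical
  rcases eq_or_ne T T' with rfl | hne
  · rfl
  set F := T.1 ∩ T'.1 with hF
  have hxF : x ∈ convexHull ℝ (F : Set (Space d)) := by
    rw [hF, Finset.coe_inter]
    exact Cell.inter_subset T T' ⟨hx, hx'⟩
  have hne' : F.Nonempty := by
    rw [← Finset.coe_nonempty, ← convexHull_nonempty_iff (𝕜 := ℝ)]
    exact ⟨x, hxF⟩
  have hface : F ∈ M.complex.faces :=
    M.complex.down_closed T.2.1 Finset.inter_subset_left hne'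
  have hcard : F.card = d := by
    have h1 : F.card ≤ d := Cell.ne_inter_card hne
    by_contra hlt
    exact hS (Set.mem_biUnion (show F ∈ {s | s ∈ M.complex.faces ∧ s.card + 1 ≤ d} from
      ⟨hface, by omega⟩) hxF)
  have hint : IsInteriorFacet F T T' := by
    refine ⟨hne, ⟨Finset.inter_subset_left, hcard⟩, ⟨Finset.inter_subset_right, hcard⟩, fun h => ?_⟩
    have := h hxF
    rw [M.isOpen.frontier_eq] at this
    exact this.2 hΩ
  rw [nodalAverage_eq_sum_facet hint.left.1 hxF, nodalAverage_eq_sum_facet hint.right.1 hxF]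
  refine Finset.sum_congr rfl fun z hz => ?_
  have hadj : (M.vertexGraph z).Adj T T' := ⟨F, hz, hint⟩
  rw [nodalValue_eq_of_reachable hadj.reachable, Cell.lam_eq_lam hx hx']

/-- The average of nodal values belongs to the finite element space. -/
theorem memLagrange_nodalAverage {K : ℕ} (hK : 1 ≤ K) (a : M.Cell → ℝ) :
    M.MemLagrange K (stepFun fun T x => nodalAverage a T x) := by
  refine memLagrange_stepFun hK volume_lowSkeleton_add_line
    (fun T T' x hx hx' hΩ hS => nodalAverage_eq hx hx' hΩ hS) fun T F hF hΓ x hx => ?_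
  rw [nodalAverage_eq_sum_facet hF.1 hx]
  exact Finset.sum_eq_zero fun z hz => by rw [nodalValue_eq_zero hz hF hΓ, zero_mul]

end Triangulation

/-! ### Stability of the gradients -/

namespace GrowthBound

variable {ι : Type} [Fintype ι] {G : SimpleGraph ι} {μ : ι → ℝ} {d : ℕ} {B η : ℝ}

lemma sum_adj_le [DecidableRel G.Adj] (h : GrowthBound G μ d B η) (i : ι) :
    ∑ j with G.Adj i j, μ j ≤ (B * 2 ^ d * η) * μ i := by
  have h1 := h i 1
  simp only [SimpleGraph.dist_eq_one_iff_adj, pow_one] at h1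
  refine le_trans (le_of_eq ?_) (h1.trans (le_of_eq ?_))
  · congr!
  · norm_num

lemma le_of_adj (h : GrowthBound G μ d B η) (hμ : ∀ i, 0 < μ i) {i j : ι} (hij : G.Adj i j) :
    μ j ≤ (B * 2 ^ d * η) * μ i := by
  classical
  refine le_trans ?_ (h.sum_adj_le i)
  exact Finset.single_le_sum (f := μ) (fun k _ => (hμ k).le) (by simpa using hij)

/-- A bound for the degrees of the vertices of the graph. -/
lemma card_adj_le [DecidableRel G.Adj] (h : GrowthBound G μ d B η) (hμ : ∀ i, 0 < μ i)
    (hN : 0 ≤ B * 2 ^ d * η) (i : ι) :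
    ((Finset.univ.filter fun j => G.Adj i j).card : ℝ) ≤ (B * 2 ^ d * η) ^ 2 := by
  have h1 : ((Finset.univ.filter fun j => G.Adj i j).card : ℝ) * μ i ≤
      (B * 2 ^ d * η) * ∑ j with G.Adj i j, μ j := by
    rw [← nsmul_eq_mul, ← Finset.sum_const, Finset.mul_sum]
    refine Finset.sum_le_sum fun j hj => ?_
    exact h.le_of_adj hμ (Finset.mem_filter.1 hj).2.symm
  have h2 := mul_le_mul_of_nonneg_left (h.sum_adj_le i) hN
  refine le_of_mul_le_mul_right ?_ (hμ i)
  linarith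

end GrowthBound

namespace Triangulation

variable {d : ℕ} {M : Triangulation d}

lemma Cell.mem_patch_comm {T T' : M.Cell} : T' ∈ T.patch ↔ T ∈ T'.patch := by
  rw [Cell.mem_patch, Cell.mem_patch, eq_comm, SimpleGraph.adj_comm]

/-- The sum over the neighboring elements is bounded in weighted `ℓ²`-norms. -/
lemma sum_patch_sq_le {μ r f : M.Cell → ℝ} {N m γ : ℝ} (hμ : ∀ T, 0 < μ T)
    (hμN : ∀ T T', M.neighborGraph.Adj T T' → μ T' ≤ N * μ T) (hN : 1 ≤ N)
    (hm : ∀ T : M.Cell, (T.patch.card : ℝ) ≤ m) (hr : ∀ T, 0 < r T)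
    (hrγ : ∀ T T', M.neighborGraph.Adj T T' → r T' ≤ γ * r T) (hγ : 1 ≤ γ) :
    ∑ T, μ T * (r T * ∑ S ∈ T.patch, f S) ^ 2 ≤
      m ^ 2 * (N * γ ^ 2) * ∑ T, μ T * (r T * f T) ^ 2 := by
  classical
  have hNγ : 1 ≤ N * γ ^ 2 := one_le_mul_of_one_le_of_one_le hN (one_le_pow₀ hγ)
  have h1 (T S : M.Cell) (hS : S ∈ T.patch) : μ T * r T ^ 2 ≤ N * γ ^ 2 * (μ S * r S ^ 2) := by
    have h0 : 0 < μ S * r S ^ 2 := mul_pos (hμ S) (pow_pos (hr S) 2)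
    rcases Cell.mem_patch.1 hS with rfl | hadj
    · exact le_mul_of_one_le_left h0.le hNγ
    · have h2 := hμN S T hadj.symm
      have h3 := pow_le_pow_left₀ (hr T).le (hrγ S T hadj.symm) 2
      calc μ T * r T ^ 2 ≤ (N * μ S) * (γ * r S) ^ 2 :=
            mul_le_mul h2 h3 (sq_nonneg _) (by have := hμ S; positivity)
        _ = _ := by ring
  have h2 (T : M.Cell) : μ T * (r T * ∑ S ∈ T.patch, f S) ^ 2 ≤
      m * (N * γ ^ 2) * ∑ S ∈ T.patch, μ S * (r S * f S) ^ 2 := by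
    have h3 := sq_sum_le_card_mul_sum_sq (s := T.patch) (f := f)
    have h4 : 0 ≤ ∑ S ∈ T.patch, f S ^ 2 := Finset.sum_nonneg fun _ _ => sq_nonneg _
    have h5 : (∑ S ∈ T.patch, f S) ^ 2 ≤ m * ∑ S ∈ T.patch, f S ^ 2 :=
      h3.trans (mul_le_mul_of_nonneg_right (hm T) h4)
    calc μ T * (r T * ∑ S ∈ T.patch, f S) ^ 2
        = (μ T * r T ^ 2) * (∑ S ∈ T.patch, f S) ^ 2 := by ring
      _ ≤ (μ T * r T ^ 2) * (m * ∑ S ∈ T.patch, f S ^ 2) :=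
          mul_le_mul_of_nonneg_left h5 (mul_nonneg (hμ T).le (sq_nonneg _))
      _ = m * ∑ S ∈ T.patch, (μ T * r T ^ 2) * f S ^ 2 := by rw [← Finset.mul_sum]; ring
      _ ≤ m * ∑ S ∈ T.patch, N * γ ^ 2 * (μ S * r S ^ 2) * f S ^ 2 := by
          refine mul_le_mul_of_nonneg_left (Finset.sum_le_sum fun S hS => ?_)
            (le_trans (Nat.cast_nonneg _) (hm T))
          exact mul_le_mul_of_nonneg_right (h1 T S hS) (sq_nonneg _)
      _ = _ := by
          rw [Finset.mul_sum, Finset.mul_sum]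
          exact Finset.sum_congr rfl fun S _ => by ring
  refine (Finset.sum_le_sum fun T _ => h2 T).trans ?_
  rw [← Finset.mul_sum]
  rcases isEmpty_or_nonempty M.Cell with hE | ⟨⟨T₀⟩⟩
  · simp
  have hm0 : 0 ≤ m := le_trans (Nat.cast_nonneg _) (hm T₀)
  have h3 : ∑ T : M.Cell, ∑ S ∈ T.patch, μ S * (r S * f S) ^ 2 ≤
      m * ∑ T, μ T * (r T * f T) ^ 2 := by
    rw [Finset.sum_comm' (s' := fun S : M.Cell => S.patch) (t' := Finset.univ)
      fun T S => by simp [Cell.mem_patch_comm (T := T)], Finset.mul_sum]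
    refine Finset.sum_le_sum fun S _ => ?_
    rw [Finset.sum_const, nsmul_eq_mul]
    exact mul_le_mul_of_nonneg_right (hm S) (mul_nonneg (hμ S).le (sq_nonneg _))
  calc m * (N * γ ^ 2) * ∑ T : M.Cell, ∑ S ∈ T.patch, μ S * (r S * f S) ^ 2
      ≤ m * (N * γ ^ 2) * (m * ∑ T, μ T * (r T * f T) ^ 2) :=
        mul_le_mul_of_nonneg_left h3 (mul_nonneg hm0 (by linarith))
    _ = _ := by ring

/-- On each element, the weak gradient of a function that agrees with a polynomial there is the
gradient of the polynomial. -/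
lemma norm_weakGradient_eq {v : Space d → ℝ} {G : Space d → Space d}
    (hvG : HasWeakGradient M.Ω v G) (hG : IntegrableOn G M.Ω) (T : M.Cell)
    {R : MvPolynomial (Fin d) ℝ} (hR : ∀ᵐ x ∂volume.restrict T.simplex, v x = polyFun R x) :
    ∀ᵐ x ∂volume.restrict T.simplex, ‖G x‖ = ‖fderiv ℝ (polyFun R) x‖ := by
  let D (x : Space d) : Space d :=
    (InnerProductSpace.toDual ℝ (Space d)).symm (fderiv ℝ (polyFun R) x)
  have hR1 := contDiff_polyFun R
  have hDc : Continuous D :=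
    (InnerProductSpace.toDual ℝ (Space d)).symm.continuous.comp
      (hR1.continuous_fderiv (by simp))
  have hGT : IntegrableOn G T.simplex := integrableOn_Ω_iff.1 hG T
  have hDT : IntegrableOn D T.simplex := hDc.continuousOn.integrableOn_compact (isCompact_simplex T)
  have hsub : IntegrableOn (fun x => G x - D x) (interior T.simplex) :=
    (hGT.sub hDT).mono_set interior_subset
  have key := isOpen_interior.ae_eq_zero_of_integral_contDiff_smul_eq_zero (μ := volume)
    hsub.locallyIntegrableOn fun φ h1 h2 h3 => ?_
  · filter_upwards [ae_restrict_of_ae key, T.ae_interior] with x hx hxT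
    rw [sub_eq_zero.1 (hx hxT)]
    exact LinearIsometryEquiv.norm_map _ _
  -- test with `φ`, which is supported in the interior of the element
  · have hφT {x : Space d} (hx : x ∉ T.simplex) : φ x = 0 :=
      image_eq_zero_of_notMem_tsupport fun h => hx (interior_subset (h3 h))
    have hdφT {x : Space d} (hx : x ∉ T.simplex) : fderiv ℝ φ x = 0 :=
      image_eq_zero_of_notMem_tsupport fun h =>
        hx (interior_subset (h3 (tsupport_fderiv_subset ℝ h)))
    have hφΩ : tsupport φ ⊆ M.Ω := h3.trans T.interior_subset_domain
    have hφn {x : Space d} (hx : x ∉ M.Ω) : φ x = 0 :=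
      image_eq_zero_of_notMem_tsupport fun h => hx (hφΩ h)
    have hdφn {x : Space d} (hx : x ∉ M.Ω) : fderiv ℝ φ x = 0 :=
      image_eq_zero_of_notMem_tsupport fun h => hx (hφΩ (tsupport_fderiv_subset ℝ h))
    have hi : IntegrableOn (fun x => φ x • (G x - D x)) T.simplex :=
      (hGT.sub hDT).continuousOn_smul h1.continuous.continuousOn (isCompact_simplex T)
    rw [← setIntegral_eq_integral_of_forall_compl_eq_zero (s := T.simplex) fun x hx => by
      rw [hφT hx, zero_smul]]
    refine ext_inner_right ℝ fun e => ?_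
    rw [inner_zero_left, real_inner_comm, ← integral_inner hi]
    have hw := hvG φ h1 h2 hφΩ e
    rw [setIntegral_eq_integral_of_forall_compl_eq_zero (s := M.Ω) fun x hx => by
        rw [hdφn hx, _root_.zero_apply, mul_zero],
      setIntegral_eq_integral_of_forall_compl_eq_zero (s := M.Ω) fun x hx => by
        rw [hφn hx, mul_zero],
      ← setIntegral_eq_integral_of_forall_compl_eq_zero (s := T.simplex) fun x hx => by
        rw [hdφT hx, _root_.zero_apply, mul_zero],
      ← setIntegral_eq_integral_of_forall_compl_eq_zero (s := T.simplex)
        (f := fun x => inner ℝ (G x) e * φ x) fun x hx => by rw [hφT hx, mul_zero]] at hw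
    have hcf : Continuous fun x => fderiv ℝ φ x e :=
      (h1.continuous_fderiv (by simp)).clm_apply continuous_const
    have hcR : Continuous fun x => fderiv ℝ (polyFun R) x e :=
      (hR1.continuous_fderiv (by simp)).clm_apply continuous_const
    have hparts := integral_mul_fderiv_eq_neg_fderiv_mul_of_integrable (μ := volume) (v := e)
      (f := polyFun R) (g := φ)
      ((hcR.mul h1.continuous).integrable_of_hasCompactSupport h2.mul_left)
      ((hR1.continuous.mul hcf).integrable_of_hasCompactSupport (h2.fderiv_apply ℝ e).mul_left)
      ((hR1.continuous.mul h1.continuous).integrable_of_hasCompactSupport h2.mul_left)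
      (fun x _ => differentiable_polyFun R x) (fun x _ => h1.differentiable (by simp) x)
    rw [← setIntegral_eq_integral_of_forall_compl_eq_zero (s := T.simplex) fun x hx => by
        rw [hdφT hx, _root_.zero_apply, mul_zero],
      ← setIntegral_eq_integral_of_forall_compl_eq_zero (s := T.simplex)
        (f := fun x => fderiv ℝ (polyFun R) x e * φ x) fun x hx => by rw [hφT hx, mul_zero]]
      at hparts
    have e1 : ∫ x in T.simplex, v x * fderiv ℝ φ x e =
        ∫ x in T.simplex, polyFun R x * fderiv ℝ φ x e := by
      refine integral_congr_ae ?_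
      filter_upwards [hR] with x hx
      rw [hx]
    have e2 : ∫ x in T.simplex, inner ℝ (G x) e * φ x =
        ∫ x in T.simplex, fderiv ℝ (polyFun R) x e * φ x := by linarith
    have i1 : IntegrableOn (fun x => inner ℝ (G x) e * φ x) T.simplex :=
      T.integrableOn_mul (integrable_inner_const hG e) h1.continuous
    have i2 : IntegrableOn (fun x => fderiv ℝ (polyFun R) x e * φ x) T.simplex :=
      (hcR.mul h1.continuous).continuousOn.integrableOn_compact (isCompact_simplex T)
    calc ∫ x in T.simplex, inner ℝ e (φ x • (G x - D x))
        = ∫ x in T.simplex, (inner ℝ (G x) e * φ x - fderiv ℝ (polyFun R) x e * φ x) := by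
          refine integral_congr_ae (.of_forall fun x => ?_)
          dsimp only
          rw [inner_smul_right, inner_sub_right, real_inner_comm, real_inner_comm (D x)]
          have : inner ℝ (D x) e = fderiv ℝ (polyFun R) x e :=
            InnerProductSpace.toDual_symm_apply
          rw [this]; ring
      _ = 0 := by rw [integral_sub i1 i2, e2, sub_self]

end Triangulation

namespace Triangulation

variable {d : ℕ} {M : Triangulation d} {u : Space d → ℝ} {g : Space d → Space d}

namespace MeshBounds

variable {w : M.Cell → ℝ} {γ κ χ : ℝ}

/-- A bound for the ratio of the volumes of neighboring elements. -/
noncomputable def volRatio (d : ℕ) (γ κ χ : ℝ) : ℝ := max 1 ((κ ^ 2 * χ) ^ d * 2 ^ d * γ ^ d)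

lemma one_le_volRatio (d : ℕ) (γ κ χ : ℝ) : 1 ≤ volRatio d γ κ χ := le_max_left _ _

lemma vol_le (h : MeshBounds M w γ κ χ) (T T' : M.Cell) (hadj : M.neighborGraph.Adj T T') :
    T'.vol ≤ volRatio d γ κ χ * T.vol :=
  (h.growthBound.le_of_adj (fun T => T.vol_pos) hadj).trans
    (mul_le_mul_of_nonneg_right (le_max_right _ _) T.vol_pos.le)

lemma card_patch_le (h : MeshBounds M w γ κ χ) (T : M.Cell) :
    (T.patch.card : ℝ) ≤ volRatio d γ κ χ ^ 2 + 1 := by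
  classical
  have hκ := h.κ_pos
  have hχ := h.χ_pos
  have hγ := h.one_le
  have h0 : 0 ≤ (κ ^ 2 * χ) ^ d * 2 ^ d * γ ^ d := by positivity
  have h1 := h.growthBound.card_adj_le (fun T => T.vol_pos) h0 T
  have h2 := pow_le_pow_left₀ h0 (le_max_right 1 _) 2
  have h3 : T.patch ⊆ insert T (Finset.univ.filter fun S => M.neighborGraph.Adj T S) := by
    intro S hS
    rw [Finset.mem_insert, Finset.mem_filter]
    rcases Cell.mem_patch.1 hS with h | h
    · exact .inl h
    · exact .inr ⟨Finset.mem_univ _, h⟩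
  have h4 := (Finset.card_le_card h3).trans (Finset.card_insert_le _ _)
  have h5 : (T.patch.card : ℝ) ≤
      ((Finset.univ.filter fun S => M.neighborGraph.Adj T S).card : ℝ) + 1 := by exact_mod_cast h4
  exact h5.trans (add_le_add_left (h1.trans h2) 1)

/-- The constant in the estimate for the jumps of the mean values. -/
noncomputable def jumpConst (d : ℕ) (γ κ χ : ℝ) : ℝ := facetConst d χ * κ * γ * volRatio d γ κ χ

lemma jumpConst_nonneg (h : MeshBounds M w γ κ χ) : 0 ≤ jumpConst d γ κ χ := by
  have h1 := facetConst_nonneg (d := d) h.χ_pos.le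
  have h2 := h.κ_pos
  have h3 := h.one_le
  have h4 := one_le_volRatio d γ κ χ
  exact mul_nonneg (by positivity) (by linarith)

/-- The jumps of the mean values of a Sobolev function are controlled by the gradient. -/
lemma jumpBound_avg (hd : 1 ≤ d) (h : MeshBounds M w γ κ χ) (hug : HasWeakGradient M.Ω u g)
    (hu : IntegrableOn u M.Ω) (hg : IntegrableOn g M.Ω) (h0 : M.HasZeroTrace u g) :
    JumpBound (fun T : M.Cell => T.avg u)
      fun T => jumpConst d γ κ χ * (w T * T.avg fun x => ‖g x‖) := by
  have hG (T : M.Cell) : 0 ≤ T.avg fun x => ‖g x‖ := T.avg_nonneg fun x => norm_nonneg _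
  have hf := facetConst_nonneg (d := d) h.χ_pos.le
  have hκ := h.κ_pos
  have hγ := h.one_le
  have hN := one_le_volRatio d γ κ χ
  have hc : facetConst d χ * κ ≤ jumpConst d γ κ χ := by
    rw [jumpConst, mul_assoc _ γ]
    exact le_mul_of_one_le_right (by positivity) (one_le_mul_of_one_le_of_one_le hγ hN)
  refine ⟨fun T => mul_nonneg h.jumpConst_nonneg (mul_nonneg (h.pos T).le (hG T)),
    fun F T T' hF => ?_, fun T F hF hΓ => ?_⟩
  · have h1 := hF.vol_mul_abs_avg_sub_le hd (h.ball T) (h.ball T') hug hu hg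
    rw [← T.vol_mul_avg, ← T'.vol_mul_avg] at h1
    obtain ⟨z, hz⟩ : F.Nonempty := Finset.card_pos.1 (by rw [hF.left.2]; exact hd)
    have hadj := adj_of_mem hF.ne (hF.left.1 hz) (hF.right.1 hz)
    have h2 : T.vol * |T.avg u - T'.avg u| ≤ T.vol * (facetConst d χ * (T.diam *
        ((T.avg fun x => ‖g x‖) + volRatio d γ κ χ * T'.avg fun x => ‖g x‖))) := by
      refine h1.trans ?_
      have h3 := mul_le_mul_of_nonneg_right (h.vol_le T T' hadj) (hG T')
      calc facetConst d χ * (T.diam * ((T.vol * T.avg fun x => ‖g x‖) +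
            T'.vol * T'.avg fun x => ‖g x‖))
          ≤ facetConst d χ * (T.diam * ((T.vol * T.avg fun x => ‖g x‖) +
            volRatio d γ κ χ * T.vol * T'.avg fun x => ‖g x‖)) := by
            have := T.diam_nonneg
            gcongr
        _ = _ := by ring
    refine (le_of_mul_le_mul_left h2 T.vol_pos).trans ?_
    have hw := h.pos T
    have hG' := hG T'
    have hw' := h.graded T' T hadj.symm
    calc facetConst d χ * (T.diam *
          ((T.avg fun x => ‖g x‖) + volRatio d γ κ χ * T'.avg fun x => ‖g x‖))
        ≤ facetConst d χ * ((κ * w T) *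
          ((T.avg fun x => ‖g x‖) + volRatio d γ κ χ * T'.avg fun x => ‖g x‖)) := by
          have := hG T
          have := h.diam_le T
          gcongr
      _ = (facetConst d χ * κ) * (w T * T.avg fun x => ‖g x‖) +
          (facetConst d χ * κ * volRatio d γ κ χ) * (w T * T'.avg fun x => ‖g x‖) := by ring
      _ ≤ jumpConst d γ κ χ * (w T * T.avg fun x => ‖g x‖) +
          (facetConst d χ * κ * volRatio d γ κ χ) * ((γ * w T') * T'.avg fun x => ‖g x‖) := by
          have := hG T
          gcongr
      _ = _ := by rw [jumpConst]; ring
  · have h1 := vol_mul_abs_avg_le hd hF hΓ (h.ball T) hug hu hg h0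
    rw [← T.vol_mul_avg] at h1
    have h2 : T.vol * |T.avg u| ≤
        T.vol * (facetConst d χ * (T.diam * T.avg fun x => ‖g x‖)) := by
      linarith
    refine (le_of_mul_le_mul_left h2 T.vol_pos).trans ?_
    have := hG T
    have := h.pos T
    calc facetConst d χ * (T.diam * T.avg fun x => ‖g x‖)
        ≤ facetConst d χ * ((κ * w T) * T.avg fun x => ‖g x‖) := by
          have := h.diam_le T
          gcongr
      _ = facetConst d χ * κ * (w T * T.avg fun x => ‖g x‖) := by ring
      _ ≤ _ := by gcongr

lemma sum_patch_le (h : MeshBounds M w γ κ χ) {f : M.Cell → ℝ} (hf : ∀ T, 0 ≤ f T) (T : M.Cell) :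
    ∑ S ∈ T.patch, jumpConst d γ κ χ * (w S * f S) ≤
      jumpConst d γ κ χ * γ * (w T * ∑ S ∈ T.patch, f S) := by
  rw [← Finset.mul_sum, mul_assoc, ← mul_assoc γ, Finset.mul_sum _ _ (γ * w T)]
  refine mul_le_mul_of_nonneg_left (Finset.sum_le_sum fun S hS => ?_) h.jumpConst_nonneg
  refine mul_le_mul_of_nonneg_right ?_ (hf S)
  rcases Cell.mem_patch.1 hS with rfl | hadj
  · exact le_mul_of_one_le_left (h.pos S).le h.one_le
  · exact h.graded T S hadj

end MeshBounds

lemma Cell.mem_patch_self (T : M.Cell) : T ∈ T.patch := Cell.mem_patch.2 (.inl rfl)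

lemma Cell.rms_le_of_abs_le (T : M.Cell) {f : Space d → ℝ} (hf : Continuous f) {s : ℝ}
    (h : ∀ x ∈ T.simplex, |f x| ≤ s) : T.rms f ≤ s := by
  have hs : 0 ≤ s := by
    obtain ⟨x, hx⟩ := T.nonempty_interior
    exact (abs_nonneg _).trans (h x (interior_subset hx))
  have h1 : T.vol * T.rms f ^ 2 ≤ T.vol * s ^ 2 := by
    rw [T.vol_mul_rms_sq]
    have h2 : ∫ x in T.simplex, s ^ 2 = T.vol * s ^ 2 := by
      rw [integral_const, measureReal_restrict_apply_univ, smul_eq_mul, Cell.vol]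
    rw [← h2]
    refine setIntegral_mono_on ((hf.pow 2).continuousOn.integrableOn_compact (isCompact_simplex T))
      (integrable_const _) (isCompact_simplex T).measurableSet fun x hx => ?_
    rw [← sq_abs]
    exact pow_le_pow_left₀ (abs_nonneg _) (h x hx) 2
  exact le_of_sq_le_sq (le_of_mul_le_mul_left h1 T.vol_pos) hs

/-- The local projection of a Sobolev function minus an affine function that is close to its mean
value. -/
lemma Cell.rms_le_of_moment (T : M.Cell) {P : MvPolynomial (Fin d) ℝ} {f : Space d →ᵃ[ℝ] ℝ}
    {ci cm β δ : ℝ} (hδ : 0 ≤ δ) (hβ : 0 ≤ β) (hci : 0 ≤ ci) (hcm : 0 ≤ cm)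
    (hu : IntegrableOn u M.Ω) {v : Space d → ℝ}
    (hv : ∀ᵐ x ∂volume.restrict T.simplex, v x = f x)
    (hf : ∀ x ∈ T.simplex, |f x - T.avg u| ≤ β)
    (hP : T.vol * T.rms (polyFun P) ^ 2 = ∫ x in T.simplex, (u x - v x) * polyFun P x)
    (hsup : ∀ x ∈ T.simplex, |polyFun P x| ≤ ci * T.rms (polyFun P))
    (hm : |∫ x in T.simplex, (u x - T.avg u) * polyFun P x| ≤
      cm * T.rms (polyFun P) * (T.vol * δ)) :
    T.rms (polyFun P) ≤ cm * δ + ci * β := by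
  have hfc : Continuous f := f.continuous_of_finiteDimensional
  have huT : IntegrableOn u T.simplex := integrableOn_Ω_iff.1 hu T
  have h0 := T.rms_nonneg (polyFun P)
  refine T.rms_le_of_vol_mul_sq_le (by positivity) ?_
  have i1 : IntegrableOn (fun x => (u x - T.avg u) * polyFun P x) T.simplex :=
    integrableOn_mul_polyFun T (huT.sub (integrable_const _)) P
  have hc2 : Continuous fun x => (f x - T.avg u) * polyFun P x :=
    (hfc.sub continuous_const).mul (continuous_polyFun P)
  have i2 : IntegrableOn (fun x => (f x - T.avg u) * polyFun P x) T.simplex :=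
    hc2.continuousOn.integrableOn_compact (isCompact_simplex T)
  have e1 : ∫ x in T.simplex, (u x - v x) * polyFun P x =
      (∫ x in T.simplex, (u x - T.avg u) * polyFun P x) -
        ∫ x in T.simplex, (f x - T.avg u) * polyFun P x := by
    rw [← integral_sub i1 i2]
    refine integral_congr_ae ?_
    filter_upwards [hv] with x hx
    rw [hx]; ring
  have e2 : |∫ x in T.simplex, (f x - T.avg u) * polyFun P x| ≤
      T.vol * (β * (ci * T.rms (polyFun P))) := by
    have h1 : ∫ x in T.simplex, β * (ci * T.rms (polyFun P)) =
        T.vol * (β * (ci * T.rms (polyFun P))) := by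
      rw [integral_const, measureReal_restrict_apply_univ, smul_eq_mul, Cell.vol]
    rw [← h1, ← Real.norm_eq_abs]
    refine norm_integral_le_of_norm_le (integrable_const _) ?_
    filter_upwards [ae_restrict_mem (isCompact_simplex T).measurableSet] with x hx
    rw [norm_mul]
    exact mul_le_mul (hf x hx) (hsup x hx) (norm_nonneg _) hβ
  rw [hP, e1]
  have := le_abs_self (∫ x in T.simplex, (u x - T.avg u) * polyFun P x)
  have := neg_abs_le (∫ x in T.simplex, (f x - T.avg u) * polyFun P x)
  linarith

/-- The weighted `ℓ²`-bound for the gradients of the projection: the projection is compared with the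
average of nodal values, for which the weights of the mean squares may be divided by the mesh
size. -/
theorem exists_gradedBound_gradient (hd : 1 ≤ d) {K : ℕ} (hK : 1 ≤ K) {γ C γh κ χ : ℝ}
    (hγ : 1 ≤ γ) (hC : 0 ≤ C) (hγh : 1 ≤ γh) :
    ∃ A : ℝ, 0 ≤ A ∧ ∀ (M : Triangulation d) (w : M.Cell → ℝ), MeshBounds M w γh κ χ →
      (∀ ρ, M.IsWeight ρ γ → ∀ u, MemLp u 2 (volume.restrict M.Ω) →
        eLpNorm (fun x => ρ x * M.Q K u x) 2 (volume.restrict M.Ω) ≤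
          ENNReal.ofReal C * eLpNorm (fun x => ρ x * u x) 2 (volume.restrict M.Ω)) →
      ∀ (u : Space d → ℝ) (g : Space d → Space d), HasWeakGradient M.Ω u g →
        IntegrableOn u M.Ω → IntegrableOn g M.Ω → M.HasZeroTrace u g →
        ∃ V : M.Cell → ℝ, (∀ T, 0 ≤ V T) ∧
          GradedBound M.neighborGraph (fun T : M.Cell => T.vol) (γ / γh) A V
            (fun T => T.avg fun x => ‖g x‖) ∧
          ∀ G, HasWeakGradient M.Ω (M.Q K u) G → IntegrableOn G M.Ω →
            ∀ T : M.Cell, ∀ᵐ x ∂volume.restrict T.simplex, ‖G x‖ ≤ V T := by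
  obtain ⟨ci, hci, hinv⟩ := exists_inverse_estimate d K χ
  obtain ⟨cm, hcm, hmom⟩ := Cell.exists_integral_mul_polyFun_le d K χ
  set N := MeshBounds.volRatio d γh κ χ with hN
  have hN1 : 1 ≤ N := MeshBounds.one_le_volRatio d γh κ χ
  set c₁ := MeshBounds.jumpConst d γh κ χ with hc₁
  -- the constants for the distances of `u` and of the nodal averages to the mean values
  set c₂ := 3 * (c₁ * γh) with hc₂
  set c₃ := cm * κ + ci * c₂ with hc₃
  set A2 := 2 * (ci * κ) ^ 2 * (C ^ 2 * c₃ ^ 2 + c₂ ^ 2) * ((N ^ 2 + 1) ^ 2 * (N * γ ^ 2)) with hA2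
  have hA20 : 0 ≤ A2 := by positivity
  refine ⟨√A2, Real.sqrt_nonneg _, fun M w hM hstab u g hug hu hg h0 => ?_⟩
  have hκ := hM.κ_pos
  have hc₁0 : 0 ≤ c₁ := hM.jumpConst_nonneg
  have hc₂0 : 0 ≤ c₂ := by positivity
  have hc₃0 : 0 ≤ c₃ := by positivity
  have hjump := hM.jumpBound_avg hd hug hu hg h0
  set f : M.Cell → Space d →ᵃ[ℝ] ℝ := nodalAverage fun T => T.avg u with hf
  set v : Space d → ℝ := stepFun fun T x => f T x with hv
  have hvK : M.MemLagrange K v := memLagrange_nodalAverage hK _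
  have hvT (T : M.Cell) : ∀ᵐ x ∂volume.restrict T.simplex, v x = f T x :=
    stepFun_ae (fun T x => f T x) T
  have hQ := isL2Projection_Q K hu
  -- the sums of the gradients over the patches
  let s (T : M.Cell) : ℝ := ∑ S ∈ T.patch, S.avg fun x => ‖g x‖
  have hG (T : M.Cell) : 0 ≤ T.avg fun x => ‖g x‖ := T.avg_nonneg fun x => norm_nonneg _
  have hs (T : M.Cell) : 0 ≤ s T := Finset.sum_nonneg fun S _ => hG S
  have hGs (T : M.Cell) : (T.avg fun x => ‖g x‖) ≤ s T :=
    Finset.single_le_sum (fun S _ => hG S) T.mem_patch_self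
  have hfa (T : M.Cell) : ∀ x ∈ T.simplex, |f T x - T.avg u| ≤ c₂ * (w T * s T) := by
    intro x hx
    refine (hjump.abs_nodalAverage_sub_le hx).trans ?_
    have := hM.sum_patch_le hG T
    rw [hc₂]
    linarith
  have hws (T : M.Cell) : 0 ≤ w T * s T := mul_nonneg (hM.pos T).le (hs T)
  -- the projection of `u - v` is `Q u - v`
  have hv2 := memLp_two_of_memLagrange hvK
  have hvi : IntegrableOn v M.Ω := integrableOn_of_memLp one_le_two hv2
  have hproj : M.IsL2Projection K (fun x => u x - v x) (fun x => M.Q K u x - v x) := by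
    have e : (fun x => M.Q K u x - v x) = M.Q K u + (-1 : ℝ) • v := by
      ext x; simp; ring
    refine ⟨e ▸ memLagrange_add hQ.1 (memLagrange_smul hvK _), fun φ hφ => ?_⟩
    have hφ2 := memLp_two_of_memLagrange hφ
    have hQ2 := memLp_two_of_memLagrange hQ.1
    have hφ1 := hφ.1.choose_spec.1
    have i1 : IntegrableOn (fun x => M.Q K u x * φ x) M.Ω := hQ2.integrable_mul hφ2
    have i2 : IntegrableOn (fun x => v x * φ x) M.Ω := hv2.integrable_mul hφ2
    have i3 : IntegrableOn (fun x => u x * φ x) M.Ω :=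
      memLp_one_iff_integrable.1 (hφ1.mul (memLp_one_iff_integrable.2 hu) : MemLp _ 1 _)
    simp only [sub_mul]
    rw [integral_sub i1 i2, integral_sub i3 i2, hQ.2 φ hφ]
  obtain ⟨P, hPd, hP, hgb⟩ := exists_gradedBound hγ hC hstab (hu.sub hvi) hproj
  have hPs (T : M.Cell) : T.rms (polyFun (P T)) ≤ c₃ * (w T * s T) := by
    obtain ⟨x₀, r, hr, hball, hdiam⟩ := hM.ball T
    obtain ⟨h1, -, -⟩ := hinv M T x₀ r hr hball hdiam (P T) (hPd T)
    have hmean : ∫ x in T.simplex, (u x - T.avg u) = 0 := by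
      rw [integral_sub (integrableOn_Ω_iff.1 hu T) (integrable_const _), integral_const,
        measureReal_restrict_apply_univ, smul_eq_mul, ← T.vol_mul_avg u, Cell.vol, sub_self]
    have h2 := hmom M T x₀ r hr hball hdiam _ g
      (hug.sub_const hu (M.integrableOn_const_Ω 1) (T.avg u))
      (hu.sub (M.integrableOn_const_Ω _)) hg hmean (P T) (hPd T)
    rw [← T.vol_mul_avg fun x => ‖g x‖, mul_left_comm T.diam] at h2
    have h3 := T.rms_le_of_moment (mul_nonneg T.diam_nonneg (hG T)) (mul_nonneg hc₂0 (hws T)) hci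
      hcm hu (hvT T) (hfa T) (hP T) h1 h2
    have h4 : T.diam * (T.avg fun x => ‖g x‖) ≤ κ * (w T * s T) := by
      have := hM.pos T
      rw [← mul_assoc]
      exact mul_le_mul (hM.diam_le T) (hGs T) (hG T) (by positivity)
    calc T.rms (polyFun (P T)) ≤ cm * (κ * (w T * s T)) + ci * (c₂ * (w T * s T)) :=
          h3.trans (add_le_add_left (mul_le_mul_of_nonneg_left h4 hcm) _)
      _ = _ := by rw [hc₃]; ring
  let V (T : M.Cell) : ℝ :=
    ci * κ * ((w T)⁻¹ * T.rms (fun x => M.Q K u x - v x) + c₂ * s T)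
  refine ⟨V, fun T => ?_, fun r hr hrγ => ?_, fun G hQG hGi T => ?_⟩
  · have h1 := T.rms_nonneg (fun x => M.Q K u x - v x)
    have h2 := hM.pos T
    have h3 := hs T
    positivity
  · -- the weights `r / w` have grading `γ`
    have hγ' : ∀ T T', M.neighborGraph.Adj T T' → r T' / w T' ≤ γ * (r T / w T) := by
      intro T T' hadj
      have h1 := hrγ T T' hadj
      have h2 := hM.graded T' T hadj.symm
      have h3 := hM.pos T
      have h4 := hM.pos T'
      have h5 := hr T
      rw [div_le_iff₀ h4]
      calc r T' ≤ γ / γh * r T := h1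
        _ = γ / γh * r T / w T * w T := by field_simp
        _ ≤ γ / γh * r T / w T * (γh * w T') := by gcongr
        _ = γ * (r T / w T) * w T' := by field_simp
    have hrγ' : ∀ T T', M.neighborGraph.Adj T T' → r T' ≤ γ * r T := fun T T' hadj =>
      (hrγ T T' hadj).trans (mul_le_mul_of_nonneg_right (div_le_self (by linarith) hγh) (hr T).le)
    have h1 := hgb (fun T => r T / w T) (fun T => div_pos (hr T) (hM.pos T)) hγ'
    have h2 := sum_patch_sq_le (f := fun T => T.avg fun x => ‖g x‖) (fun T : M.Cell => T.vol_pos)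
      hM.vol_le hN1 hM.card_patch_le hr hrγ' hγ
    have h3 : ∑ T : M.Cell, T.vol * (r T / w T * T.rms (polyFun (P T))) ^ 2 ≤
        c₃ ^ 2 * ∑ T : M.Cell, T.vol * (r T * s T) ^ 2 := by
      rw [Finset.mul_sum]
      refine Finset.sum_le_sum fun T _ => ?_
      have hr := hr T
      have hw := hM.pos T
      have h4 : r T / w T * T.rms (polyFun (P T)) ≤ c₃ * (r T * s T) := by
        calc r T / w T * T.rms (polyFun (P T)) ≤ r T / w T * (c₃ * (w T * s T)) :=
              mul_le_mul_of_nonneg_left (hPs T) (by positivity)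
          _ = c₃ * (r T * s T) := by field_simp
      calc T.vol * (r T / w T * T.rms (polyFun (P T))) ^ 2 ≤ T.vol * (c₃ * (r T * s T)) ^ 2 :=
            mul_le_mul_of_nonneg_left (pow_le_pow_left₀
              (mul_nonneg (by positivity) (T.rms_nonneg _)) h4 2) T.vol_pos.le
        _ = _ := by ring
    have h5 : ∑ T : M.Cell, T.vol * (r T * V T) ^ 2 ≤
        2 * (ci * κ) ^ 2 * ((∑ T : M.Cell,
          T.vol * (r T / w T * T.rms (fun x => M.Q K u x - v x)) ^ 2) +
          c₂ ^ 2 * ∑ T : M.Cell, T.vol * (r T * s T) ^ 2) := by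
      rw [Finset.mul_sum, ← Finset.sum_add_distrib, Finset.mul_sum]
      refine Finset.sum_le_sum fun T _ => ?_
      set X := r T / w T * T.rms (fun x => M.Q K u x - v x) with hX
      have e : r T * V T = ci * κ * (X + c₂ * (r T * s T)) := by
        simp only [V, hX, div_eq_mul_inv]; ring
      have h6 : (X + c₂ * (r T * s T)) ^ 2 ≤ 2 * (X ^ 2 + c₂ ^ 2 * (r T * s T) ^ 2) := by
        linarith [sq_nonneg (X - c₂ * (r T * s T)), add_sq X (c₂ * (r T * s T)),
          sub_sq X (c₂ * (r T * s T)), mul_pow c₂ (r T * s T) 2]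
      calc T.vol * (r T * V T) ^ 2
          = (T.vol * (ci * κ) ^ 2) * (X + c₂ * (r T * s T)) ^ 2 := by rw [e]; ring
        _ ≤ (T.vol * (ci * κ) ^ 2) * (2 * (X ^ 2 + c₂ ^ 2 * (r T * s T) ^ 2)) :=
            mul_le_mul_of_nonneg_left h6 (mul_nonneg T.vol_pos.le (sq_nonneg _))
        _ = _ := by ring
    rw [Real.sq_sqrt hA20]
    refine h5.trans ?_
    set Y := ∑ T : M.Cell, T.vol * (r T * s T) ^ 2 with hY
    calc 2 * (ci * κ) ^ 2 * ((∑ T : M.Cell,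
          T.vol * (r T / w T * T.rms (fun x => M.Q K u x - v x)) ^ 2) + c₂ ^ 2 * Y)
        ≤ 2 * (ci * κ) ^ 2 * (C ^ 2 * (c₃ ^ 2 * Y) + c₂ ^ 2 * Y) := by
          have := h1.trans (mul_le_mul_of_nonneg_left h3 (sq_nonneg C))
          gcongr
      _ = 2 * (ci * κ) ^ 2 * (C ^ 2 * c₃ ^ 2 + c₂ ^ 2) * Y := by ring
      _ ≤ 2 * (ci * κ) ^ 2 * (C ^ 2 * c₃ ^ 2 + c₂ ^ 2) * ((N ^ 2 + 1) ^ 2 * (N * γ ^ 2) *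
          ∑ T : M.Cell, T.vol * (r T * T.avg fun x => ‖g x‖) ^ 2) := by
          refine mul_le_mul_of_nonneg_left h2 (by positivity)
      _ = _ := by rw [hA2]; ring
  · -- the inverse estimate on one element, for `Q u - v` and for `v` minus the mean value
    obtain ⟨R, hRd, hR⟩ := hQ.1.exists_polyFun T
    obtain ⟨B, hBd, hB⟩ := exists_polyFun_eq_affine (f T)
    obtain ⟨x₀, r, hr, hball, hdiam⟩ := hM.ball T
    have hR1 : (R - B).totalDegree ≤ K :=
      (MvPolynomial.totalDegree_sub _ _).trans (max_le hRd (hBd.trans hK))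
    have hB1 : (B - MvPolynomial.C (T.avg u)).totalDegree ≤ K :=
      (MvPolynomial.totalDegree_sub _ _).trans (max_le (hBd.trans hK) (by simp))
    obtain ⟨-, h1, -⟩ := hinv M T x₀ r hr hball hdiam _ hR1
    obtain ⟨-, h2, -⟩ := hinv M T x₀ r hr hball hdiam _ hB1
    have e1 : T.rms (polyFun (R - B)) = T.rms (fun x => M.Q K u x - v x) := by
      refine T.rms_congr ?_
      filter_upwards [hR, hvT T] with x hx hx'
      rw [polyFun_sub, hB, hx, hx']
    have e2 : T.rms (polyFun (B - MvPolynomial.C (T.avg u))) ≤ c₂ * (w T * s T) := by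
      refine T.rms_le_of_abs_le (continuous_polyFun _) fun x hx => ?_
      rw [polyFun_sub, polyFun_C, hB]
      exact hfa T x hx
    filter_upwards [norm_weakGradient_eq hQG hGi T hR,
      ae_restrict_mem (isCompact_simplex T).measurableSet] with x hx hxT
    rw [hx]
    have hd1 := differentiable_polyFun (d := d)
    have e3 : fderiv ℝ (polyFun R) x = fderiv ℝ (polyFun (R - B)) x +
        fderiv ℝ (polyFun (B - MvPolynomial.C (T.avg u))) x := by
      have : polyFun R = fun y => polyFun (R - B) y +
          polyFun (B - MvPolynomial.C (T.avg u)) y + T.avg u := by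
        ext y
        rw [polyFun_sub, polyFun_sub, polyFun_C]; ring
      conv_lhs => rw [this]
      rw [fderiv_add_const, fderiv_fun_add (hd1 _ x) (hd1 _ x)]
    have hw := hM.pos T
    have h3 := h1 x hxT
    have h4 := h2 x hxT
    have h5 : w T * ‖fderiv ℝ (polyFun R) x‖ ≤ w T * V T := by
      calc w T * ‖fderiv ℝ (polyFun R) x‖
          ≤ (κ * T.diam) * (‖fderiv ℝ (polyFun (R - B)) x‖ +
            ‖fderiv ℝ (polyFun (B - MvPolynomial.C (T.avg u))) x‖) := by
            rw [e3]
            exact mul_le_mul (hM.le_diam T) (norm_add_le _ _) (norm_nonneg _)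
              (mul_nonneg hκ.le T.diam_nonneg)
        _ = κ * (T.diam * ‖fderiv ℝ (polyFun (R - B)) x‖ +
            T.diam * ‖fderiv ℝ (polyFun (B - MvPolynomial.C (T.avg u))) x‖) := by ring
        _ ≤ κ * (ci * T.rms (polyFun (R - B)) + ci * (c₂ * (w T * s T))) := by
            refine mul_le_mul_of_nonneg_left (add_le_add h3 (h4.trans ?_)) hκ.le
            exact mul_le_mul_of_nonneg_left e2 hci
        _ = w T * V T := by
            simp only [V, e1]
            field_simp
    exact le_of_mul_le_mul_left h5 hw

end Triangulation

open Triangulation in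
theorem exists_gradient_stability {d : ℕ} (hd : 1 ≤ d) (K : ℕ) (hK : 1 ≤ K)
    (𝔉 : Set (Triangulation d)) {p : ℝ≥0∞} (hp : 1 ≤ p) {γρ γh : ℝ} (χ₀ κ : ℝ) (hγρ : 1 ≤ γρ)
    (hγh : 1 ≤ γh)
    (hlt : ENNReal.ofReal (γρ * γh ^ (1 + (d : ℝ) * |1 / 2 - (p⁻¹).toReal|)) < gammaMax 𝔉 K) :
    ∃ c : ℝ≥0, ∀ M ∈ 𝔉, M.ShapeRegular χ₀ → ∀ ρ h : Space d → ℝ,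
      M.IsWeight ρ γρ → M.IsMeshSize h γh κ →
      ∀ (u : Space d → ℝ) (g : Space d → Space d), M.HasSobolevGradientΓ p u g →
        ∃ G : Space d → Space d, HasSobolevGradient M.Ω ∞ (M.Q K u) G ∧
          eLpNorm (fun x => ρ x • G x) p (volume.restrict M.Ω) ≤
            c * eLpNorm (fun x => ρ x • g x) p (volume.restrict M.Ω) := by
  obtain ⟨γ, C, hγ, hγlt, hC, hstab⟩ := exists_stable_of_lt_gammaMax hlt
  obtain ⟨A, hA, hgrad⟩ := exists_gradedBound_gradient hd hK (κ := κ) (χ := χ₀) hγ hC hγh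
  have hγh0 : 0 < γh := by linarith
  have hγlt' : γρ * (γh ^ d) ^ |1 / 2 - (p⁻¹).toReal| < γ / γh := by
    rw [lt_div_iff₀ hγh0]
    refine lt_of_eq_of_lt ?_ hγlt
    rw [Real.rpow_add hγh0, Real.rpow_one, Real.rpow_mul hγh0.le, Real.rpow_natCast]
    ring
  obtain ⟨c, hc, hdisc⟩ := exists_discrete_bound d (B := (|κ| ^ 2 * |χ₀|) ^ d) (C := A)
    (by positivity) hA (one_le_pow₀ hγh : 1 ≤ γh ^ d) hγρ hp hγlt'
  refine ⟨(γρ * 1 * (c + 1)).toNNReal, fun M hM hχ ρ h hρ hh u g hug => ?_⟩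
  have hmesh := hh.meshBounds hd hχ
  obtain ⟨⟨hu, hg, hw⟩, h0⟩ := hug
  have hui := integrableOn_of_memLp hp hu
  have hgi := integrableOn_of_memLp hp hg
  obtain ⟨G, hG⟩ := (isL2Projection_Q K hui).1.1
  refine ⟨G, hG, ?_⟩
  obtain ⟨V, hV, hgb, hVG⟩ := hgrad M _ hmesh (hstab M hM) u g hw hui hgi h0
  have hgr := hmesh.growthBound
  rw [← abs_of_pos hmesh.κ_pos, ← abs_of_pos hmesh.χ_pos] at hgr
  have hlp := hdisc M.Cell M.neighborGraph _ (fun T => T.weight ρ) _ _ M.connected_neighborGraph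
    (fun T => T.vol_pos) hgr (fun T => hρ.weight_pos T) (fun T T' h => hρ.weight_graded h)
    hV (fun T => T.avg_nonneg fun x => norm_nonneg _) hgb
  have hlp' := hlp.mono_const (c' := c + 1) (fun T => T.vol_pos.le) hc (by linarith)
    (fun T => mul_nonneg (hρ.weight_pos T).le (T.avg_nonneg fun x => norm_nonneg _))
  refine eLpNorm_le_of_lpBound (a := 1) hρ hp (by linarith) (by linarith) hgi
    (f := G) hV (fun T => ?_) hlp'
  simpa using hVG G hG.2.2 (integrableOn_of_memLp le_top hG.2.1) T

end FEM

theorem theorem4p14 {d : ℕ} (hd : 1 ≤ d) (K : ℕ) (hK : 1 ≤ K) (𝔉 : Set (FEM.Triangulation d))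
    (p : ℝ≥0∞) (hp : 1 ≤ p) (γρ γh χ₀ κ : ℝ) (hγρ : 1 ≤ γρ) (hγh : 1 ≤ γh) :
    (ENNReal.ofReal (γρ * γh ^ ((d : ℝ) * |1 / 2 - (p⁻¹).toReal|)) < FEM.gammaMax 𝔉 K →
      ∃ c : ℝ≥0, ∀ M ∈ 𝔉, M.ShapeRegular χ₀ → ∀ ρ h : FEM.Space d → ℝ,
        M.IsWeight ρ γρ → M.IsMeshSize h γh κ →
        ∀ u : FEM.Space d → ℝ, MemLp u p (volume.restrict M.Ω) →
          eLpNorm (fun x => ρ x * M.Q K u x) p (volume.restrict M.Ω) ≤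
            c * eLpNorm (fun x => ρ x * u x) p (volume.restrict M.Ω)) ∧
    (ENNReal.ofReal (γρ * γh ^ (1 + (d : ℝ) * |1 / 2 - (p⁻¹).toReal|)) < FEM.gammaMax 𝔉 K →
      ∃ c : ℝ≥0, ∀ M ∈ 𝔉, M.ShapeRegular χ₀ → ∀ ρ h : FEM.Space d → ℝ,
        M.IsWeight ρ γρ → M.IsMeshSize h γh κ →
        ∀ (u : FEM.Space d → ℝ) (g : FEM.Space d → FEM.Space d), M.HasSobolevGradientΓ p u g →
          ∃ G : FEM.Space d → FEM.Space d, FEM.HasSobolevGradient M.Ω ∞ (M.Q K u) G ∧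
            eLpNorm (fun x => ρ x • G x) p (volume.restrict M.Ω) ≤
              c * eLpNorm (fun x => ρ x • g x) p (volume.restrict M.Ω)) :=
  ⟨FEM.exists_Lp_stability hd K 𝔉 hp χ₀ κ hγρ hγh,
    FEM.exists_gradient_stability hd K hK 𝔉 hp χ₀ κ hγρ hγh⟩
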